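/- **Setting.** Let $X_1,X_2,\dots$ be random elements on a probability space $(\Omega,\mathcal F,P)$ (not necessarily independent or identically distributed; known design information may be part of $X_i$), let $\theta_0\in\operatorname{int}(\Theta)$, $\Theta\subseteq\mathbb R^p$, and let $g(X_i,\theta)\in\mathbb R^p$ be an estimating function. Put $$G_n(\theta)=\frac1n\sum_{i=1}^n g(X_i,\theta),\qquad S_n(\theta)=\frac1n\sum_{i=1}^n g(X_i,\theta)g(X_i,\theta)^\top ,$$ and, on an open neighbourhood $\mathcal N$ of $\theta_0$, let $G(\theta)=\lim_n \mathrm E\,G_n(\theta)$ (so $G(\theta)=\mathrm E\,g(X_i,\theta)$ if this does not depend on $i$), where $G(\theta_0)=0$. Let $$l_n(\theta)=-2\log\max\Big\{\prod_{i=1}^n nw_i:\ w_i>0,\ \sum_i w_i=1,\ \sum_i w_i\,g(X_i,\theta)=0\Big\}$$ ($=+\infty$ if there are no such weights). Let $a_n>0$, $a_n\to\infty$. For $j=1,\dots,m$ let $h_j$ be $\mathbb R^{q_j}$-valued with $q_j\ge1$, $H_j=\{\theta\in\Theta:h_j(\theta)=0\}$, $H_0=\bigcap_jH_j$. With $|\cdot|$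 the Euclidean and $\|\cdot\|$ the Frobenius norm, assume: 1. $P(0\in\operatorname{int}\operatorname{conv}\{g(X_i,\theta_0):i\le n\})\to1$. 2. Almost surely all $g(X_i,\cdot)$, and $G$, are $C^1$ on $\mathcal N$; $\sup_{\theta\in\mathcal N}\|\partial_\theta G_n(\theta)-\partial_\theta G(\theta)\|\to_p0$; and $\partial_\theta G(\theta_0)$ is nonsingular. 3. There is a matrix function $V(\theta)$ with $V=V(\theta_0)$ positive definite, $\sup_{\theta\in\mathcal N}\|S_n(\theta)-V(\theta)\|\to_p0$, and $\sup_{|\theta-\theta_0|\le b_n}\|V(\theta)-V(\theta_0)\|\to0$ whenever $b_n\downarrow0$, $b_n>0$. 4. $a_nG_n(\theta_0)\to_dN(0,V)$. 5. $\max_{i\le n}|g(X_i,\theta_0)|=o_P(a_n)$ and $\max_{i\le n}\|\partial_\theta g(X_i,\theta_0)\|=O_P(a_n)$; if $\sqrt n=O(a_n)$ does not hold, then moreover $\max_{i\le n}\sup_{\theta\in\mathcal N}\|\partial_\theta g(X_i,\theta)\|=O_P(a_n)$. 6. Each $h_j$ is $C^1$ on $\mathcal N$ and $J_j=\partial_\theta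 h_j(\theta_0)$ has rank $q_j$. Write $W=\partial_\theta G(\theta_0)^{-1}$. For $K_n>0$ put $$T_{nj}=\frac{a_n^2}{n}\inf\{l_n(\theta):\theta\in H_j,\ |\theta-\theta_0|\le K_n/a_n\},\qquad T_n=(T_{n1},\dots,T_{nm}).$$ For an estimator $\hat\theta$ put $\hat A_j=(J_jW)^\top\big((J_jW)S_n(\hat\theta)(J_jW)^\top\big)^{-1}(J_jW)$ and, given the data $\mathcal X_n=(X_1,\dots,X_n)$, let $U_n\sim N(0,S_n(\hat\theta))$ and $\hat T_n=(U_n^\top\hat A_1U_n,\dots,U_n^\top\hat A_mU_n)$, with conditional law $\hat P_n(\,\cdot\mid\mathcal X_n)$. **Theorem.** There is a sequence $K_n>0$ with $K_n\to\infty$ and $K_n/a_n\to0$ such that for every consistent estimator $\hat\theta$ of $\theta_0$: (a) If $H_0$ is true (that is, $\theta_0\in H_j$ for all $j$), then $$\sup_{x\in\mathbb R^m_+}\Big|\hat P_n(\hat T_n\le x\mid\mathcal X_n)-P(T_n\le x)\Big|\to_p0 .$$ (b) The asymptotic Monte Carlo procedure asymptotically controls the generalized family-wise error rate, whichever of the $H_j$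 are true: for $1\le v\le m$, $\alpha\in(0,1)$ and any $B_n\to\infty$, let $c_\alpha$ be the sample $(1-\alpha)$ quantile of the $v$-th largest components of $B_n$ independent draws from $\hat P_n(\,\cdot\mid\mathcal X_n)$. Then $$\limsup_{n\to\infty}P\big(\#\{j:\theta_0\in H_j,\ T_{nj}>c_\alpha\}\ge v\big)\le\alpha .$$ -/

import Mathlib

open MeasureTheory ProbabilityTheory Filter Topology
open scoped ENNReal Matrix

noncomputable section

namespace EmpLik

/-- Euclidean space `ℝ^p`. -/
abbrev Vec (p : ℕ) : Type := EuclideanSpace ℝ (Fin p)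

/-- The Jacobian matrix of `f` at `θ`. -/
def jacobian {p q : ℕ} (f : Vec p → Vec q) (θ : Vec p) : Matrix (Fin q) (Fin p) ℝ :=
  Matrix.of fun k l => fderiv ℝ f θ (EuclideanSpace.single l (1 : ℝ)) k

/-- The Frobenius norm of a real matrix. -/
def frobNorm {r s : ℕ} (A : Matrix (Fin r) (Fin s) ℝ) : ℝ :=
  √(∑ k, ∑ l, A k l ^ 2)

/-! ### Stochastic order symbols

Suprema are taken in `[0, ∞]`, so that they have no default values. -/

section Order

variable {Ω : Type*} [MeasurableSpace Ω]

/-- `Y n → 0` in probability. -/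
def TendsToZeroInProb (P : Measure Ω) (Y : ℕ → Ω → ℝ≥0∞) : Prop :=
  ∀ ε : ℝ, 0 < ε → Tendsto (fun n => P {ω | ENNReal.ofReal ε ≤ Y n ω}) atTop (𝓝 0)

/-- `Y n = o_P(a n)`. -/
def IsSmallOInProb (P : Measure Ω) (Y : ℕ → Ω → ℝ≥0∞) (a : ℕ → ℝ) : Prop :=
  ∀ ε : ℝ, 0 < ε → Tendsto (fun n => P {ω | ENNReal.ofReal (ε * a n) ≤ Y n ω}) atTop (𝓝 0)

/-- `Y n = O_P(a n)`. -/
def IsBigOInProb (P : Measure Ω) (Y : ℕ → Ω → ℝ≥0∞) (a : ℕ → ℝ) : Prop :=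
  ∀ ε : ℝ, 0 < ε → ∃ M : ℝ, 0 < M ∧
    ∀ᶠ n in atTop, P {ω | ENNReal.ofReal (M * a n) < Y n ω} ≤ ENNReal.ofReal ε

end Order

/-! ### Empirical likelihood -/

section EL

variable {𝒳 : Type*} {p n : ℕ}

/-- The data `X_1, …, X_n`. -/
def sample {Ω : Type*} (X : ℕ → Ω → 𝒳) (n : ℕ) (ω : Ω) : Fin n → 𝒳 := fun i => X i ω

/-- `G_n(θ) = n⁻¹ ∑ g(x_i, θ)`. -/
def meanG (g : 𝒳 → Vec p → Vec p) (x : Fin n → 𝒳) (θ : Vec p) : Vec p :=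
  (n : ℝ)⁻¹ • ∑ i, g (x i) θ

/-- `S_n(θ) = n⁻¹ ∑ g(x_i, θ) g(x_i, θ)ᵀ`. -/
def meanS (g : 𝒳 → Vec p → Vec p) (x : Fin n → 𝒳) (θ : Vec p) : Matrix (Fin p) (Fin p) ℝ :=
  Matrix.of fun k l => (n : ℝ)⁻¹ * ∑ i, g (x i) θ k * g (x i) θ l

/-- The empirical likelihood ratio `max {∏ n w_i : w_i > 0, ∑ w_i = 1, ∑ w_i g(x_i, θ) = 0}`,
which is `0` if there are no such weights. -/
def elRatio (g : 𝒳 → Vec p → Vec p) (x : Fin n → 𝒳) (θ : Vec p) : ℝ≥0∞ :=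
  ⨆ w ∈ {w : Fin n → ℝ | (∀ i, 0 < w i) ∧ ∑ i, w i = 1 ∧ ∑ i, w i • g (x i) θ = 0},
    ENNReal.ofReal (∏ i, (n : ℝ) * w i)

/-- `l_n(θ)`, minus twice the log empirical likelihood ratio; it is `+∞` if the ratio is `0`. -/
def ell (g : 𝒳 → Vec p → Vec p) (x : Fin n → 𝒳) (θ : Vec p) : EReal :=
  (-2 : EReal) * ENNReal.log (elRatio g x θ)

/-- The hypothesis `H = {θ ∈ Θ : h(θ) = 0}`. -/
def nullSet {q : ℕ} (Θ : Set (Vec p)) (h : Vec p → Vec q) : Set (Vec p) :=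
  {θ | θ ∈ Θ ∧ h θ = 0}

/-- The empirical likelihood statistic `(a² / n) inf {l_n(θ) : θ ∈ H, |θ - θ₀| ≤ r}`. -/
def elStat (g : 𝒳 → Vec p → Vec p) (x : Fin n → 𝒳) (a : ℝ) (H : Set (Vec p)) (θ₀ : Vec p)
    (r : ℝ) : EReal :=
  ((a ^ 2 / n : ℝ) : EReal) * ⨅ θ ∈ H ∩ Metric.closedBall θ₀ r, ell g x θ

end EL

/-! ### The asymptotic Monte Carlo scheme -/

section AMC

variable {p m : ℕ}

/-- `Â = Lᵀ (L S Lᵀ)⁻¹ L`, used with `L = J_j W` and `S = S_n(θ̂)`. -/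
def quadMatrix {q : ℕ} (L : Matrix (Fin q) (Fin p) ℝ) (S : Matrix (Fin p) (Fin p) ℝ) :
    Matrix (Fin p) (Fin p) ℝ :=
  Lᵀ * (L * S * Lᵀ)⁻¹ * L

/-- The law of `(Uᵀ Â_1 U, …, Uᵀ Â_m U)` for `U ∼ N(0, S)`; with `S = S_n(θ̂)` this is the
conditional law, given the data, of the simulated statistics. -/
def amcLaw {q : Fin m → ℕ} (L : (j : Fin m) → Matrix (Fin (q j)) (Fin p) ℝ)
    (S : Matrix (Fin p) (Fin p) ℝ) : Measure (Fin m → ℝ) :=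
  (multivariateGaussian (0 : Vec p) S).map
    fun u j => u.ofLp ⬝ᵥ (quadMatrix (L j) S *ᵥ u.ofLp)

/-- The `v`-th largest component of `t`, for `1 ≤ v ≤ m`: the least `c` such that fewer than `v`
components exceed `c`. -/
def vthLargest (v : ℕ) (t : Fin m → ℝ) : ℝ :=
  sInf {c : ℝ | Nat.card {j : Fin m // c < t j} < v}

/-- The sample `(1 - α)` quantile of `Q_1, …, Q_B`. -/
def sampleQuantile {B : ℕ} (α : ℝ) (Q : Fin B → ℝ) : ℝ :=
  sInf {c : ℝ | (1 - α) * B ≤ (Nat.card {b : Fin B // Q b ≤ c} : ℝ)}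

/-- The cutoff computed from `B` simulated vectors of statistics. -/
def amcCutoff {B : ℕ} (v : ℕ) (α : ℝ) (t : Fin B → Fin m → ℝ) : ℝ :=
  sampleQuantile α fun b => vthLargest v (t b)

end AMC

end EmpLik

end

open EmpLik

/-! On the scale `1 / a n` the rescaled statistic is a constrained least squares problem. Write `z =
a n • G_n(θ₀)`, `D` for the Jacobian of `G` at `θ₀`, `V` for `V θ₀`, `J` for a constraint Jacobian
and `L = J D⁻¹`. Uniformly over `|θ - θ₀| ≤ K / a n`, `(a² / n) l_n(θ)` is close to `ζᵀ V⁻¹ ζ` with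
`ζ = a n • G_n(θ)` (`ell_approx_lower`, `ell_approx_upper`). No multiplier equation is solved: the
dual bound `le_ell` holds for every multiplier and is used at `V⁻¹ G_n(θ)`, while the upper bound
uses explicit feasible weights, linear in `g(X_i, θ)`.

Moreover `ζ` is close to `z + D u` with `u = a n • (θ - θ₀)`, and a true hypothesis confines `u`
approximately to `ker J`. So the profile statistic is approximately the minimum of `ζᵀ V⁻¹ ζ` over
`L ζ = L z`. This minimum is `zᵀ A z` with `A = quadMatrix L V`, attained at `V A z`
(`elStat_approx`). The approximation needs `g(X_i, θ)` to be `o(a n)` on the small ball, uniformly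
in `i`, which is `whp_norm_le`. It holds for each fixed radius constant `K`; a diagonal choice gives
`K n → ∞` (`exists_radius`).

By asymptotic normality the vector of forms `zᵀ A_j z` converges to `amcLaw L V`. The simulated law
is the same construction at `S_n(θ̂)`, which is consistent for `V`, so it has the same limit
(`exists_amcLaw_close`). Convergence is expressed by Lévy–Prokhorov inequalities valid for all
events at once. The marginals of the limit have no atoms (`amcLaw_eval_eq_zero`), so enlarging an
event by `η` costs little, uniformly over orthants and over exceedance events. This gives (a) in
`tendsToZeroInProb_cdf_sub`.

For (b), choose `c` so that `v` of the true components exceed `c` with limiting probability slightly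
above `α`. By Chebyshev's inequality the fraction of such draws is above `α`, so the cutoff is at
least `c` with high probability. Simulating all components, rather than only those of true
hypotheses, can only raise the cutoff; hence control holds whichever hypotheses are true
(`limsup_exceed_le`). -/

noncomputable section

namespace EmpLik

/-! ### Matrices acting on Euclidean space -/

section Matrices

variable {p q r : ℕ}

/-- The action of a matrix on Euclidean vectors. -/
def mv (A : Matrix (Fin q) (Fin p) ℝ) (x : Vec p) : Vec q := WithLp.toLp 2 (A *ᵥ x.ofLp)

/-- The quadratic form of a matrix. -/
def qf (A : Matrix (Fin p) (Fin p) ℝ) (x : Vec p) : ℝ := x.ofLp ⬝ᵥ (A *ᵥ x.ofLp)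

lemma mv_add (A : Matrix (Fin q) (Fin p) ℝ) (x y : Vec p) : mv A (x + y) = mv A x + mv A y := by
  simp [mv, Matrix.mulVec_add]

lemma mv_sub (A : Matrix (Fin q) (Fin p) ℝ) (x y : Vec p) : mv A (x - y) = mv A x - mv A y := by
  simp [mv, Matrix.mulVec_sub]

lemma mv_smul (A : Matrix (Fin q) (Fin p) ℝ) (c : ℝ) (x : Vec p) : mv A (c • x) = c • mv A x := by
  simp [mv, Matrix.mulVec_smul]

lemma sub_mv (A B : Matrix (Fin q) (Fin p) ℝ) (x : Vec p) : mv (A - B) x = mv A x - mv B x := by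
  simp [mv, Matrix.sub_mulVec]

lemma mv_mv (A : Matrix (Fin r) (Fin q) ℝ) (B : Matrix (Fin q) (Fin p) ℝ) (x : Vec p) :
    mv A (mv B x) = mv (A * B) x := by
  simp [mv, Matrix.mulVec_mulVec]

lemma mv_one (x : Vec p) : mv 1 x = x := by
  simp [mv]

lemma inner_mv (A : Matrix (Fin q) (Fin p) ℝ) (x : Vec q) (y : Vec p) :
    inner ℝ x (mv A y) = x.ofLp ⬝ᵥ (A *ᵥ y.ofLp) := by
  simp [EuclideanSpace.inner_eq_star_dotProduct, mv, dotProduct_comm]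

lemma qf_eq_inner (A : Matrix (Fin p) (Fin p) ℝ) (x : Vec p) : qf A x = inner ℝ x (mv A x) := by
  rw [inner_mv]; rfl

lemma inner_mv_transpose (A : Matrix (Fin q) (Fin p) ℝ) (x : Vec q) (y : Vec p) :
    inner ℝ (mv Aᵀ x) y = inner ℝ x (mv A y) := by
  rw [real_inner_comm, inner_mv, inner_mv, Matrix.mulVec_transpose, dotProduct_comm,
    Matrix.dotProduct_mulVec]

lemma frobNorm_eq (A : Matrix (Fin q) (Fin p) ℝ) :
    frobNorm A = ‖(WithLp.toLp 2 fun kl : Fin q × Fin p => A kl.1 kl.2 :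
      EuclideanSpace ℝ (Fin q × Fin p))‖ := by
  simp [frobNorm, EuclideanSpace.norm_eq, Fintype.sum_prod_type]

lemma frobNorm_nonneg (A : Matrix (Fin q) (Fin p) ℝ) : 0 ≤ frobNorm A := Real.sqrt_nonneg _

lemma frobNorm_add_le (A B : Matrix (Fin q) (Fin p) ℝ) :
    frobNorm (A + B) ≤ frobNorm A + frobNorm B := by
  set a : EuclideanSpace ℝ (Fin q × Fin p) := WithLp.toLp 2 fun kl => A kl.1 kl.2 with ha
  set b : EuclideanSpace ℝ (Fin q × Fin p) := WithLp.toLp 2 fun kl => B kl.1 kl.2 with hb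
  have hab : frobNorm (A + B) = ‖a + b‖ := by
    rw [frobNorm_eq]; rfl
  rw [hab, frobNorm_eq A, frobNorm_eq B]
  exact norm_add_le a b

lemma frobNorm_sub_comm (A B : Matrix (Fin q) (Fin p) ℝ) : frobNorm (A - B) = frobNorm (B - A) := by
  simp only [frobNorm, Matrix.sub_apply]
  congr 1
  exact Finset.sum_congr rfl fun k _ => Finset.sum_congr rfl fun l _ => by ring

lemma frobNorm_sub_le (A B C : Matrix (Fin q) (Fin p) ℝ) :
    frobNorm (A - C) ≤ frobNorm (A - B) + frobNorm (B - C) := by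
  simpa using frobNorm_add_le (A - B) (B - C)

lemma continuous_frobNorm : Continuous (frobNorm : Matrix (Fin q) (Fin p) ℝ → ℝ) := by
  unfold frobNorm
  fun_prop

@[simp]
lemma frobNorm_zero : frobNorm (0 : Matrix (Fin q) (Fin p) ℝ) = 0 := by
  simp [frobNorm]

lemma abs_entry_le_frobNorm (A : Matrix (Fin q) (Fin p) ℝ) (k : Fin q) (l : Fin p) :
    |A k l| ≤ frobNorm A := by
  rw [frobNorm_eq]
  exact PiLp.norm_apply_le (WithLp.toLp 2 fun kl : Fin q × Fin p => A kl.1 kl.2 :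
      EuclideanSpace ℝ (Fin q × Fin p)) (k, l)

lemma norm_mv_le (A : Matrix (Fin q) (Fin p) ℝ) (x : Vec p) : ‖mv A x‖ ≤ frobNorm A * ‖x‖ := by
  rw [EuclideanSpace.norm_eq, EuclideanSpace.norm_eq, frobNorm, ← Real.sqrt_mul (by positivity)]
  apply Real.sqrt_le_sqrt
  rw [Finset.sum_mul]
  apply Finset.sum_le_sum
  intro k _
  simp only [mv, Real.norm_eq_abs, sq_abs]
  exact Finset.sum_mul_sq_le_sq_mul_sq Finset.univ (fun l => A k l) x.ofLp

lemma abs_inner_mv_le (A : Matrix (Fin q) (Fin p) ℝ) (x : Vec q) (y : Vec p) :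
    |inner ℝ x (mv A y)| ≤ frobNorm A * ‖x‖ * ‖y‖ := by
  calc |inner ℝ x (mv A y)| ≤ ‖x‖ * ‖mv A y‖ := abs_real_inner_le_norm _ _
    _ ≤ ‖x‖ * (frobNorm A * ‖y‖) := by gcongr; exact norm_mv_le A y
    _ = _ := by ring

lemma abs_qf_le (A : Matrix (Fin p) (Fin p) ℝ) (x : Vec p) : |qf A x| ≤ frobNorm A * ‖x‖ ^ 2 := by
  rw [qf_eq_inner]
  exact (abs_inner_mv_le A x x).trans_eq (by ring)

lemma abs_qf_sub_le (A : Matrix (Fin p) (Fin p) ℝ) (x y : Vec p) :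
    |qf A x - qf A y| ≤ frobNorm A * ‖x - y‖ * (‖x‖ + ‖y‖) := by
  have : qf A x - qf A y = inner ℝ (x - y) (mv A x) + inner ℝ y (mv A (x - y)) := by
    rw [qf_eq_inner, qf_eq_inner, mv_sub, inner_sub_left, inner_sub_right]; ring
  rw [this]
  refine (abs_add_le _ _).trans ?_
  have h1 := abs_inner_mv_le A (x - y) x
  have h2 := abs_inner_mv_le A y (x - y)
  nlinarith

/-- Matrices carry the product topology, and `frobNorm` dominates every entry. This turns
qualitative continuity statements into explicit Frobenius radii. -/
lemma exists_frobNorm_subset {A : Matrix (Fin q) (Fin p) ℝ} {U : Set (Matrix (Fin q) (Fin p) ℝ)}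
    (hU : U ∈ 𝓝 A) : ∃ δ > 0, ∀ B, frobNorm (B - A) ≤ δ → B ∈ U := by
  obtain ⟨δ, hδ, h⟩ := (Metric.mem_nhds_iff (α := Fin q → Fin p → ℝ)).1 hU
  refine ⟨δ / 2, half_pos hδ, fun B hB => h ?_⟩
  refine (dist_pi_lt_iff (X := fun _ : Fin q => Fin p → ℝ) hδ).2 ?_
  intro k
  rw [dist_pi_lt_iff hδ]
  intro l
  have := abs_entry_le_frobNorm (B - A) k l
  rw [Real.dist_eq]
  simp only [Matrix.sub_apply] at this
  linarith

lemma tendsto_of_frobNorm {ι : Type*} {l : Filter ι} {S : ι → Matrix (Fin q) (Fin p) ℝ}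
    {A : Matrix (Fin q) (Fin p) ℝ} (h : Tendsto (fun i => frobNorm (S i - A)) l (𝓝 0)) :
    Tendsto S l (𝓝 A) := by
  intro U hU
  obtain ⟨δ, hδ, hδU⟩ := exists_frobNorm_subset hU
  exact (h.eventually_le_const hδ).mono fun i hi => hδU _ hi

lemma continuousAt_matrix_inv {V : Matrix (Fin p) (Fin p) ℝ} (hV : IsUnit V.det) :
    ContinuousAt (fun C : Matrix (Fin p) (Fin p) ℝ => C⁻¹) V := by
  have : (fun C : Matrix (Fin p) (Fin p) ℝ => C⁻¹) = fun C => C.det⁻¹ • C.adjugate := by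
    funext C; rw [Matrix.inv_def, Ring.inverse_eq_inv']
  rw [this]
  exact ((Continuous.matrix_det continuous_id).continuousAt.inv₀ hV.ne_zero).smul
    (Continuous.matrix_adjugate continuous_id).continuousAt

lemma exists_inv_close {V : Matrix (Fin p) (Fin p) ℝ} (hV : IsUnit V.det) {ε : ℝ} (hε : 0 < ε) :
    ∃ δ > 0, ∀ C : Matrix (Fin p) (Fin p) ℝ, frobNorm (C - V) ≤ δ →
      IsUnit C.det ∧ frobNorm (C⁻¹ - V⁻¹) ≤ ε := by
  have hdet : ∀ᶠ C in 𝓝 V, C.det ≠ 0 :=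
    (Continuous.matrix_det continuous_id).continuousAt.eventually_ne hV.ne_zero
  have hinv := continuousAt_matrix_inv hV
  have hfr : ∀ᶠ C in 𝓝 V, frobNorm (C⁻¹ - V⁻¹) < ε := by
    have : Tendsto (fun C : Matrix (Fin p) (Fin p) ℝ => frobNorm (C⁻¹ - V⁻¹)) (𝓝 V) (𝓝 0) := by
      have h := continuous_frobNorm.continuousAt.tendsto.comp (hinv.tendsto.sub_const V⁻¹)
      simpa [Function.comp_def] using h
    exact this.eventually_lt_const hε
  obtain ⟨δ, hδ, h⟩ := exists_frobNorm_subset (hdet.and hfr)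
  exact ⟨δ, hδ, fun C hC => ⟨isUnit_iff_ne_zero.2 (h C hC).1, (h C hC).2.le⟩⟩

end Matrices

/-! ### Bounds on the empirical log likelihood ratio -/

section ELBounds

variable {𝒳 : Type*} {p n : ℕ} (g : 𝒳 → Vec p → Vec p) (x : Fin n → 𝒳) (θ : Vec p)

lemma sum_inner_eq (hn : 0 < n) (l : Vec p) :
    ∑ i, inner ℝ l (g (x i) θ) = n * inner ℝ l (meanG g x θ) := by
  have : (n : ℝ) ≠ 0 := by positivity
  rw [meanG, inner_smul_right, inner_sum]
  field_simp

lemma mv_meanS (l : Vec p) :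
    mv (meanS g x θ) l = (n : ℝ)⁻¹ • ∑ i, inner ℝ l (g (x i) θ) • g (x i) θ := by
  ext k
  simp only [mv, meanS, Matrix.mulVec, dotProduct, Matrix.of_apply, PiLp.smul_apply,
    WithLp.ofLp_sum, WithLp.ofLp_smul, Finset.sum_apply, Pi.smul_apply, smul_eq_mul,
    EuclideanSpace.inner_eq_star_dotProduct, star_trivial]
  simp_rw [Finset.mul_sum, Finset.sum_mul]
  rw [Finset.sum_comm]
  refine Finset.sum_congr rfl fun i _ => ?_
  rw [Finset.mul_sum]
  exact Finset.sum_congr rfl fun j _ => by ring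

lemma sum_inner_sq_eq (hn : 0 < n) (l : Vec p) :
    ∑ i, inner ℝ l (g (x i) θ) ^ 2 = n * qf (meanS g x θ) l := by
  have : (n : ℝ) ≠ 0 := by positivity
  rw [qf_eq_inner, mv_meanS, inner_smul_right, inner_sum]
  simp_rw [inner_smul_right]
  field_simp

lemma ell_ge_of_elRatio_le {b : ℝ} (h : elRatio g x θ ≤ ENNReal.ofReal (Real.exp (-b / 2))) :
    (b : EReal) ≤ ell g x θ := by
  have h1 : ENNReal.log (elRatio g x θ) ≤ ((-b / 2 : ℝ) : EReal) := by
    refine (ENNReal.log_monotone h).trans ?_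
    rw [ENNReal.log_ofReal_of_pos (Real.exp_pos _), Real.log_exp]
  rw [ell, neg_mul, EReal.le_neg]
  calc (2 : EReal) * ENNReal.log (elRatio g x θ) ≤ 2 * ((-b / 2 : ℝ) : EReal) :=
        mul_le_mul_of_nonneg_left h1 (by norm_num)
    _ = ((-b : ℝ) : EReal) := by
        rw [show (2 : EReal) = ((2 : ℝ) : EReal) from rfl, ← EReal.coe_mul]; congr 1; ring
    _ = -(b : EReal) := by simp

lemma ell_le_of_le_elRatio {b : ℝ} (h : ENNReal.ofReal (Real.exp (-b / 2)) ≤ elRatio g x θ) :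
    ell g x θ ≤ b := by
  have h1 : ((-b / 2 : ℝ) : EReal) ≤ ENNReal.log (elRatio g x θ) := by
    refine le_trans ?_ (ENNReal.log_monotone h)
    rw [ENNReal.log_ofReal_of_pos (Real.exp_pos _), Real.log_exp]
  rw [ell, neg_mul, EReal.neg_le]
  calc -(b : EReal) = ((-b : ℝ) : EReal) := by simp
    _ = 2 * ((-b / 2 : ℝ) : EReal) := by
        rw [show (2 : EReal) = ((2 : ℝ) : EReal) from rfl, ← EReal.coe_mul]; congr 1; ring
    _ ≤ (2 : EReal) * ENNReal.log (elRatio g x θ) :=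
        mul_le_mul_of_nonneg_left h1 (by norm_num)

/-- The dual lower bound on `l_n(θ)`, for an arbitrary multiplier. -/
lemma le_ell (l : Vec p) (hl : ∀ i, 0 < 1 + inner ℝ l (g (x i) θ)) :
    ((2 * ∑ i, Real.log (1 + inner ℝ l (g (x i) θ)) : ℝ) : EReal) ≤ ell g x θ := by
  apply ell_ge_of_elRatio_le
  refine iSup₂_le fun w hw => ENNReal.ofReal_le_ofReal ?_
  obtain ⟨hw0, hw1, hwg⟩ := hw
  have hn : 0 < n := by
    rcases Nat.eq_zero_or_pos n with h | h
    · subst h; simp at hw1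
    · exact h
  -- The two constraints on `w` make these excesses over `1` cancel for every multiplier `l`.
  have hsum : ∑ i, (n * w i * (1 + inner ℝ l (g (x i) θ)) - 1) = 0 := by
    have h0 : ∑ i, w i * inner ℝ l (g (x i) θ) = 0 := by
      simp_rw [← inner_smul_right]
      rw [← inner_sum, hwg, inner_zero_right]
    have : ∀ i, n * w i * (1 + inner ℝ l (g (x i) θ)) - 1
        = n * w i + n * (w i * inner ℝ l (g (x i) θ)) - 1 := fun i => by ring
    simp_rw [this]
    rw [Finset.sum_sub_distrib, Finset.sum_add_distrib, ← Finset.mul_sum, ← Finset.mul_sum, hw1, h0]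
    simp
  -- Factorwise `u ≤ exp (u - 1)`, the tangent line inequality behind weak duality.
  have hprod : ∏ i, (n * w i * (1 + inner ℝ l (g (x i) θ))) ≤ 1 := by
    calc ∏ i, (n * w i * (1 + inner ℝ l (g (x i) θ)))
        ≤ ∏ i, Real.exp (n * w i * (1 + inner ℝ l (g (x i) θ)) - 1) := by
          refine Finset.prod_le_prod (fun i _ => ?_) fun i _ => ?_
          · have := hw0 i; have := hl i; positivity
          · linarith [Real.add_one_le_exp (n * w i * (1 + inner ℝ l (g (x i) θ)) - 1)]
      _ = 1 := by rw [← Real.exp_sum, hsum, Real.exp_zero]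
  have hpos : 0 < ∏ i, (1 + inner ℝ l (g (x i) θ)) := Finset.prod_pos fun i _ => hl i
  have : Real.exp (-(2 * ∑ i, Real.log (1 + inner ℝ l (g (x i) θ))) / 2)
      = (∏ i, (1 + inner ℝ l (g (x i) θ)))⁻¹ := by
    rw [show -(2 * ∑ i, Real.log (1 + inner ℝ l (g (x i) θ))) / 2
      = - ∑ i, Real.log (1 + inner ℝ l (g (x i) θ)) by ring, Real.exp_neg, Real.exp_sum]
    simp_rw [Real.exp_log (hl _)]
  rw [this, le_inv_comm₀ (Finset.prod_pos fun i _ => by have := hw0 i; positivity) hpos]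
  rw [Finset.prod_mul_distrib] at hprod
  rwa [← one_div, le_div_iff₀' (Finset.prod_pos fun i _ => by have := hw0 i; positivity)]

lemma ell_le {w : Fin n → ℝ} (hw0 : ∀ i, 0 < w i) (hw1 : ∑ i, w i = 1)
    (hwg : ∑ i, w i • g (x i) θ = 0) :
    ell g x θ ≤ ((-2 * ∑ i, Real.log (n * w i) : ℝ) : EReal) := by
  have hn : 0 < n := by
    rcases Nat.eq_zero_or_pos n with h | h
    · subst h; simp at hw1
    · exact h
  have hpos : ∀ i, 0 < (n : ℝ) * w i := fun i => by have := hw0 i; positivity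
  apply ell_le_of_le_elRatio
  have : Real.exp (-(-2 * ∑ i, Real.log (n * w i)) / 2) = ∏ i, (n * w i) := by
    rw [show -(-2 * ∑ i, Real.log (n * w i)) / 2 = ∑ i, Real.log (n * w i) by ring, Real.exp_sum]
    simp_rw [Real.exp_log (hpos _)]
  rw [this]
  exact le_iSup₂_of_le w ⟨hw0, hw1, hwg⟩ le_rfl

/-- The cubic Taylor remainder is bounded by a small multiple of `y ^ 2`, so that after summation it
is controlled by the second moment matrix. -/
lemma le_log_one_add {y t : ℝ} (hy : |y| ≤ t) (ht : t ≤ 1 / 2) :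
    y - y ^ 2 / 2 - 2 * t * y ^ 2 ≤ Real.log (1 + y) := by
  have h1 : |(-y)| < 1 := by rw [abs_neg]; linarith
  have h := Real.abs_log_sub_add_sum_range_le h1 2
  simp only [Finset.sum_range_succ, Finset.sum_range_zero, abs_neg, sub_neg_eq_add] at h
  norm_num at h
  have h2 : |y| ^ 3 / (1 - |y|) ≤ 2 * t * y ^ 2 := by
    rw [div_le_iff₀ (by linarith [abs_nonneg y])]
    have : |y| ^ 3 = |y| * y ^ 2 := by rw [← sq_abs y]; ring
    rw [this]
    have h0 : 0 ≤ y ^ 2 := sq_nonneg y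
    have ht0 : 0 ≤ t := (abs_nonneg y).trans hy
    nlinarith [mul_nonneg ht0 h0, mul_le_mul_of_nonneg_right hy h0]
  have h3 := (abs_le.1 (h.trans h2)).1
  linarith

end ELBounds

/-! ### Quadratic approximation of the empirical log likelihood ratio -/

section ELApprox

variable {𝒳 : Type*} {p : ℕ}

lemma frobNorm_vecMulVec (u v : Vec p) :
    frobNorm (Matrix.vecMulVec u.ofLp v.ofLp) = ‖u‖ * ‖v‖ := by
  rw [frobNorm, EuclideanSpace.norm_eq, EuclideanSpace.norm_eq, ← Real.sqrt_mul (by positivity),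
    Finset.sum_mul_sum]
  congr 1
  exact Finset.sum_congr rfl fun k _ => Finset.sum_congr rfl fun l _ => by
    simp [Matrix.vecMulVec_apply, mul_pow]

lemma mv_vecMulVec (u v x : Vec p) :
    mv (Matrix.vecMulVec u.ofLp v.ofLp) x = inner ℝ v x • u := by
  ext k
  simp [mv, Matrix.vecMulVec_mulVec, EuclideanSpace.inner_eq_star_dotProduct, dotProduct_comm]

lemma coe_le_mul_ell {r b : ℝ} (hr : 0 < r) {e : EReal} (h : ((b / r : ℝ) : EReal) ≤ e) :
    (b : EReal) ≤ (r : EReal) * e := by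
  calc (b : EReal) = (r : EReal) * ((b / r : ℝ) : EReal) := by
        rw [← EReal.coe_mul]; congr 1; field_simp
    _ ≤ _ := mul_le_mul_of_nonneg_left h (by exact_mod_cast hr.le)

lemma mul_ell_le {r b : ℝ} (hr : 0 < r) {e : EReal} (h : e ≤ ((b / r : ℝ) : EReal)) :
    (r : EReal) * e ≤ b := by
  calc (r : EReal) * e ≤ (r : EReal) * ((b / r : ℝ) : EReal) :=
        mul_le_mul_of_nonneg_left h (by exact_mod_cast hr.le)
    _ = (b : EReal) := by rw [← EReal.coe_mul]; congr 1; field_simp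

variable (g : 𝒳 → Vec p → Vec p)

/-- Lower half of the quadratic approximation of the empirical log likelihood ratio. -/
lemma ell_approx_lower {V : Matrix (Fin p) (Fin p) ℝ} (hV : IsUnit V.det) {R η : ℝ} (hR : 0 ≤ R)
    (hη : 0 < η) :
    ∃ ε₀ > 0, ∀ ε, 0 < ε → ε ≤ ε₀ → ∀ {n : ℕ} (x : Fin n → 𝒳) (θ : Vec p) (a : ℝ), 0 < n → 0 < a →
      frobNorm (meanS g x θ - V) ≤ ε → (∀ i, ‖g (x i) θ‖ ≤ ε * a) → ‖a • meanG g x θ‖ ≤ R →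
      ((qf V⁻¹ (a • meanG g x θ) - η : ℝ) : EReal) ≤ ((a ^ 2 / n : ℝ) : EReal) * ell g x θ := by
  set c := frobNorm V⁻¹ with hc
  have hc0 : 0 ≤ c := frobNorm_nonneg _
  -- With `t = c * R * ε` bounding all `|l · g_i|`, the first condition allows `le_log_one_add`; the
  -- second absorbs the cubic remainder and the replacement of `S_n` by `V`.
  have key : ∀ᶠ ε in 𝓝[>] (0 : ℝ), c * R * ε ≤ 1 / 2 ∧
      4 * (c * R * ε) * (c * R ^ 2) + (1 + 4 * (c * R * ε)) * (ε * (c * R) ^ 2) ≤ η := by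
    apply nhdsWithin_le_nhds
    apply Filter.Eventually.and
    · have : Tendsto (fun ε : ℝ => c * R * ε) (𝓝 0) (𝓝 0) := by
        have h : Continuous (fun ε : ℝ => c * R * ε) := by fun_prop
        exact h.tendsto' _ _ (by simp)
      exact this.eventually_le_const (by norm_num)
    · have : Tendsto (fun ε : ℝ => 4 * (c * R * ε) * (c * R ^ 2) +
          (1 + 4 * (c * R * ε)) * (ε * (c * R) ^ 2)) (𝓝 0) (𝓝 0) := by
        have h : Continuous (fun ε : ℝ => 4 * (c * R * ε) * (c * R ^ 2) +
          (1 + 4 * (c * R * ε)) * (ε * (c * R) ^ 2)) := by fun_prop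
        exact h.tendsto' _ _ (by simp)
      exact this.eventually_le_const hη
  obtain ⟨ε₀, hε₀, hε₀'⟩ := mem_nhdsGT_iff_exists_Ioc_subset.1 key
  refine ⟨ε₀, hε₀, fun ε hε hle n x θ a hn ha hS hg hG => ?_⟩
  obtain ⟨ht, hbd⟩ := hε₀' ⟨hε, hle⟩
  set t := c * R * ε with ht_def
  set Z := a • meanG g x θ with hZ
  -- The first-order approximation to the optimal multiplier. It has norm at most `c * R / a`, which
  -- offsets `‖g_i‖ ≤ ε * a`.
  set l := mv V⁻¹ (meanG g x θ) with hl
  have hmvZ : mv V⁻¹ Z = a • l := by rw [hZ, mv_smul]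
  have haG : a * ‖meanG g x θ‖ ≤ R := by rwa [hZ, norm_smul, Real.norm_of_nonneg ha.le] at hG
  have hal : a * ‖l‖ ≤ c * R := by
    calc a * ‖l‖ ≤ a * (c * ‖meanG g x θ‖) := by gcongr; exact norm_mv_le _ _
      _ = c * (a * ‖meanG g x θ‖) := by ring
      _ ≤ c * R := by gcongr
  have hy : ∀ i, |inner ℝ l (g (x i) θ)| ≤ t := fun i => by
    calc |inner ℝ l (g (x i) θ)| ≤ ‖l‖ * ‖g (x i) θ‖ := abs_real_inner_le_norm _ _
      _ ≤ ‖l‖ * (ε * a) := by gcongr; exact hg i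
      _ = (a * ‖l‖) * ε := by ring
      _ ≤ c * R * ε := by gcongr
  have hpos : ∀ i, 0 < 1 + inner ℝ l (g (x i) θ) := fun i => by
    have := (abs_le.1 (hy i)).1; linarith
  have hn' : (0 : ℝ) < n := by exact_mod_cast hn
  apply coe_le_mul_ell (by positivity)
  refine le_trans ?_ (le_ell g x θ l hpos)
  rw [EReal.coe_le_coe_iff, div_le_iff₀ (by positivity)]
  have hsum : n * inner ℝ l (meanG g x θ) - (1 / 2 + 2 * t) * (n * qf (meanS g x θ) l)
      ≤ ∑ i, Real.log (1 + inner ℝ l (g (x i) θ)) := by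
    rw [← sum_inner_eq g x θ hn, ← sum_inner_sq_eq g x θ hn, Finset.mul_sum,
      ← Finset.sum_sub_distrib]
    refine Finset.sum_le_sum fun i _ => ?_
    have := le_log_one_add (hy i) ht
    linarith
  have hQ : qf V⁻¹ Z = a ^ 2 * inner ℝ l (meanG g x θ) := by
    rw [qf_eq_inner, hmvZ, hZ, inner_smul_left, inner_smul_right, real_inner_comm]
    simp; ring
  have hVl : mv V l = meanG g x θ := by
    rw [hl, mv_mv, Matrix.mul_nonsing_inv _ hV, mv_one]
  have hSl : a ^ 2 * qf (meanS g x θ) l ≤ qf V⁻¹ Z + ε * (c * R) ^ 2 := by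
    have h1 : qf (meanS g x θ) l = inner ℝ l (meanG g x θ) + qf (meanS g x θ - V) l := by
      rw [qf_eq_inner, qf_eq_inner, sub_mv, inner_sub_right, hVl]; ring
    have h2 : a ^ 2 * qf (meanS g x θ - V) l ≤ ε * (c * R) ^ 2 := by
      calc a ^ 2 * qf (meanS g x θ - V) l ≤ a ^ 2 * (ε * ‖l‖ ^ 2) := by
            gcongr
            refine (le_abs_self _).trans ((abs_qf_le _ _).trans ?_)
            gcongr
        _ = ε * (a * ‖l‖) ^ 2 := by ring
        _ ≤ ε * (c * R) ^ 2 := by gcongr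
    rw [h1, mul_add, ← hQ]; linarith
  have hQle : qf V⁻¹ Z ≤ c * R ^ 2 := by
    refine (le_abs_self _).trans ((abs_qf_le _ _).trans ?_)
    gcongr
  have ht0 : 0 ≤ t := by positivity
  have hfin : (1 + 4 * t) * (a ^ 2 * qf (meanS g x θ) l) ≤ qf V⁻¹ Z + η := by
    calc (1 + 4 * t) * (a ^ 2 * qf (meanS g x θ) l)
        ≤ (1 + 4 * t) * (qf V⁻¹ Z + ε * (c * R) ^ 2) := by gcongr
      _ ≤ _ := by nlinarith
  have hmain : qf V⁻¹ Z - η ≤ 2 * (a ^ 2 * inner ℝ l (meanG g x θ))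
      - (1 + 4 * t) * (a ^ 2 * qf (meanS g x θ) l) := by
    rw [← hQ]; linarith
  calc qf V⁻¹ Z - η ≤ 2 * (a ^ 2 * inner ℝ l (meanG g x θ))
      - (1 + 4 * t) * (a ^ 2 * qf (meanS g x θ) l) := hmain
    _ = 2 * (n * inner ℝ l (meanG g x θ) - (1 / 2 + 2 * t) * (n * qf (meanS g x θ) l))
        * (a ^ 2 / n) := by field_simp; ring
    _ ≤ _ := by gcongr

/-- Upper half of the quadratic approximation of the empirical log likelihood ratio. -/
lemma ell_approx_upper {V : Matrix (Fin p) (Fin p) ℝ} (hV : IsUnit V.det) {R η : ℝ} (hR : 0 ≤ R)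
    (hη : 0 < η) :
    ∃ ε₀ > 0, ∀ ε, 0 < ε → ε ≤ ε₀ → ∀ {n : ℕ} (x : Fin n → 𝒳) (θ : Vec p) (a : ℝ), 0 < n → 0 < a →
      1 / a ≤ ε →
      frobNorm (meanS g x θ - V) ≤ ε → (∀ i, ‖g (x i) θ‖ ≤ ε * a) → ‖a • meanG g x θ‖ ≤ R →
      ((a ^ 2 / n : ℝ) : EReal) * ell g x θ ≤ ((qf V⁻¹ (a • meanG g x θ) + η : ℝ) : EReal) := by
  -- The extra `1` makes `c` bound `C⁻¹` as well, for the sample covariance `C` introduced below.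
  set c := frobNorm V⁻¹ + 1 with hc
  have hc0 : 1 ≤ c := by linarith [frobNorm_nonneg V⁻¹]
  obtain ⟨ε₁, hε₁, hε₁1, hε₁η⟩ : ∃ ε₁ > 0, ε₁ ≤ 1 ∧ ε₁ * R ^ 2 ≤ η / 2 := by
    refine ⟨min 1 (η / 2 / (R ^ 2 + 1)), by positivity, min_le_left _ _, ?_⟩
    calc min 1 (η / 2 / (R ^ 2 + 1)) * R ^ 2 ≤ (η / 2 / (R ^ 2 + 1)) * (R ^ 2 + 1) := by
          gcongr
          · exact min_le_right _ _
          · linarith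
      _ = η / 2 := by field_simp
  obtain ⟨δ, hδ, hinv⟩ := exists_inv_close hV hε₁
  have key : ∀ᶠ ε in 𝓝[>] (0 : ℝ), (c * R * ε + c * R ^ 2 * ε ^ 2 ≤ 1 / 2 ∧
      4 * (c * R * ε + c * R ^ 2 * ε ^ 2) * (c * R ^ 2) ≤ η / 2) ∧ ε + R ^ 2 * ε ^ 2 ≤ δ := by
    have h1 : Tendsto (fun ε : ℝ => c * R * ε + c * R ^ 2 * ε ^ 2) (𝓝 0) (𝓝 0) := by
      have h : Continuous (fun ε : ℝ => c * R * ε + c * R ^ 2 * ε ^ 2) := by fun_prop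
      exact h.tendsto' _ _ (by simp)
    have h2 : Tendsto (fun ε : ℝ => 4 * (c * R * ε + c * R ^ 2 * ε ^ 2) * (c * R ^ 2)) (𝓝 0)
        (𝓝 0) := by
      have h : Continuous (fun ε : ℝ => 4 * (c * R * ε + c * R ^ 2 * ε ^ 2) * (c * R ^ 2)) := by
        fun_prop
      exact h.tendsto' _ _ (by simp)
    have h3 : Tendsto (fun ε : ℝ => ε + R ^ 2 * ε ^ 2) (𝓝 0) (𝓝 0) := by
      have h : Continuous (fun ε : ℝ => ε + R ^ 2 * ε ^ 2) := by fun_prop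
      exact h.tendsto' _ _ (by simp)
    exact nhdsWithin_le_nhds (((h1.eventually_le_const (by norm_num)).and
      (h2.eventually_le_const (half_pos hη))).and (h3.eventually_le_const hδ))
  obtain ⟨ε₀, hε₀, hε₀'⟩ := mem_nhdsGT_iff_exists_Ioc_subset.1 key
  refine ⟨ε₀, hε₀, fun ε hε hle n x θ a hn ha hainv hS hg hG => ?_⟩
  obtain ⟨⟨ht, hbd⟩, hδ'⟩ := hε₀' ⟨hε, hle⟩
  set t := c * R * ε + c * R ^ 2 * ε ^ 2 with ht_def
  set m := meanG g x θ with hm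
  set Z := a • m with hZ
  have haG : a * ‖m‖ ≤ R := by rwa [hZ, norm_smul, Real.norm_of_nonneg ha.le] at hG
  have hmε : ‖m‖ ≤ R * ε := by
    calc ‖m‖ = (a * ‖m‖) * (1 / a) := by field_simp
      _ ≤ R * ε := by gcongr
  -- The centred second moment matrix. It differs from `S_n` by a rank one term of norm `‖m‖ ^ 2 =
  -- O(a⁻²)`.
  set C := meanS g x θ - Matrix.vecMulVec m.ofLp m.ofLp with hC
  have hCV : frobNorm (C - V) ≤ δ := by
    have h1 := frobNorm_sub_le C (meanS g x θ) V
    have h2 : frobNorm (C - meanS g x θ) = ‖m‖ * ‖m‖ := by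
      rw [frobNorm_sub_comm, hC, sub_sub_cancel, frobNorm_vecMulVec]
    have h3 : ‖m‖ * ‖m‖ ≤ (R * ε) * (R * ε) := by gcongr
    rw [h2] at h1
    linarith [show (R * ε) * (R * ε) = R ^ 2 * ε ^ 2 by ring]
  obtain ⟨hCu, hCinv⟩ := hinv C hCV
  have hCfrob : frobNorm C⁻¹ ≤ c := by
    have := frobNorm_add_le (C⁻¹ - V⁻¹) V⁻¹
    rw [sub_add_cancel] at this
    linarith
  set l := mv C⁻¹ m with hl
  have hal : a * ‖l‖ ≤ c * R := by
    calc a * ‖l‖ ≤ a * (c * ‖m‖) := by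
          gcongr
          exact (norm_mv_le _ _).trans (by gcongr)
      _ = c * (a * ‖m‖) := by ring
      _ ≤ c * R := by gcongr
  have hCl : mv C l = m := by
    rw [hl, mv_mv, Matrix.mul_nonsing_inv _ hCu, mv_one]
  have hSl : mv (meanS g x θ) l - inner ℝ m l • m = m := by
    rw [← mv_vecMulVec, ← sub_mv, hCl]
  have hn' : (0 : ℝ) < n := by exact_mod_cast hn
  -- Tilting by centred values keeps total mass one, and `C l = m` makes the tilted mean vanish. The
  -- condition `1 / a ≤ ε` enters in bounding the centring term.
  set y : Fin n → ℝ := fun i => inner ℝ l (g (x i) θ) - inner ℝ l m with hy_def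
  have hy : ∀ i, |y i| ≤ t := fun i => by
    have e : y i = inner ℝ l (g (x i) θ - m) := by rw [inner_sub_right]
    calc |y i| ≤ ‖l‖ * ‖g (x i) θ - m‖ := by rw [e]; exact abs_real_inner_le_norm _ _
      _ ≤ ‖l‖ * (ε * a + R * ε * (ε * a)) := by
          gcongr
          refine (norm_sub_le _ _).trans (add_le_add (hg i) (hmε.trans ?_))
          have : 1 ≤ ε * a := by rwa [div_le_iff₀ ha] at hainv
          have h0 : 0 ≤ R * ε := by positivity
          nlinarith
      _ = (a * ‖l‖) * (ε + R * ε * ε) := by ring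
      _ ≤ (c * R) * (ε + R * ε * ε) := by gcongr
      _ = t := by rw [ht_def]; ring
  have hy0 : ∑ i, y i = 0 := by
    simp only [hy_def, Finset.sum_sub_distrib, sum_inner_eq g x θ hn]
    simp [hm]
  -- The left side is `n lᵀ C l`, and `C l = m`.
  have hy2 : ∑ i, y i ^ 2 = n * inner ℝ l m := by
    have e : ∀ i, y i ^ 2 = inner ℝ l (g (x i) θ) ^ 2 - 2 * inner ℝ l m * inner ℝ l (g (x i) θ)
        + inner ℝ l m ^ 2 := fun i => by simp only [hy_def]; ring
    simp_rw [e]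
    rw [Finset.sum_add_distrib, Finset.sum_sub_distrib, ← Finset.mul_sum, sum_inner_eq g x θ hn,
      sum_inner_sq_eq g x θ hn, ← hm, qf_eq_inner]
    have : mv (meanS g x θ) l = m + inner ℝ m l • m := by rw [← sub_eq_iff_eq_add]; exact hSl
    rw [this, inner_add_right, inner_smul_right, real_inner_comm l m]
    simp
    ring
  set w : Fin n → ℝ := fun i => (n : ℝ)⁻¹ * (1 - y i) with hw
  have hpos : ∀ i, 0 < 1 - y i := fun i => by have := (abs_le.1 (hy i)).2; linarith
  have hw0 : ∀ i, 0 < w i := fun i => by have := hpos i; positivity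
  have hw1 : ∑ i, w i = 1 := by
    simp only [hw, ← Finset.mul_sum, Finset.sum_sub_distrib, hy0]
    simp; field_simp
  -- The sum is `m - S_n l + (l · m) m = m - C l`.
  have hwg : ∑ i, w i • g (x i) θ = 0 := by
    have e : ∀ i, w i • g (x i) θ = (n : ℝ)⁻¹ • g (x i) θ
        - (n : ℝ)⁻¹ • (inner ℝ l (g (x i) θ) • g (x i) θ)
        + inner ℝ l m • ((n : ℝ)⁻¹ • g (x i) θ) := fun i => by
      simp only [hw, hy_def]; module
    simp_rw [e]
    rw [Finset.sum_add_distrib, Finset.sum_sub_distrib, ← Finset.smul_sum, ← Finset.smul_sum,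
      ← Finset.smul_sum, ← Finset.smul_sum, ← mv_meanS]
    change m - mv (meanS g x θ) l + inner ℝ l m • m = 0
    have := hSl
    rw [real_inner_comm] at this
    nth_rewrite 1 [← this]
    abel
  apply mul_ell_le (by positivity)
  refine (ell_le g x θ hw0 hw1 hwg).trans ?_
  rw [EReal.coe_le_coe_iff, le_div_iff₀ (by positivity)]
  have hsum : -((1 / 2 + 2 * t) * (n * inner ℝ l m)) ≤ ∑ i, Real.log (n * w i) := by
    have e : ∀ i, Real.log (n * w i) = Real.log (1 + - y i) := fun i => by
      simp only [hw]; congr 1; field_simp; ring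
    have h0 : -((1 / 2 + 2 * t) * (n * inner ℝ l m))
        = ∑ i, (-(y i) - (1 / 2 + 2 * t) * y i ^ 2) := by
      rw [Finset.sum_sub_distrib, Finset.sum_neg_distrib, hy0, ← Finset.mul_sum, hy2]; ring
    rw [h0]
    refine Finset.sum_le_sum fun i _ => ?_
    rw [e]
    have := le_log_one_add (y := -y i) (by rw [abs_neg]; exact hy i) ht
    linarith [neg_sq (y i)]
  have hQ : qf C⁻¹ Z = a ^ 2 * inner ℝ l m := by
    rw [qf_eq_inner, hZ, mv_smul, inner_smul_left, inner_smul_right, real_inner_comm]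
    simp; ring
  have hQC : qf C⁻¹ Z ≤ qf V⁻¹ Z + η / 2 := by
    have h1 : qf C⁻¹ Z = qf V⁻¹ Z + qf (C⁻¹ - V⁻¹) Z := by
      rw [qf_eq_inner, qf_eq_inner, qf_eq_inner, sub_mv, inner_sub_right]; ring
    have h2 : qf (C⁻¹ - V⁻¹) Z ≤ ε₁ * R ^ 2 := by
      refine (le_abs_self _).trans ((abs_qf_le _ _).trans ?_)
      gcongr
    linarith
  have hQle : qf C⁻¹ Z ≤ c * R ^ 2 := by
    refine (le_abs_self _).trans ((abs_qf_le _ _).trans ?_)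
    gcongr
  have ht0 : 0 ≤ t := by positivity
  have hfin : (1 + 4 * t) * qf C⁻¹ Z ≤ qf V⁻¹ Z + η := by
    have : 4 * t * qf C⁻¹ Z ≤ 4 * t * (c * R ^ 2) := by gcongr
    linarith
  calc (-2 * ∑ i, Real.log (n * w i)) * (a ^ 2 / n)
      = 2 * (a ^ 2 / n) * (- ∑ i, Real.log (n * w i)) := by ring
    _ ≤ 2 * (a ^ 2 / n) * ((1 / 2 + 2 * t) * (n * inner ℝ l m)) := by
        gcongr
        linarith
    _ = (1 + 4 * t) * qf C⁻¹ Z := by rw [hQ]; field_simp; ring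
    _ ≤ _ := hfin

end ELApprox

/-! ### The projection matrix of a linear constraint -/

section Projection

variable {p q : ℕ} {V : Matrix (Fin p) (Fin p) ℝ} {L : Matrix (Fin q) (Fin p) ℝ}

lemma vecMul_injective_of_rank (hL : L.rank = q) : Function.Injective L.vecMul := by
  rw [Matrix.vecMul_injective_iff, linearIndependent_iff_card_eq_finrank_span, Set.finrank,
    ← Matrix.rank_eq_finrank_span_row, hL, Fintype.card_fin]

lemma gram_posDef (hV : V.PosDef) (hL : L.rank = q) : (L * V * Lᵀ).PosDef := by
  have := hV.mul_mul_conjTranspose_same (vecMul_injective_of_rank hL)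
  rwa [Matrix.conjTranspose_eq_transpose_of_trivial] at this

lemma isUnit_det_of_posDef {n : ℕ} {M : Matrix (Fin n) (Fin n) ℝ} (hM : M.PosDef) :
    IsUnit M.det :=
  isUnit_iff_ne_zero.2 hM.det_pos.ne'

lemma transpose_eq_of_posDef {n : ℕ} {M : Matrix (Fin n) (Fin n) ℝ} (hM : M.PosDef) : Mᵀ = M := by
  rw [← Matrix.conjTranspose_eq_transpose_of_trivial]
  exact hM.isHermitian

/-- `V * quadMatrix L V` is the projection taking `x` to the point of least `V⁻¹`-energy in the
fibre of `L` through `x`; this is its feasibility. -/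
lemma proj_constraint (hV : V.PosDef) (hL : L.rank = q) : L * (V * quadMatrix L V) = L := by
  rw [quadMatrix]
  calc L * (V * (Lᵀ * (L * V * Lᵀ)⁻¹ * L)) = (L * V * Lᵀ) * (L * V * Lᵀ)⁻¹ * L := by
        simp only [Matrix.mul_assoc]
    _ = L := by
        rw [Matrix.mul_nonsing_inv _ (isUnit_det_of_posDef (gram_posDef hV hL)), Matrix.one_mul]

lemma quadMatrix_mul_mul (hV : V.PosDef) (hL : L.rank = q) :
    quadMatrix L V * V * quadMatrix L V = quadMatrix L V := by
  have h := proj_constraint hV hL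
  calc quadMatrix L V * V * quadMatrix L V = Lᵀ * (L * V * Lᵀ)⁻¹ * (L * (V * quadMatrix L V)) := by
        simp only [quadMatrix, Matrix.mul_assoc]
    _ = quadMatrix L V := by rw [h]; rfl

lemma quadMatrix_transpose (hV : V.PosDef) (hL : L.rank = q) :
    (quadMatrix L V)ᵀ = quadMatrix L V := by
  rw [quadMatrix, Matrix.transpose_mul, Matrix.transpose_mul, Matrix.transpose_transpose,
    Matrix.transpose_nonsing_inv, transpose_eq_of_posDef (gram_posDef hV hL)]
  exact (Matrix.mul_assoc _ _ _).symm

/-- The form sees `x` only through `L x`. Hence its value barely changes along approximately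
feasible points. -/
lemma qf_quadMatrix (x : Vec p) : qf (quadMatrix L V) x = qf (L * V * Lᵀ)⁻¹ (mv L x) := by
  rw [qf_eq_inner, qf_eq_inner, quadMatrix, ← mv_mv, ← mv_mv, ← inner_mv_transpose,
    Matrix.transpose_transpose]

lemma qf_nonneg {n : ℕ} {M : Matrix (Fin n) (Fin n) ℝ} (hM : M.PosSemidef) (x : Vec n) :
    0 ≤ qf M x := by
  have := hM.dotProduct_mulVec_nonneg x.ofLp
  simpa [qf] using this

/-- The energy of the minimiser, from symmetry and `A V A = A`. -/
lemma qf_inv_proj (hV : V.PosDef) (hL : L.rank = q) (x : Vec p) :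
    qf V⁻¹ (mv (V * quadMatrix L V) x) = qf (quadMatrix L V) x := by
  rw [qf_eq_inner, qf_eq_inner, mv_mv, ← Matrix.mul_assoc,
    Matrix.nonsing_inv_mul _ (isUnit_det_of_posDef hV), Matrix.one_mul, real_inner_comm,
    ← inner_mv_transpose (V * quadMatrix L V), Matrix.transpose_mul, transpose_eq_of_posDef hV,
    quadMatrix_transpose hV hL, mv_mv, quadMatrix_mul_mul hV hL, real_inner_comm]

/-- The residual `x - V A x` has nonnegative energy, equal to the difference of the two sides. -/
lemma qf_quadMatrix_le (hV : V.PosDef) (hL : L.rank = q) (x : Vec p) :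
    qf (quadMatrix L V) x ≤ qf V⁻¹ x := by
  have h0 := qf_nonneg hV.inv.posSemidef (x - mv (V * quadMatrix L V) x)
  have hx : ∀ y z : Vec p, qf V⁻¹ (y - z) = qf V⁻¹ y - 2 * inner ℝ y (mv V⁻¹ z) + qf V⁻¹ z := by
    intro y z
    have hs : inner ℝ z (mv V⁻¹ y) = inner ℝ y (mv V⁻¹ z) := by
      rw [← inner_mv_transpose, transpose_eq_of_posDef hV.inv, real_inner_comm]
    simp only [qf_eq_inner, mv_sub, inner_sub_left, inner_sub_right, hs]
    ring
  rw [hx, qf_inv_proj hV hL, mv_mv, ← Matrix.mul_assoc,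
    Matrix.nonsing_inv_mul _ (isUnit_det_of_posDef hV), Matrix.one_mul, ← qf_eq_inner] at h0
  linarith

end Projection

/-! ### Local analysis at the true parameter -/

section Local

variable {p q : ℕ}

lemma mv_jacobian (f : Vec p → Vec q) (θ v : Vec p) : mv (jacobian f θ) v = fderiv ℝ f θ v := by
  have hv : v = ∑ l, v l • EuclideanSpace.single l (1 : ℝ) := by
    ext k
    simp [Finset.sum_apply, Pi.single_apply]
  conv_rhs => rw [hv, map_sum]
  ext k
  simp [mv, jacobian, Matrix.mulVec, dotProduct, mul_comm]

lemma norm_fderiv_sub_le (f₁ f₂ : Vec p → Vec q) (θ₁ θ₂ : Vec p) :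
    ‖fderiv ℝ f₁ θ₁ - fderiv ℝ f₂ θ₂‖ ≤ frobNorm (jacobian f₁ θ₁ - jacobian f₂ θ₂) := by
  refine ContinuousLinearMap.opNorm_le_bound _ (frobNorm_nonneg _) fun v => ?_
  rw [sub_apply, ← mv_jacobian, ← mv_jacobian, ← sub_mv]
  exact norm_mv_le _ _

lemma norm_fderiv_le (f : Vec p → Vec q) (θ : Vec p) :
    ‖fderiv ℝ f θ‖ ≤ frobNorm (jacobian f θ) := by
  refine ContinuousLinearMap.opNorm_le_bound _ (frobNorm_nonneg _) fun v => ?_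
  rw [← mv_jacobian]
  exact norm_mv_le _ _

variable {f : Vec p → Vec q} {N : Set (Vec p)} {θ₀ : Vec p}

lemma tendsto_jacobian (hN : IsOpen N) (hθ : θ₀ ∈ N) (hf : ContDiffOn ℝ 1 f N) :
    Tendsto (fun θ => frobNorm (jacobian f θ - jacobian f θ₀)) (𝓝 θ₀) (𝓝 0) := by
  have hc : ContinuousAt (fderiv ℝ f) θ₀ :=
    (hf.continuousOn_fderiv_of_isOpen hN le_rfl).continuousAt (hN.mem_nhds hθ)
  have hj : ContinuousAt (fun θ => jacobian f θ) θ₀ := by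
    unfold jacobian
    refine continuousAt_pi.2 fun k => continuousAt_pi.2 fun l => ?_
    have h1 : ContinuousAt (fun θ => fderiv ℝ f θ (EuclideanSpace.single l (1 : ℝ))) θ₀ :=
      hc.clm_apply continuousAt_const
    exact (EuclideanSpace.proj (𝕜 := ℝ) k).continuous.continuousAt.comp h1
  have := continuous_frobNorm.continuousAt.tendsto.comp (hj.tendsto.sub_const (jacobian f θ₀))
  simpa [Function.comp_def] using this

/-- The level set is tangent to the kernel of the derivative: the implicit function, parametrised by
the kernel, has the inclusion as its derivative at `0`. -/
lemma exists_level_point (hf : HasStrictFDerivAt f (fderiv ℝ f θ₀) θ₀)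
    (hr : (jacobian f θ₀).rank = q) {ε : ℝ} (hε : 0 < ε) :
    ∃ ρ > 0, ∀ u : Vec p, fderiv ℝ f θ₀ u = 0 → ‖u‖ ≤ ρ →
      ∃ θ, f θ = f θ₀ ∧ ‖θ - θ₀ - u‖ ≤ ε * ‖u‖ := by
  have hsurj : (fderiv ℝ f θ₀).range = ⊤ := by
    rw [LinearMap.range_eq_top]
    intro y
    set J := jacobian f θ₀ with hJ
    -- The right inverse `Jᵀ (J Jᵀ)⁻¹`; the factor `1` lets `gram_posDef` apply with the identity as
    -- covariance.
    refine ⟨mv (Jᵀ * (J * (1 : Matrix (Fin p) (Fin p) ℝ) * Jᵀ)⁻¹) y, ?_⟩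
    change fderiv ℝ f θ₀ _ = y
    rw [← mv_jacobian, mv_mv, ← Matrix.mul_assoc, ← hJ]
    have := isUnit_det_of_posDef (gram_posDef (V := 1) Matrix.PosDef.one hr)
    rw [Matrix.mul_one] at this ⊢
    rw [Matrix.mul_nonsing_inv _ this, mv_one]
  set φ := hf.implicitFunction f _ hsurj (f θ₀) with hφ
  have h1 : ∀ᶠ y in 𝓝 (0 : (fderiv ℝ f θ₀).ker), f (φ y) = f θ₀ := by
    have h := hf.map_implicitFunction_eq hsurj
    have hc : Tendsto (fun y : (fderiv ℝ f θ₀).ker => (f θ₀, y)) (𝓝 0) (𝓝 (f θ₀, 0)) :=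
      (Continuous.prodMk_right _).tendsto _
    exact hc.eventually h
  have h2 : HasFDerivAt φ (fderiv ℝ f θ₀).ker.subtypeL 0 :=
    (hf.to_implicitFunction hsurj).hasFDerivAt
  have h0 : φ 0 = θ₀ := hf.implicitFunction_apply_image hsurj
  have h3 := (h2.isLittleO).def hε
  rw [h0] at h3
  obtain ⟨ρ, hρ, hball⟩ := Metric.nhds_basis_closedBall.mem_iff.1 (h1.and h3)
  refine ⟨ρ, hρ, fun u hu hn => ?_⟩
  have hmem : (⟨u, hu⟩ : (fderiv ℝ f θ₀).ker) ∈ Metric.closedBall 0 ρ := by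
    rw [mem_closedBall_zero_iff]; exact hn
  obtain ⟨e1, e2⟩ := hball hmem
  refine ⟨φ ⟨u, hu⟩, e1, ?_⟩
  simpa using e2

lemma exists_linear_approx (hf : HasFDerivAt f (fderiv ℝ f θ₀) θ₀) {ε : ℝ} (hε : 0 < ε) :
    ∃ ρ > 0, ∀ θ, ‖θ - θ₀‖ ≤ ρ → ‖f θ - f θ₀ - fderiv ℝ f θ₀ (θ - θ₀)‖ ≤ ε * ‖θ - θ₀‖ := by
  obtain ⟨ρ, hρ, h⟩ := Metric.nhds_basis_closedBall.mem_iff.1 (hf.isLittleO.def hε)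
  exact ⟨ρ, hρ, fun θ hθ => h (by rwa [mem_closedBall_iff_norm])⟩

end Local

/-! ### The profile statistic of a true hypothesis -/

section ProfileStat

variable {𝒳 : Type*} {p q n : ℕ}

lemma div_le_of_coe_le_mul {r b : ℝ} (hr : 0 < r) {e : EReal} (h : (b : EReal) ≤ (r : EReal) * e) :
    ((b / r : ℝ) : EReal) ≤ e := by
  calc ((b / r : ℝ) : EReal) = ((r⁻¹ : ℝ) : EReal) * (b : EReal) := by
        rw [← EReal.coe_mul]; congr 1; field_simp
    _ ≤ ((r⁻¹ : ℝ) : EReal) * ((r : EReal) * e) :=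
        mul_le_mul_of_nonneg_left h (by exact_mod_cast (inv_pos.2 hr).le)
    _ = e := by
        rw [← mul_assoc, ← EReal.coe_mul, inv_mul_cancel₀ hr.ne', EReal.coe_one, one_mul]

lemma coe_le_elStat {g : 𝒳 → Vec p → Vec p} {x : Fin n → 𝒳} {a : ℝ} {H : Set (Vec p)} {θ₀ : Vec p}
    {r b : ℝ} (hn : 0 < n) (ha : 0 < a)
    (h : ∀ θ ∈ H ∩ Metric.closedBall θ₀ r, (b : EReal) ≤ ((a ^ 2 / n : ℝ) : EReal) * ell g x θ) :
    (b : EReal) ≤ elStat g x a H θ₀ r := by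
  have hr : 0 < a ^ 2 / n := by have : (0 : ℝ) < n := by exact_mod_cast hn
                                positivity
  exact coe_le_mul_ell hr (le_iInf₂ fun θ hθ => div_le_of_coe_le_mul hr (h θ hθ))

lemma elStat_le {g : 𝒳 → Vec p → Vec p} {x : Fin n → 𝒳} {a : ℝ} {H : Set (Vec p)} {θ₀ θ : Vec p}
    {r : ℝ} (hθ : θ ∈ H ∩ Metric.closedBall θ₀ r) :
    elStat g x a H θ₀ r ≤ ((a ^ 2 / n : ℝ) : EReal) * ell g x θ :=
  mul_le_mul_of_nonneg_left (iInf₂_le θ hθ) (by exact_mod_cast (by positivity : 0 ≤ a ^ 2 / (n : ℝ)))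

lemma differentiableAt_meanG {g : 𝒳 → Vec p → Vec p} {x : Fin n → 𝒳} {N : Set (Vec p)}
    (hN : IsOpen N) (hg : ∀ i, ContDiffOn ℝ 1 (g (x i)) N) {θ : Vec p} (hθ : θ ∈ N) :
    DifferentiableAt ℝ (meanG g x) θ := by
  unfold meanG
  have h : DifferentiableAt ℝ (fun θ => ∑ i, g (x i) θ) θ := DifferentiableAt.fun_sum fun i _ =>
    ((hg i).differentiableOn one_ne_zero).differentiableAt (hN.mem_nhds hθ)
  exact DifferentiableAt.const_smul h ((n : ℝ)⁻¹)

/-- The mean value inequality on the fixed ball of radius `ρ`, with `G'(θ₀)` subtracted; the factor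
`a` cancels against `‖θ - θ₀‖ ≤ K / a`. -/
lemma meanG_linear_approx {g : 𝒳 → Vec p → Vec p} {x : Fin n → 𝒳} {G : Vec p → Vec p}
    {N : Set (Vec p)} {θ₀ : Vec p} (hN : IsOpen N) (hg : ∀ i, ContDiffOn ℝ 1 (g (x i)) N)
    {ρ τ a K : ℝ} (ha : 0 < a) (hKρ : K / a ≤ ρ) (hρN : Metric.closedBall θ₀ ρ ⊆ N)
    (hτ : ∀ θ ∈ Metric.closedBall θ₀ ρ, frobNorm (jacobian (meanG g x) θ - jacobian G θ₀) ≤ τ)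
    {θ : Vec p} (hθ : θ ∈ Metric.closedBall θ₀ (K / a)) :
    ‖a • meanG g x θ - (a • meanG g x θ₀ + mv (jacobian G θ₀) (a • (θ - θ₀)))‖ ≤ τ * K := by
  have hθ' : θ ∈ Metric.closedBall θ₀ ρ := Metric.closedBall_subset_closedBall hKρ hθ
  have hρ0 : 0 ≤ ρ := by
    rw [Metric.mem_closedBall] at hθ'; exact dist_nonneg.trans hθ'
  have h0 : θ₀ ∈ Metric.closedBall θ₀ ρ := Metric.mem_closedBall_self hρ0
  have hτ0 : 0 ≤ τ := (frobNorm_nonneg _).trans (hτ _ h0)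
  have := (convex_closedBall θ₀ ρ).norm_image_sub_le_of_norm_fderiv_le'
    (f := meanG g x) (φ := fderiv ℝ G θ₀) (C := τ)
    (fun y hy => differentiableAt_meanG hN hg (hρN hy))
    (fun y hy => (norm_fderiv_sub_le _ _ _ _).trans (hτ y hy)) h0 hθ'
  have e : a • meanG g x θ - (a • meanG g x θ₀ + mv (jacobian G θ₀) (a • (θ - θ₀)))
      = a • (meanG g x θ - meanG g x θ₀ - fderiv ℝ G θ₀ (θ - θ₀)) := by
    rw [mv_jacobian, map_smul, smul_sub, smul_sub]; abel
  rw [mem_closedBall_iff_norm, le_div_iff₀ ha] at hθ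
  rw [e, norm_smul, Real.norm_of_nonneg ha.le]
  calc a * ‖meanG g x θ - meanG g x θ₀ - fderiv ℝ G θ₀ (θ - θ₀)‖ ≤ a * (τ * ‖θ - θ₀‖) := by gcongr
    _ = τ * (‖θ - θ₀‖ * a) := by ring
    _ ≤ τ * K := by gcongr

set_option maxHeartbeats 1000000 in
/-- The profile statistic of a true hypothesis is close to a quadratic form in `a G_n(θ₀)`. -/
lemma elStat_approx {g : 𝒳 → Vec p → Vec p} {G : Vec p → Vec p} {Θ N : Set (Vec p)} {θ₀ : Vec p}
    {V : Vec p → Matrix (Fin p) (Fin p) ℝ} {h : Vec p → Vec q}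
    (hθ₀ : θ₀ ∈ interior Θ) (hN : IsOpen N) (hθ₀N : θ₀ ∈ N) (hG : ContDiffOn ℝ 1 G N)
    (hD : IsUnit (jacobian G θ₀).det) (hV : (V θ₀).PosDef)
    (hVc : Tendsto (fun θ => frobNorm (V θ - V θ₀)) (𝓝 θ₀) (𝓝 0))
    (hh : ContDiffOn ℝ 1 h N) (hJ : (jacobian h θ₀).rank = q) (hh0 : h θ₀ = 0) :
    ∃ C, 0 ≤ C ∧ ∀ K, 0 < K → ∀ η, 0 < η → ∃ ε, 0 < ε ∧ ∀ {n : ℕ} (x : Fin n → 𝒳) (a : ℝ),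
      0 < n → 0 < a → 1 / a ≤ ε → (∀ i, ContDiffOn ℝ 1 (g (x i)) N) →
      (∀ θ ∈ N, frobNorm (jacobian (meanG g x) θ - jacobian G θ) ≤ ε) →
      (∀ θ ∈ N, frobNorm (meanS g x θ - V θ) ≤ ε) →
      (∀ i, ∀ θ ∈ Metric.closedBall θ₀ (K / a), ‖g (x i) θ‖ ≤ ε * a) →
      C * ‖a • meanG g x θ₀‖ ≤ K →
      ((qf (quadMatrix (jacobian h θ₀ * (jacobian G θ₀)⁻¹) (V θ₀)) (a • meanG g x θ₀) - η : ℝ) :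
        EReal) ≤ elStat g x a (nullSet Θ h) θ₀ (K / a) ∧
      elStat g x a (nullSet Θ h) θ₀ (K / a) ≤
      ((qf (quadMatrix (jacobian h θ₀ * (jacobian G θ₀)⁻¹) (V θ₀)) (a • meanG g x θ₀) + η : ℝ) :
        EReal) := by
  set D := jacobian G θ₀ with hDdef
  set J := jacobian h θ₀ with hJdef
  set V₀ := V θ₀ with hV₀
  set L := J * D⁻¹ with hL
  set A := quadMatrix L V₀ with hA
  have hLrank : L.rank = q := by
    rw [hL, Matrix.rank_mul_eq_left_of_isUnit_det, hJ]
    exact Matrix.isUnit_nonsing_inv_det D hD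
  have hLD : L * D = J := by rw [hL, Matrix.mul_assoc, Matrix.nonsing_inv_mul _ hD, Matrix.mul_one]
  set fD := frobNorm D
  set fW := frobNorm D⁻¹
  set fP := frobNorm (V₀ * A)
  set fL := frobNorm L
  set cM := frobNorm (L * V₀ * Lᵀ)⁻¹
  set cV := frobNorm V₀⁻¹
  have hfD : 0 ≤ fD := frobNorm_nonneg _
  have hfW : 0 ≤ fW := frobNorm_nonneg _
  have hfP : 0 ≤ fP := frobNorm_nonneg _
  have hfL : 0 ≤ fL := frobNorm_nonneg _
  have hcM : 0 ≤ cM := frobNorm_nonneg _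
  have hcV : 0 ≤ cV := frobNorm_nonneg _
  -- This constant makes the local minimiser `u` satisfy `‖u‖ ≤ K / 2`, leaving room for the
  -- curvature of the level set; the `+ 1` gives `‖z‖ ≤ K`. It depends on neither `K` nor `η`, which
  -- later lets tightness of `z` discharge the condition as `K → ∞`.
  refine ⟨2 * (fW * (fP + 1)) + 1, by positivity, fun K hK η hη => ?_⟩
  -- A bound for `‖z‖`, the linear term `D u` and the linearisation error together.
  set R := K + fD * K + 1 with hR
  have hR0 : 0 < R := by positivity
  have hVu := isUnit_det_of_posDef hV
  obtain ⟨εl, hεl, hlow⟩ := ell_approx_lower g hVu hR0.le (half_pos hη)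
  obtain ⟨εu, hεu, hupp⟩ := ell_approx_upper g hVu hR0.le (half_pos hη)
  set ε₁ := min εl εu with hε₁
  have hε₁0 : 0 < ε₁ := lt_min hεl hεu
  -- The last two conditions are the errors of the lower and the upper half, respectively.
  have key : ∀ᶠ τ in 𝓝[>] (0 : ℝ), (τ ≤ 1 ∧ 2 * τ * K ≤ 1) ∧
      (cM * (fL * (2 * τ * K) + τ * K) * (fL * R + fL * R) ≤ η / 2 ∧
      cV * (2 * τ * K + fD * (τ * K)) * (R + fP * K) ≤ η / 2) := by
    have h1 : Tendsto (fun τ : ℝ => τ) (𝓝 0) (𝓝 0) := tendsto_id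
    have h2 : Tendsto (fun τ : ℝ => 2 * τ * K) (𝓝 0) (𝓝 0) := by
      have h : Continuous (fun τ : ℝ => 2 * τ * K) := by fun_prop
      exact h.tendsto' _ _ (by simp)
    have h3 : Tendsto (fun τ : ℝ => cM * (fL * (2 * τ * K) + τ * K) * (fL * R + fL * R)) (𝓝 0)
        (𝓝 0) := by
      have h : Continuous fun τ : ℝ => cM * (fL * (2 * τ * K) + τ * K) * (fL * R + fL * R) := by
        fun_prop
      exact h.tendsto' _ _ (by simp)
    have h4 : Tendsto (fun τ : ℝ => cV * (2 * τ * K + fD * (τ * K)) * (R + fP * K)) (𝓝 0)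
        (𝓝 0) := by
      have h : Continuous fun τ : ℝ => cV * (2 * τ * K + fD * (τ * K)) * (R + fP * K) := by fun_prop
      exact h.tendsto' _ _ (by simp)
    exact nhdsWithin_le_nhds (((h1.eventually_le_const one_pos).and
      (h2.eventually_le_const one_pos)).and ((h3.eventually_le_const (half_pos hη)).and
      (h4.eventually_le_const (half_pos hη))))
  obtain ⟨τ, ⟨⟨hτ1, hτK⟩, hτM, hτV⟩, hτ0⟩ := (key.and self_mem_nhdsWithin).exists
  replace hτ0 : 0 < τ := hτ0
  have hhc : ContDiffAt ℝ 1 h θ₀ := hh.contDiffAt (hN.mem_nhds hθ₀N)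
  have hstrict := hhc.hasStrictFDerivAt one_ne_zero
  obtain ⟨ρ₁, hρ₁, hlin⟩ := exists_linear_approx hstrict.hasFDerivAt hτ0
  obtain ⟨ρ₂, hρ₂, hlev⟩ := exists_level_point hstrict hJ hτ0
  have hloc : ∀ᶠ θ in 𝓝 θ₀, (θ ∈ N ∧ θ ∈ Θ) ∧ frobNorm (jacobian G θ - D) ≤ τ ∧
      frobNorm (V θ - V₀) ≤ ε₁ / 2 :=
    ((hN.eventually_mem hθ₀N).and
      (show ∀ᶠ θ in 𝓝 θ₀, θ ∈ Θ from mem_interior_iff_mem_nhds.1 hθ₀)).and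
      (((tendsto_jacobian hN hθ₀N hG).eventually_le_const hτ0).and
        (hVc.eventually_le_const (half_pos hε₁0)))
  obtain ⟨ρ₃, hρ₃, hball⟩ := Metric.nhds_basis_closedBall.mem_iff.1 hloc
  set ρ := min ρ₁ (min ρ₂ ρ₃) with hρdef
  have hρ : 0 < ρ := lt_min hρ₁ (lt_min hρ₂ hρ₃)
  have hρle₁ : ρ ≤ ρ₁ := min_le_left _ _
  have hρle₂ : ρ ≤ ρ₂ := (min_le_right _ _).trans (min_le_left _ _)
  have hρle₃ : ρ ≤ ρ₃ := (min_le_right _ _).trans (min_le_right _ _)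
  -- Since `1 / a ≤ ε`, the last entry forces `K / a ≤ ρ`.
  refine ⟨min τ (min (ε₁ / 2) (ρ / K)), by positivity, ?_⟩
  set ε := min τ (min (ε₁ / 2) (ρ / K)) with hε
  have hετ : ε ≤ τ := min_le_left _ _
  have hεε : ε ≤ ε₁ / 2 := (min_le_right _ _).trans (min_le_left _ _)
  have hερ : ε ≤ ρ / K := (min_le_right _ _).trans (min_le_right _ _)
  intro n x a hn ha hainv hg hjac hS hmax hCz
  set z := a • meanG g x θ₀ with hz
  have hz0 : 0 ≤ ‖z‖ := norm_nonneg _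
  have hzK : ‖z‖ ≤ K := by
    have : 0 ≤ 2 * (fW * (fP + 1)) * ‖z‖ := by positivity
    linarith
  have huK : fW * (fP + 1) * ‖z‖ ≤ K / 2 := by linarith
  have hKρ : K / a ≤ ρ := by
    calc K / a = K * (1 / a) := by ring
      _ ≤ K * (ρ / K) := mul_le_mul_of_nonneg_left (hainv.trans hερ) hK.le
      _ = ρ := by field_simp
  have hin : ∀ θ ∈ Metric.closedBall θ₀ ρ, (θ ∈ N ∧ θ ∈ Θ) ∧ frobNorm (jacobian G θ - D) ≤ τ ∧
      frobNorm (V θ - V₀) ≤ ε₁ / 2 := fun θ hθ =>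
    hball (Metric.closedBall_subset_closedBall hρle₃ hθ)
  have hexp : ∀ θ ∈ Metric.closedBall θ₀ (K / a),
      ‖a • meanG g x θ - (z + mv D (a • (θ - θ₀)))‖ ≤ 2 * τ * K := fun θ hθ =>
    meanG_linear_approx hN hg ha hKρ (fun y hy => (hin y hy).1.1) (fun y hy => by
      have h1 := frobNorm_sub_le (jacobian (meanG g x) y) (jacobian G y) D
      have h2 := hjac y (hin y hy).1.1
      have h3 := (hin y hy).2.1
      linarith) hθ
  have huball : ∀ θ ∈ Metric.closedBall θ₀ (K / a), ‖a • (θ - θ₀)‖ ≤ K := fun θ hθ => by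
    rw [mem_closedBall_iff_norm, le_div_iff₀ ha] at hθ
    rw [norm_smul, Real.norm_of_nonneg ha.le]; linarith
  have hζR : ∀ θ ∈ Metric.closedBall θ₀ (K / a), ‖a • meanG g x θ‖ ≤ R := fun θ hθ => by
    have h1 := hexp θ hθ
    have h2 : ‖mv D (a • (θ - θ₀))‖ ≤ fD * K :=
      (norm_mv_le _ _).trans (by gcongr; exact huball θ hθ)
    have h3 := norm_add_le (a • meanG g x θ - (z + mv D (a • (θ - θ₀)))) (z + mv D (a • (θ - θ₀)))
    rw [sub_add_cancel] at h3
    have h4 := norm_add_le z (mv D (a • (θ - θ₀)))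
    linarith
  have hS₁ : ∀ θ ∈ Metric.closedBall θ₀ (K / a), frobNorm (meanS g x θ - V₀) ≤ ε₁ := fun θ hθ => by
    have hθ' := hin θ (Metric.closedBall_subset_closedBall hKρ hθ)
    have h1 := frobNorm_sub_le (meanS g x θ) (V θ) V₀
    have h2 := hS θ hθ'.1.1
    linarith [hθ'.2.2]
  have hg₁ : ∀ θ ∈ Metric.closedBall θ₀ (K / a), ∀ i, ‖g (x i) θ‖ ≤ ε₁ * a := fun θ hθ i =>
    (hmax i θ hθ).trans (by gcongr; linarith)
  constructor
  · refine coe_le_elStat hn ha fun θ hθ => ?_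
    obtain ⟨⟨-, hθ0⟩, hθb⟩ := hθ
    refine le_trans ?_ (hlow ε₁ hε₁0 (min_le_left _ _) x θ a hn ha (hS₁ θ hθb) (hg₁ θ hθb)
      (hζR θ hθb))
    rw [EReal.coe_le_coe_iff]
    set ζ := a • meanG g x θ with hζ
    set u := a • (θ - θ₀) with hu
    -- For any `θ` in the hypothesis, it remains to compare `L ζ` with `L z`: their difference is `J
    -- u`, small by linearisation of `h`, up to the error of `ζ`.
    have h1 : qf A ζ ≤ qf V₀⁻¹ ζ := qf_quadMatrix_le hV hLrank ζ
    have hJu : ‖mv J u‖ ≤ τ * K := by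
      have hd := hlin θ (by
        rw [← mem_closedBall_iff_norm]
        exact Metric.closedBall_subset_closedBall (hKρ.trans hρle₁) hθb)
      rw [hθ0, hh0, sub_zero, zero_sub, norm_neg] at hd
      rw [hu, mv_jacobian, map_smul, norm_smul, Real.norm_of_nonneg ha.le]
      have hb := huball θ hθb
      rw [norm_smul, Real.norm_of_nonneg ha.le] at hb
      calc a * ‖fderiv ℝ h θ₀ (θ - θ₀)‖ ≤ a * (τ * ‖θ - θ₀‖) := by gcongr
        _ = τ * (a * ‖θ - θ₀‖) := by ring
        _ ≤ τ * K := by gcongr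
    have hdiff : ‖mv L ζ - mv L z‖ ≤ fL * (2 * τ * K) + τ * K := by
      have e : mv L ζ - mv L z = mv L (ζ - (z + mv D u)) + mv J u := by
        rw [mv_sub, mv_add, mv_mv, hLD]; abel
      rw [e]
      refine (norm_add_le _ _).trans (add_le_add ((norm_mv_le _ _).trans ?_) hJu)
      gcongr
      exact hexp θ hθb
    have hLζ : ‖mv L ζ‖ ≤ fL * R := (norm_mv_le _ _).trans (by gcongr; exact hζR θ hθb)
    have hLz : ‖mv L z‖ ≤ fL * R := (norm_mv_le _ _).trans (by
      gcongr; rw [hR]; nlinarith)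
    have h2 := abs_qf_sub_le (L * V₀ * Lᵀ)⁻¹ (mv L ζ) (mv L z)
    rw [← qf_quadMatrix, ← qf_quadMatrix] at h2
    have h3 : |qf A ζ - qf A z| ≤ η / 2 := by
      refine h2.trans (le_trans ?_ hτM)
      gcongr
    have := (abs_le.1 h3).1
    linarith
  -- The local parameter at which `z + D u` is the minimiser `V A z`. It lies in `ker J`, so `u / a`
  -- can be moved onto the level set.
  · set u := mv D⁻¹ (mv (V₀ * A) z - z) with hu
    have hDu : mv D u = mv (V₀ * A) z - z := by
      rw [hu, mv_mv, Matrix.mul_nonsing_inv _ hD, mv_one]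
    have hJu : mv J u = 0 := by
      rw [hu, mv_mv, ← hL, mv_sub, mv_mv, proj_constraint hV hLrank, sub_self]
    have hun : ‖u‖ ≤ K / 2 := by
      refine le_trans ?_ huK
      rw [mul_assoc]
      refine (norm_mv_le _ _).trans ?_
      gcongr
      have := norm_mv_le (V₀ * A) z
      linarith [norm_sub_le (mv (V₀ * A) z) z]
    have hua : ‖a⁻¹ • u‖ = ‖u‖ / a := by
      rw [norm_smul, norm_inv, Real.norm_of_nonneg ha.le]; ring
    have huρ : ‖a⁻¹ • u‖ ≤ ρ₂ := by
      rw [hua]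
      refine le_trans ?_ (hKρ.trans hρle₂)
      gcongr
      linarith
    obtain ⟨θ, hθ0, hθu⟩ := hlev (a⁻¹ • u) (by rw [map_smul, ← mv_jacobian, hJu, smul_zero]) huρ
    have hθb : θ ∈ Metric.closedBall θ₀ (K / a) := by
      rw [mem_closedBall_iff_norm]
      have h1 := norm_add_le (θ - θ₀ - a⁻¹ • u) (a⁻¹ • u)
      rw [sub_add_cancel] at h1
      have h2 : τ * ‖a⁻¹ • u‖ ≤ 1 * ‖a⁻¹ • u‖ := by gcongr
      have h3 : ‖a⁻¹ • u‖ ≤ K / a / 2 := by rw [hua, div_right_comm]; gcongr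
      linarith
    have hθΘ := (hin θ (Metric.closedBall_subset_closedBall hKρ hθb)).1.2
    have hmem : θ ∈ nullSet Θ h ∩ Metric.closedBall θ₀ (K / a) := ⟨⟨hθΘ, hθ0.trans hh0⟩, hθb⟩
    refine (elStat_le hmem).trans ((hupp ε₁ hε₁0 (min_le_right _ _) x θ a hn
      ha (by linarith) (hS₁ θ hθb) (hg₁ θ hθb) (hζR θ hθb)).trans ?_)
    rw [EReal.coe_le_coe_iff]
    set ζ := a • meanG g x θ with hζ
    have hdu : ‖mv D (a • (θ - θ₀)) - mv D u‖ ≤ fD * (τ * K) := by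
      rw [← mv_sub]
      refine (norm_mv_le _ _).trans ?_
      gcongr
      have e : a • (θ - θ₀) - u = a • (θ - θ₀ - a⁻¹ • u) := by
        rw [smul_sub a (θ - θ₀), smul_inv_smul₀ ha.ne']
      rw [e, norm_smul, Real.norm_of_nonneg ha.le]
      calc a * ‖θ - θ₀ - a⁻¹ • u‖ ≤ a * (τ * ‖a⁻¹ • u‖) := by gcongr
        _ = τ * ‖u‖ := by rw [hua]; field_simp
        _ ≤ τ * K := by gcongr; linarith
    have hdiff : ‖ζ - mv (V₀ * A) z‖ ≤ 2 * τ * K + fD * (τ * K) := by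
      have e : ζ - mv (V₀ * A) z
          = (ζ - (z + mv D (a • (θ - θ₀)))) + (mv D (a • (θ - θ₀)) - mv D u) := by
        rw [hDu]; abel
      rw [e]
      exact (norm_add_le _ _).trans (add_le_add (hexp θ hθb) hdu)
    have hP : ‖mv (V₀ * A) z‖ ≤ fP * K := (norm_mv_le _ _).trans (by gcongr)
    have h2 := abs_qf_sub_le V₀⁻¹ ζ (mv (V₀ * A) z)
    rw [qf_inv_proj hV hLrank] at h2
    have h3 : |qf V₀⁻¹ ζ - qf A z| ≤ η / 2 := by
      refine h2.trans (le_trans ?_ hτV)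
      have := hζR θ hθb
      gcongr
    have := (abs_le.1 h3).2
    linarith

end ProfileStat

/-! ### Weak convergence, uniformly over events -/

section Weak

/-- The Lévy–Prokhorov distance metrises weak convergence here, so the inequalities hold for all
events simultaneously; `B` may then depend on the data and on `n`. -/
lemma eventually_measure_le_thickening {ι E : Type*} [PseudoMetricSpace E] [MeasurableSpace E]
    [SecondCountableTopology E] [BorelSpace E] {l : Filter ι} {μs : ι → ProbabilityMeasure E}
    {μ : ProbabilityMeasure E} (h : Tendsto μs l (𝓝 μ)) {η : ℝ} (hη : 0 < η) :
    ∀ᶠ i in l, ∀ B, MeasurableSet B →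
      (μs i : Measure E) B ≤ (μ : Measure E) (Metric.thickening η B) + ENNReal.ofReal η ∧
      (μ : Measure E) B ≤ (μs i : Measure E) (Metric.thickening η B) + ENNReal.ofReal η := by
  have h1 := (LevyProkhorov.continuous_ofMeasure_probabilityMeasure (Ω := E)).continuousAt.tendsto.comp h
  have h2 := (EMetric.tendsto_nhds.1 h1) (ENNReal.ofReal η) (ENNReal.ofReal_pos.2 hη)
  filter_upwards [h2] with i hi B hB
  rw [LevyProkhorov.edist_probabilityMeasure_def] at hi
  have ha := left_measure_le_of_levyProkhorovEDist_lt hi hB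
  have hb := right_measure_le_of_levyProkhorovEDist_lt hi hB
  rw [ENNReal.toReal_ofReal hη.le] at ha hb
  exact ⟨ha, hb⟩

variable {m : ℕ}

lemma thickening_Iic_subset (x : Fin m → ℝ) (η : ℝ) :
    Metric.thickening η (Set.Iic x) ⊆ Set.Iic (fun j => x j + η) := by
  intro y hy
  obtain ⟨z, hz, hyz⟩ := Metric.mem_thickening_iff.1 hy
  intro j
  have h1 : z j ≤ x j := hz j
  have h2 := (dist_le_pi_dist y z j).trans_lt hyz
  rw [Real.dist_eq] at h2
  have := (abs_lt.1 h2).2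
  change y j ≤ x j + η
  linarith

/-- An atomless law on the line gives small mass to short intervals, uniformly. -/
lemma exists_short_interval_small {ν : Measure ℝ} [IsProbabilityMeasure ν] (hν : ∀ c, ν {c} = 0)
    {ε : ℝ≥0∞} (hε : 0 < ε) : ∃ η : ℝ, 0 < η ∧ ∀ c, ν (Metric.closedBall c η) ≤ ε := by
  by_contra! hcon
  -- Otherwise shrinking intervals keep mass above `ε`. Tightness bounds their centres, and a limit
  -- point of the centres would be an atom.
  have hk : ∀ k : ℕ, ∃ c, ε < ν (Metric.closedBall c (1 / (k + 1 : ℝ))) := fun k =>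
    hcon _ (by positivity)
  choose c hc using hk
  have hmono : ∀ {s t : Set ℝ}, ε < ν s → s ⊆ t → ε < ν t := fun h hst =>
    h.trans_le (measure_mono hst)
  obtain ⟨R, hR⟩ : ∃ R : ℝ, ν (Metric.closedBall 0 R)ᶜ < ε := by
    have h : Tendsto (fun k : ℕ => ν (Metric.closedBall (0 : ℝ) k)ᶜ) atTop (𝓝 0) := by
      have h0 : ⋂ k : ℕ, (Metric.closedBall (0 : ℝ) k)ᶜ = ∅ := by
        rw [← Set.compl_iUnion, Metric.iUnion_closedBall_nat, Set.compl_univ]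
      have := tendsto_measure_iInter_atTop (μ := ν)
        (s := fun k : ℕ => (Metric.closedBall (0 : ℝ) k)ᶜ)
        (fun k => Metric.isClosed_closedBall.measurableSet.compl.nullMeasurableSet)
        (fun a b hab => Set.compl_subset_compl.2
          (Metric.closedBall_subset_closedBall (by exact_mod_cast hab)))
        ⟨0, measure_ne_top _ _⟩
      rwa [h0, measure_empty] at this
    obtain ⟨k, hk⟩ := (h.eventually_lt_const hε).exists
    exact ⟨k, hk⟩
  have hbd : ∀ k, c k ∈ Metric.closedBall (0 : ℝ) (R + 1) := by
    intro k
    by_contra hck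
    apply lt_asymm (hc k)
    refine (measure_mono fun y hy => ?_).trans_lt hR
    simp only [Metric.mem_closedBall, dist_zero_right, Real.norm_eq_abs, not_le, Set.mem_compl_iff,
      Real.dist_eq] at hck hy ⊢
    have h1 : 1 / (k + 1 : ℝ) ≤ 1 := by
      rw [div_le_one (by positivity)]; linarith [(Nat.cast_nonneg k : (0 : ℝ) ≤ k)]
    have h2 := abs_sub_abs_le_abs_sub (c k) y
    rw [abs_sub_comm] at h2
    linarith
  obtain ⟨a, -, φ, hφ, hφa⟩ := (isCompact_closedBall (0 : ℝ) (R + 1)).tendsto_subseq hbd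
  have hball : ∀ r : ℝ, 0 < r → ε ≤ ν (Metric.closedBall a r) := by
    intro r hr
    have h1 : ∀ᶠ k in atTop, dist (c (φ k)) a < r / 2 := (Metric.tendsto_nhds.1 hφa) _ (half_pos hr)
    have h2 : ∀ᶠ k in atTop, 1 / ((φ k : ℝ) + 1) < r / 2 :=
      (tendsto_one_div_add_atTop_nhds_zero_nat.comp hφ.tendsto_atTop).eventually_lt_const
        (half_pos hr)
    obtain ⟨k, hk1, hk2⟩ := (h1.and h2).exists
    refine (hmono (hc (φ k)) fun y hy => ?_).le
    rw [Metric.mem_closedBall] at hy ⊢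
    linarith [dist_triangle y (c (φ k)) a]
  have hlim : Tendsto (fun k : ℕ => ν (Metric.closedBall a (1 / (k + 1 : ℝ)))) atTop (𝓝 0) := by
    have h0 : ⋂ k : ℕ, Metric.closedBall a (1 / (k + 1 : ℝ)) = {a} := by
      ext y
      simp only [Set.mem_iInter, Metric.mem_closedBall, Set.mem_singleton_iff]
      refine ⟨fun h => ?_, fun h k => by subst h; simp; positivity⟩
      have : dist y a ≤ 0 := ge_of_tendsto' tendsto_one_div_add_atTop_nhds_zero_nat h
      exact dist_le_zero.1 this
    have := tendsto_measure_iInter_atTop (μ := ν)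
      (s := fun k : ℕ => Metric.closedBall a (1 / (k + 1 : ℝ)))
      (fun k => Metric.isClosed_closedBall.measurableSet.nullMeasurableSet)
      (fun i j hij => Metric.closedBall_subset_closedBall (one_div_le_one_div_of_le (by positivity)
        (by gcongr)))
      ⟨0, measure_ne_top _ _⟩
    rwa [h0, hν] at this
  exact absurd (ge_of_tendsto' hlim fun k => hball _ (by positivity)) (not_le.2 hε)

/-- The distribution function of a law with atomless marginals is uniformly continuous. -/
lemma exists_cdf_osc_small {μ : Measure (Fin m → ℝ)} [IsProbabilityMeasure μ]
    (hμ : ∀ j c, μ {t | t j = c} = 0) {ε : ℝ≥0∞} (hε : 0 < ε) :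
    ∃ η : ℝ, 0 < η ∧ ∀ c : Fin m → ℝ, μ {t | ∃ j, |t j - c j| ≤ η} ≤ ε := by
  -- A union bound over coordinates; the denominator `m + 1` also covers `m = 0`.
  have h1 : ∀ j : Fin m, ∃ η : ℝ, 0 < η ∧ ∀ c : ℝ, μ {t | |t j - c| ≤ η} ≤ ε / (m + 1 : ℕ) := by
    intro j
    have hm : Measurable fun t : Fin m → ℝ => t j := measurable_pi_apply j
    have : IsProbabilityMeasure (μ.map fun t => t j) := Measure.isProbabilityMeasure_map hm.aemeasurable
    obtain ⟨η, hη, h⟩ := exists_short_interval_small (ν := μ.map fun t => t j)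
      (fun c => by rw [Measure.map_apply hm (measurableSet_singleton c)]; exact hμ j c)
      (ε := ε / (m + 1 : ℕ)) (ENNReal.div_pos hε.ne' (ENNReal.natCast_ne_top _))
    refine ⟨η, hη, fun c => ?_⟩
    have := h c
    rw [Measure.map_apply hm Metric.isClosed_closedBall.measurableSet] at this
    exact this
  choose η hη h using h1
  obtain ⟨η₀, hη₀, hle⟩ : ∃ η₀ : ℝ, 0 < η₀ ∧ ∀ j, η₀ ≤ η j := by
    rcases isEmpty_or_nonempty (Fin m) with he | hne
    · exact ⟨1, one_pos, fun j => he.elim j⟩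
    · obtain ⟨j, hj⟩ := Finite.exists_min η
      exact ⟨η j, hη j, hj⟩
  refine ⟨η₀, hη₀, fun c => ?_⟩
  calc μ {t | ∃ j, |t j - c j| ≤ η₀} ≤ μ (⋃ j, {t | |t j - c j| ≤ η j}) := by
        refine measure_mono fun t ht => ?_
        obtain ⟨j, hj⟩ := ht
        exact Set.mem_iUnion.2 ⟨j, hj.trans (hle j)⟩
    _ ≤ ∑ j, μ {t | |t j - c j| ≤ η j} := measure_iUnion_fintype_le _ _
    _ ≤ ∑ _j : Fin m, ε / (m + 1 : ℕ) := Finset.sum_le_sum fun j _ => h j _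
    _ = m * (ε / (m + 1 : ℕ)) := by simp
    _ ≤ (m + 1 : ℕ) * (ε / (m + 1 : ℕ)) := by gcongr; simp
    _ ≤ ε := ENNReal.mul_div_le

end Weak

/-! ### The limit law -/

section LimitLaw

open scoped MatrixOrder

variable {p m : ℕ} {q : Fin m → ℕ}

instance (L : (j : Fin m) → Matrix (Fin (q j)) (Fin p) ℝ) (S : Matrix (Fin p) (Fin p) ℝ) :
    IsProbabilityMeasure (amcLaw L S) := by
  refine Measure.isProbabilityMeasure_map (Measurable.aemeasurable ?_)
  refine measurable_pi_iff.2 fun j => Continuous.measurable ?_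
  unfold dotProduct Matrix.mulVec dotProduct
  fun_prop

lemma amcLaw_eq_map (L : (j : Fin m) → Matrix (Fin (q j)) (Fin p) ℝ)
    (S : Matrix (Fin p) (Fin p) ℝ) :
    amcLaw L S = (multivariateGaussian (0 : Vec p) S).map fun u j => qf (quadMatrix (L j) S) u := rfl

lemma continuous_qf_pair : Continuous fun x : Vec p × (Fin m → Fin p → Fin p → ℝ) =>
    fun j => qf (Matrix.of (x.2 j)) x.1 := by
  unfold qf dotProduct Matrix.mulVec dotProduct
  simp only [Matrix.of_apply]
  fun_prop

lemma continuous_qf (A : Matrix (Fin p) (Fin p) ℝ) : Continuous (qf A) := by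
  unfold qf dotProduct Matrix.mulVec dotProduct
  fun_prop

/-- By Lévy's continuity theorem: the Gaussian characteristic function is continuous in the
covariance. -/
lemma tendsto_multivariateGaussian {S : ℕ → Matrix (Fin p) (Fin p) ℝ} {V : Matrix (Fin p) (Fin p) ℝ}
    (hS : ∀ k, (S k).PosSemidef) (hV : V.PosSemidef) (h : Tendsto S atTop (𝓝 V)) :
    Tendsto (β := ProbabilityMeasure (Vec p))
      (fun k => ⟨multivariateGaussian 0 (S k), inferInstance⟩) atTop
      (𝓝 ⟨multivariateGaussian 0 V, inferInstance⟩) := by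
  apply ProbabilityMeasure.tendsto_of_tendsto_charFun
  intro t
  simp only [ProbabilityMeasure.coe_mk, charFun_multivariateGaussian (hS _),
    charFun_multivariateGaussian hV]
  have hc : Continuous fun M : Matrix (Fin p) (Fin p) ℝ =>
      Complex.exp ((inner ℝ t (0 : Vec p) : ℝ) * Complex.I - ((t.ofLp ⬝ᵥ M *ᵥ t.ofLp : ℝ) : ℂ) / 2) := by
    unfold dotProduct Matrix.mulVec dotProduct
    fun_prop
  exact (hc.tendsto V).comp h

lemma tendsto_quadMatrix {r : ℕ} {L : Matrix (Fin r) (Fin p) ℝ} {V : Matrix (Fin p) (Fin p) ℝ}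
    (hV : V.PosDef) (hL : L.rank = r) : ContinuousAt (quadMatrix L) V := by
  unfold quadMatrix
  have h1 : ContinuousAt (fun S : Matrix (Fin p) (Fin p) ℝ => L * S * Lᵀ) V := by fun_prop
  have h2 : ContinuousAt (fun S : Matrix (Fin p) (Fin p) ℝ => (L * S * Lᵀ)⁻¹) V :=
    ContinuousAt.comp (f := fun S : Matrix (Fin p) (Fin p) ℝ => L * S * Lᵀ)
      (continuousAt_matrix_inv (isUnit_det_of_posDef (gram_posDef hV hL))) h1
  have h3 : Continuous fun M : Matrix (Fin r) (Fin r) ℝ => Lᵀ * M * L := by fun_prop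
  exact h3.continuousAt.comp h2

/-- Both the Gaussian law and the matrices of the forms vary with `k`. The matrices are treated as
constant random elements, so that Slutsky's theorem handles the pair. -/
lemma tendsto_amcLaw {L : (j : Fin m) → Matrix (Fin (q j)) (Fin p) ℝ}
    {S : ℕ → Matrix (Fin p) (Fin p) ℝ} {V : Matrix (Fin p) (Fin p) ℝ}
    (hS : ∀ k, (S k).PosSemidef) (hV : V.PosDef) (hL : ∀ j, (L j).rank = q j)
    (h : Tendsto S atTop (𝓝 V)) :
    Tendsto (β := ProbabilityMeasure (Fin m → ℝ)) (fun k => ⟨amcLaw L (S k), inferInstance⟩) atTop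
      (𝓝 ⟨amcLaw L V, inferInstance⟩) := by
  let X : ℕ → Vec p → Vec p := fun k x => 0 + Matrix.toEuclideanCLM (𝕜 := ℝ) (CFC.sqrt (S k)) x
  let c : Matrix (Fin p) (Fin p) ℝ → Fin m → Fin p → Fin p → ℝ := fun M j => quadMatrix (L j) M
  have hc : Tendsto (fun k => c (S k)) atTop (𝓝 (c V)) := by
    refine tendsto_pi_nhds.2 fun j => ?_
    exact (tendsto_quadMatrix hV (hL j)).tendsto.comp h
  have hX : ∀ k, Measurable (X k) := fun k => by fun_prop
  have hXd : TendstoInDistribution X atTop (id : Vec p → Vec p)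
      (fun _ => stdGaussian (Vec p)) (multivariateGaussian (0 : Vec p) V) :=
    { forall_aemeasurable := fun k => (hX k).aemeasurable
      aemeasurable_limit := aemeasurable_id
      tendsto := by
        have := tendsto_multivariateGaussian hS hV.posSemidef h
        simp only [Measure.map_id]
        exact this }
  have hY : TendstoInMeasure (stdGaussian (Vec p)) (fun k (_ : Vec p) => c (S k)) atTop
      (fun _ => c V) := by
    refine tendstoInMeasure_of_tendsto_ae (fun k => aestronglyMeasurable_const) ?_
    exact ae_of_all _ fun _ => hc
  have hfin := hXd.continuous_comp_prodMk_of_tendstoInMeasure_const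
    (continuous_qf_pair (p := p) (m := m)) hY (fun k => aemeasurable_const)
  have e1 : ∀ k, amcLaw L (S k) = (stdGaussian (Vec p)).map
      fun ω j => qf (Matrix.of (c (S k) j)) (X k ω) := by
    intro k
    have hq : Measurable fun (u : Vec p) (j : Fin m) => qf (quadMatrix (L j) (S k)) u :=
      measurable_pi_iff.2 fun j => (continuous_qf _).measurable
    rw [amcLaw_eq_map, multivariateGaussian, Measure.map_map hq (hX k)]
    rfl
  have := hfin.tendsto
  simp only [← e1] at this
  exact this

/-- Covariance matrices close to a positive definite one give close laws, uniformly over events. -/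
lemma exists_amcLaw_close {L : (j : Fin m) → Matrix (Fin (q j)) (Fin p) ℝ}
    {V : Matrix (Fin p) (Fin p) ℝ} (hV : V.PosDef) (hL : ∀ j, (L j).rank = q j) {η : ℝ}
    (hη : 0 < η) :
    ∃ δ : ℝ, 0 < δ ∧ ∀ S : Matrix (Fin p) (Fin p) ℝ, S.PosSemidef → frobNorm (S - V) ≤ δ →
      ∀ B, MeasurableSet B →
        amcLaw L S B ≤ amcLaw L V (Metric.thickening η B) + ENNReal.ofReal η ∧
        amcLaw L V B ≤ amcLaw L S (Metric.thickening η B) + ENNReal.ofReal η := by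
  by_contra hcon
  have hk : ∀ k : ℕ, ∃ S : Matrix (Fin p) (Fin p) ℝ, S.PosSemidef ∧
      frobNorm (S - V) ≤ 1 / (k + 1 : ℝ) ∧ ¬ ∀ B, MeasurableSet B →
        amcLaw L S B ≤ amcLaw L V (Metric.thickening η B) + ENNReal.ofReal η ∧
        amcLaw L V B ≤ amcLaw L S (Metric.thickening η B) + ENNReal.ofReal η := by
    intro k
    by_contra hno
    exact hcon ⟨1 / (k + 1 : ℝ), by positivity, fun S hS hSV => by
      by_contra hB
      exact hno ⟨S, hS, hSV, hB⟩⟩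
  -- A violating sequence would converge to `V`, against `tendsto_amcLaw`. The radius so obtained is
  -- deterministic and hence applies at random covariance matrices.
  choose S hS hSV hSB using hk
  have hlim : Tendsto S atTop (𝓝 V) := tendsto_of_frobNorm
    (squeeze_zero (fun k => frobNorm_nonneg _) hSV tendsto_one_div_add_atTop_nhds_zero_nat)
  obtain ⟨k, hk⟩ := (eventually_measure_le_thickening (tendsto_amcLaw hS hV hL hlim) hη).exists
  exact hSB k hk

end LimitLaw

/-! ### Absence of atoms in the limit law -/

section NoAtoms

open scoped MatrixOrder

variable {p m : ℕ}

/-- A measurable set which meets every line parallel to a fixed axis in a countable set is null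
for a product of atomless laws. -/
lemma measure_pi_eq_zero_of_countable_slices {ι : Type*} [Fintype ι] [DecidableEq ι]
    {μ : ι → Measure ℝ} [∀ i, IsProbabilityMeasure (μ i)] (k : ι) [NullSingletonClass (μ k)]
    {s : Set (ι → ℝ)} (hs : MeasurableSet s)
    (h : ∀ x : ι → ℝ, {r | Function.update x k r ∈ s}.Countable) : Measure.pi μ s = 0 := by
  rw [← lintegral_indicator_one hs]
  -- Fubini: integrating out coordinate `k` alone already gives zero.
  have hz : ∫⋯∫⁻_{k}, s.indicator 1 ∂μ = ∫⋯∫⁻_{k}, (0 : (ι → ℝ) → ℝ≥0∞) ∂μ := by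
    funext x
    rw [lmarginal_singleton, lmarginal_singleton]
    have : ∫⁻ r, s.indicator 1 (Function.update x k r) ∂μ k = 0 := by
      have hae : ∀ᵐ r ∂μ k, s.indicator (1 : (ι → ℝ) → ℝ≥0∞) (Function.update x k r) = 0 := by
        have h0 : μ k {r | Function.update x k r ∈ s} = 0 := (h x).measure_zero _
        refine measure_mono_null (fun r hr => ?_) h0
        by_contra hrs
        exact hr (Set.indicator_of_notMem (s := s) hrs _)
      rw [lintegral_congr_ae hae, lintegral_zero]
    simp only [this, Pi.zero_apply, lintegral_zero]
  have := lintegral_eq_of_lmarginal_eq (μ := μ) {k} (f := s.indicator 1) (g := 0)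
    (measurable_one.indicator hs) measurable_zero hz
  rw [this]
  simp

/-- Relative to one root `s₀`, the equation factors as `(s - s₀) * (γ * (s + s₀) + β) = 0`. -/
lemma countable_quadratic_level {α β γ c : ℝ} (hγ : γ ≠ 0) :
    {s : ℝ | α + β * s + γ * s ^ 2 = c}.Countable := by
  rcases Set.eq_empty_or_nonempty {s : ℝ | α + β * s + γ * s ^ 2 = c} with h | ⟨s₀, h₀⟩
  · rw [h]; exact Set.countable_empty
  · refine ((Set.countable_singleton s₀).union (Set.countable_singleton (-β / γ - s₀))).mono ?_
    intro s hs
    have h1 : (s - s₀) * (γ * (s + s₀) + β) = 0 := by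
      have e1 : α + β * s + γ * s ^ 2 = c := hs
      have e2 : α + β * s₀ + γ * s₀ ^ 2 = c := h₀
      linear_combination e1 - e2
    rcases mul_eq_zero.1 h1 with h | h
    · left; exact sub_eq_zero.1 h
    · right
      change s = -β / γ - s₀
      field_simp
      linarith

lemma qf_add_smul {A : Matrix (Fin p) (Fin p) ℝ} (x e : Vec p) (s : ℝ) :
    qf A (x + s • e) = qf A x + (inner ℝ x (mv A e) + inner ℝ e (mv A x)) * s + qf A e * s ^ 2 := by
  simp only [qf_eq_inner, mv_add, mv_smul, inner_add_left, inner_add_right, inner_smul_left,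
    inner_smul_right]
  simp
  ring

/-- The components of the limit law have no atoms. -/
lemma amcLaw_eval_eq_zero {q : Fin m → ℕ} {L : (j : Fin m) → Matrix (Fin (q j)) (Fin p) ℝ}
    {V : Matrix (Fin p) (Fin p) ℝ} (hV : V.PosDef) (hL : ∀ j, (L j).rank = q j)
    (hq : ∀ j, 1 ≤ q j) (j : Fin m) (c : ℝ) : amcLaw L V {t | t j = c} = 0 := by
  set A := quadMatrix (L j) V with hA
  set B := CFC.sqrt V with hB
  have hBB : B * B = V := CFC.sqrt_mul_sqrt_self _ hV.posSemidef.nonneg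
  have hq' : Measurable fun (u : Vec p) (i : Fin m) => qf (quadMatrix (L i) V) u :=
    measurable_pi_iff.2 fun i => (continuous_qf _).measurable
  have hms : MeasurableSet {t : Fin m → ℝ | t j = c} :=
    measurableSet_eq_fun (measurable_pi_apply j) measurable_const
  have hmv : ∀ x : Vec p, (0 : Vec p) + Matrix.toEuclideanCLM (𝕜 := ℝ) B x = mv B x := by
    intro x
    rw [zero_add]
    rfl
  have hcont : Continuous fun x : Fin p → ℝ => qf A (mv B (WithLp.toLp 2 x)) := by
    refine (continuous_qf A).comp ?_
    have : (fun x : Fin p → ℝ => mv B (WithLp.toLp 2 x))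
        = fun x => Matrix.toEuclideanCLM (𝕜 := ℝ) B (WithLp.toLp 2 x) := by
      funext x; rw [← hmv, zero_add]
    rw [this]
    fun_prop
  have hms' : MeasurableSet {x : Fin p → ℝ | qf A (mv B (WithLp.toLp 2 x)) = c} :=
    measurableSet_eq_fun hcont.measurable measurable_const
  have e : amcLaw L V {t | t j = c} = Measure.pi (fun _ : Fin p => gaussianReal 0 1)
      {x | qf A (mv B (WithLp.toLp 2 x)) = c} := by
    rw [amcLaw_eq_map, Measure.map_apply hq' hms, multivariateGaussian,
      Measure.map_apply (by fun_prop) (hq' hms), ← map_pi_eq_stdGaussian,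
      Measure.map_apply (by fun_prop)]
    · simp only [← hB, hmv]
      rfl
    · have : Measurable fun x : Vec p => (0 : Vec p) + Matrix.toEuclideanCLM (𝕜 := ℝ) B x := by
        fun_prop
      exact this (hq' hms)
  rw [e]
  -- Along this axis the form is a quadratic with positive leading coefficient. If no axis worked,
  -- then `L j * V = 0`, so `L j = 0`, contradicting its rank `q j ≥ 1`.
  obtain ⟨k, hk⟩ : ∃ k : Fin p, mv (L j) (mv B (EuclideanSpace.single k 1)) ≠ 0 := by
    by_contra! hcon
    have hLB : L j * B = 0 := by
      ext i k
      have := congrArg (fun v : Vec (q j) => v i) (hcon k)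
      rw [mv_mv] at this
      simpa [mv] using this
    have hLV : L j * V = 0 := by rw [← hBB, ← Matrix.mul_assoc, hLB, Matrix.zero_mul]
    have hL0 : L j = 0 := by
      rw [← Matrix.mul_one (L j), ← Matrix.mul_nonsing_inv V (isUnit_det_of_posDef hV),
        ← Matrix.mul_assoc, hLV, Matrix.zero_mul]
    have := hL j
    rw [hL0, Matrix.rank_zero] at this
    have := hq j
    omega
  set w := mv B (EuclideanSpace.single k 1) with hw
  have hγ : qf A w ≠ 0 := by
    rw [hA, qf_quadMatrix]
    have hpos := (gram_posDef hV (hL j)).inv.dotProduct_mulVec_pos (x := (mv (L j) w).ofLp)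
      (fun h0 => hk (by ext i; exact congrFun h0 i))
    simp only [star_trivial] at hpos
    exact hpos.ne'
  have : NullSingletonClass (gaussianReal 0 1) := nullSingletonClass_gaussianReal one_ne_zero
  refine measure_pi_eq_zero_of_countable_slices k hms' fun x => ?_
  set y := mv B (WithLp.toLp 2 (Function.update x k 0)) with hy
  have hupd : ∀ r : ℝ, mv B (WithLp.toLp 2 (Function.update x k r)) = y + r • w := by
    intro r
    rw [hw, hy, ← mv_smul, ← mv_add]
    congr 1
    ext i
    by_cases hi : i = k
    · subst hi; simp
    · simp [hi]
  refine (countable_quadratic_level (α := qf A y) (β := inner ℝ y (mv A w) + inner ℝ w (mv A y))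
    (c := c) hγ).mono fun r hr => ?_
  rwa [Set.mem_ofPred_eq, Set.mem_ofPred_eq, hupd, qf_add_smul] at hr

end NoAtoms

/-! ### Events of asymptotic probability one -/

section WHP

variable {Ω : Type*} [MeasurableSpace Ω] {P : Measure Ω}

/-- The events `E n` hold with probability tending to one. -/
def WHP (P : Measure Ω) (E : ℕ → Ω → Prop) : Prop :=
  Tendsto (fun n => P {ω | ¬ E n ω}) atTop (𝓝 0)

namespace WHP

variable {E F : ℕ → Ω → Prop}

lemma mono (h : WHP P E) (hEF : ∀ᶠ n in atTop, ∀ ω, E n ω → F n ω) : WHP P F := by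
  refine tendsto_of_tendsto_of_tendsto_of_le_of_le' tendsto_const_nhds h
    (Eventually.of_forall fun _ => zero_le) ?_
  filter_upwards [hEF] with n hn
  exact measure_mono fun ω hω hE => hω (hn ω hE)

lemma and (hE : WHP P E) (hF : WHP P F) : WHP P fun n ω => E n ω ∧ F n ω := by
  have h := Tendsto.add hE hF
  rw [add_zero] at h
  refine tendsto_of_tendsto_of_tendsto_of_le_of_le tendsto_const_nhds h (fun _ => zero_le)
    fun n => ?_
  refine (measure_mono fun ω hω => ?_).trans (measure_union_le _ _)
  by_contra hcon
  simp only [Set.mem_union, Set.mem_ofPred_eq, not_or, not_not] at hcon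
  exact hω hcon

lemma of_ae {p : Ω → Prop} (h : ∀ᵐ ω ∂P, p ω) : WHP P fun _ ω => p ω := by
  have : P {ω | ¬ p ω} = 0 := h
  simp [WHP, this]

lemma of_eventually (h : ∀ᶠ n in atTop, ∀ ω, E n ω) : WHP P E := by
  refine tendsto_const_nhds.congr' ?_
  filter_upwards [h] with n hn
  simp [hn]

lemma finite_forall {ι : Type*} [Finite ι] {E : ι → ℕ → Ω → Prop} (h : ∀ i, WHP P (E i)) :
    WHP P fun n ω => ∀ i, E i n ω := by
  have := Fintype.ofFinite ι
  have hs : Tendsto (fun n => ∑ i, P {ω | ¬ E i n ω}) atTop (𝓝 0) := by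
    have := tendsto_finsetSum (Finset.univ : Finset ι) fun i _ => h i
    simpa using this
  refine tendsto_of_tendsto_of_tendsto_of_le_of_le tendsto_const_nhds hs (fun _ => zero_le)
    fun n => ?_
  refine (measure_mono fun ω hω => ?_).trans (measure_iUnion_fintype_le _ _)
  simp only [Set.mem_ofPred_eq, not_forall] at hω
  exact Set.mem_iUnion.2 hω

lemma comp (h : WHP P E) {φ : ℕ → ℕ} (hφ : Tendsto φ atTop atTop) :
    WHP P fun n ω => E (φ n) ω :=
  Tendsto.comp (g := fun n => P {ω | ¬ E n ω}) h hφ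

lemma of_forall_le (h : ∀ ε : ℝ≥0∞, 0 < ε → ∀ᶠ n in atTop, P {ω | ¬ E n ω} ≤ ε) : WHP P E :=
  ENNReal.tendsto_nhds_zero.2 fun ε hε => h ε hε

lemma eventually_le (h : WHP P E) {ε : ℝ≥0∞} (hε : 0 < ε) :
    ∀ᶠ n in atTop, P {ω | ¬ E n ω} ≤ ε :=
  ENNReal.tendsto_nhds_zero.1 h ε hε

lemma eventually_of_const [IsProbabilityMeasure P] {p : ℕ → Prop} (h : WHP P fun n _ => p n) :
    ∀ᶠ n in atTop, p n := by
  filter_upwards [h.eventually_lt_const zero_lt_one] with n hn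
  by_contra hp
  simp [hp] at hn

/-- Diagonal choice: if `E k` holds with probability tending to one for each `k`, then so does
`E (φ n) n` for some `φ → ∞`. -/
lemma exists_diagonal [IsProbabilityMeasure P] {E : ℕ → ℕ → Ω → Prop} (h : ∀ k, WHP P (E k)) :
    ∃ φ : ℕ → ℕ, Tendsto φ atTop atTop ∧ WHP P fun n ω => E (φ n) n ω := by
  classical
  let good : ℕ → ℕ → Prop := fun n k => P {ω | ¬ E k n ω} ≤ ((k : ℝ≥0∞) + 1)⁻¹
  let φ : ℕ → ℕ := fun n => Nat.findGreatest (good n) n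
  -- The search always succeeds, since at `k = 0` the bound is `1`.
  have hgood : ∀ n, good n (φ n) := fun n =>
    Nat.findGreatest_spec (P := good n) (Nat.zero_le n) (by simpa [good] using prob_le_one)
  have hφ : Tendsto φ atTop atTop := by
    refine tendsto_atTop.2 fun k => ?_
    have hk : ∀ᶠ n in atTop, good n k :=
      (h k).eventually_le (ENNReal.inv_pos.2 (by finiteness))
    filter_upwards [hk, eventually_ge_atTop k] with n hn hkn
    exact Nat.le_findGreatest hkn hn
  refine ⟨φ, hφ, ?_⟩
  have hlim : Tendsto (fun k : ℕ => ((k : ℝ≥0∞) + 1)⁻¹) atTop (𝓝 0) := by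
    have := (tendsto_add_atTop_iff_nat 1).2 ENNReal.tendsto_inv_nat_nhds_zero
    simpa using this
  exact tendsto_of_tendsto_of_tendsto_of_le_of_le tendsto_const_nhds (hlim.comp hφ)
    (fun _ => zero_le) hgood

end WHP

lemma TendsToZeroInProb.whp {ι : Type*} {s : Set ι} {f : ℕ → Ω → ι → ℝ}
    (h : TendsToZeroInProb P fun n ω => ⨆ i ∈ s, ENNReal.ofReal (f n ω i)) {ε : ℝ} (hε : 0 < ε) :
    WHP P fun n ω => ∀ i ∈ s, f n ω i ≤ ε := by
  refine tendsto_of_tendsto_of_tendsto_of_le_of_le tendsto_const_nhds (h ε hε) (fun _ => zero_le)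
    fun n => measure_mono fun ω hω => ?_
  simp only [Set.mem_ofPred_eq, not_forall, not_le] at hω
  obtain ⟨i, hi, hlt⟩ := hω
  exact (ENNReal.ofReal_le_ofReal hlt.le).trans
    (le_iSup₂ (f := fun i (_ : i ∈ s) => ENNReal.ofReal (f n ω i)) i hi)

lemma IsSmallOInProb.whp {ι : ℕ → Type*} {f : (n : ℕ) → Ω → ι n → ℝ} {a : ℕ → ℝ}
    (h : IsSmallOInProb P (fun n ω => ⨆ i, ENNReal.ofReal (f n ω i)) a) {ε : ℝ} (hε : 0 < ε) :
    WHP P fun n ω => ∀ i, f n ω i ≤ ε * a n := by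
  refine tendsto_of_tendsto_of_tendsto_of_le_of_le tendsto_const_nhds (h ε hε) (fun _ => zero_le)
    fun n => measure_mono fun ω hω => ?_
  simp only [Set.mem_ofPred_eq, not_forall, not_le] at hω
  obtain ⟨i, hlt⟩ := hω
  exact (ENNReal.ofReal_le_ofReal hlt.le).trans
    (le_iSup (fun i => ENNReal.ofReal (f n ω i)) i)

/-- Convergence in distribution implies tightness. -/
lemma whp_norm_le_of_tendstoInDistribution [IsProbabilityMeasure P] {p : ℕ} {Z : ℕ → Ω → Vec p}
    {μ : Measure (Vec p)} [IsProbabilityMeasure μ]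
    (h : TendstoInDistribution Z atTop id (fun _ => P) μ) {b : ℕ → ℝ} (hb : Tendsto b atTop atTop) :
    WHP P fun n ω => ‖Z n ω‖ ≤ b n := by
  refine WHP.of_forall_le fun ε hε => ?_
  have htail : Tendsto (fun k : ℕ => μ (Metric.closedBall (0 : Vec p) k)ᶜ) atTop (𝓝 0) := by
    have h0 : ⋂ k : ℕ, (Metric.closedBall (0 : Vec p) k)ᶜ = ∅ := by
      rw [← Set.compl_iUnion, Metric.iUnion_closedBall_nat, Set.compl_univ]
    have := tendsto_measure_iInter_atTop (μ := μ)
      (s := fun k : ℕ => (Metric.closedBall (0 : Vec p) k)ᶜ)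
      (fun k => Metric.isClosed_closedBall.measurableSet.compl.nullMeasurableSet)
      (fun a b hab => Set.compl_subset_compl.2
        (Metric.closedBall_subset_closedBall (by exact_mod_cast hab)))
      ⟨0, measure_ne_top _ _⟩
    rwa [h0, measure_empty] at this
  -- With `η ≤ 1`, thickening the outside of the ball of radius `k + 1` stays outside the ball of
  -- radius `k`.
  obtain ⟨η, hη, hη1, hηε⟩ : ∃ η : ℝ, 0 < η ∧ η ≤ 1 ∧ ENNReal.ofReal η ≤ ε / 2 := by
    rcases eq_or_ne ε ⊤ with rfl | hne
    · exact ⟨1, one_pos, le_rfl, by simp [ENNReal.top_div]⟩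
    · have h2 : 0 < (ε / 2).toReal := ENNReal.toReal_pos (ENNReal.half_pos hε.ne').ne'
        (ENNReal.div_ne_top hne (by norm_num))
      exact ⟨min 1 (ε / 2).toReal, lt_min one_pos h2, min_le_left _ _,
        (ENNReal.ofReal_le_ofReal (min_le_right _ _)).trans ENNReal.ofReal_toReal_le⟩
  obtain ⟨k, hk⟩ := (htail.eventually_le_const (ENNReal.half_pos hε.ne')).exists
  have hclose := eventually_measure_le_thickening h.tendsto hη
  filter_upwards [hclose, hb.eventually_ge_atTop ((k : ℝ) + 1)] with n hn hbn
  have hms : MeasurableSet (Metric.closedBall (0 : Vec p) (k + 1))ᶜ :=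
    Metric.isClosed_closedBall.measurableSet.compl
  have h1 := (hn _ hms).1
  simp only [ProbabilityMeasure.coe_mk, Measure.map_id] at h1
  rw [Measure.map_apply_of_aemeasurable (h.forall_aemeasurable n) hms] at h1
  calc P {ω | ¬ ‖Z n ω‖ ≤ b n} ≤ P (Z n ⁻¹' (Metric.closedBall (0 : Vec p) (k + 1))ᶜ) := by
        refine measure_mono fun ω hω => ?_
        simp only [Set.mem_ofPred_eq, not_le, Set.mem_preimage, Set.mem_compl_iff,
          mem_closedBall_zero_iff] at hω ⊢
        linarith
    _ ≤ _ := h1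
    _ ≤ μ (Metric.closedBall (0 : Vec p) k)ᶜ + ENNReal.ofReal η := by
        gcongr
        intro y hy
        obtain ⟨z, hz, hyz⟩ := Metric.mem_thickening_iff.1 hy
        simp only [Set.mem_compl_iff, mem_closedBall_zero_iff, not_le] at hz ⊢
        have := norm_sub_norm_le z y
        rw [dist_eq_norm, norm_sub_rev] at hyz
        linarith
    _ ≤ ε / 2 + ε / 2 := add_le_add hk hηε
    _ = ε := ENNReal.add_halves ε

end WHP

/-! ### Uniform bounds on the largest summand -/

section MaxBound

variable {Ω : Type*} [MeasurableSpace Ω] {P : Measure Ω} {𝒳 : Type*} {X : ℕ → Ω → 𝒳} {p : ℕ}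
  {g : 𝒳 → Vec p → Vec p} {N : Set (Vec p)} {θ₀ : Vec p} {V : Vec p → Matrix (Fin p) (Fin p) ℝ}

lemma tendsto_of_forall_antitone
    (hV : ∀ b : ℕ → ℝ, (∀ n, 0 < b n) → Antitone b → Tendsto b atTop (𝓝 0) →
      Tendsto (fun n => ⨆ θ ∈ Metric.closedBall θ₀ (b n),
        ENNReal.ofReal (frobNorm (V θ - V θ₀))) atTop (𝓝 0)) :
    Tendsto (fun θ => frobNorm (V θ - V θ₀)) (𝓝 θ₀) (𝓝 0) := by
  have h := hV (fun n => 1 / (n + 1 : ℝ)) (fun n => by positivity)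
    (fun i j hij => one_div_le_one_div_of_le (by positivity) (by gcongr))
    tendsto_one_div_add_atTop_nhds_zero_nat
  refine Metric.tendsto_nhds.2 fun ε hε => ?_
  obtain ⟨n, hn⟩ := (h.eventually_lt_const (ENNReal.ofReal_pos.2 hε)).exists
  filter_upwards [Metric.closedBall_mem_nhds θ₀ (by positivity : 0 < 1 / (n + 1 : ℝ))] with θ hθ
  rw [Real.dist_0_eq_abs, abs_of_nonneg (frobNorm_nonneg _)]
  have := (le_iSup₂ (f := fun θ (_ : θ ∈ Metric.closedBall θ₀ (1 / (n + 1 : ℝ))) =>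
    ENNReal.ofReal (frobNorm (V θ - V θ₀))) θ hθ).trans_lt hn
  exact (ENNReal.ofReal_lt_ofReal_iff hε).1 this

/-- Taking traces turns convergence of `S_n` into control of the partial sums of `‖g‖ ^ 2`. -/
lemma sum_norm_sq_eq {n : ℕ} (x : Fin n → 𝒳) (θ : Vec p) :
    ∑ i, ‖g (x i) θ‖ ^ 2 = n * (meanS g x θ).trace := by
  have e : ∀ i, ‖g (x i) θ‖ ^ 2 = ∑ k, g (x i) θ k * g (x i) θ k := fun i => by
    rw [EuclideanSpace.real_norm_sq_eq]
    exact Finset.sum_congr rfl fun k _ => sq _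
  simp_rw [e, Matrix.trace, Matrix.diag, meanS, Matrix.of_apply]
  rw [Finset.sum_comm, Finset.mul_sum]
  refine Finset.sum_congr rfl fun k _ => ?_
  rcases Nat.eq_zero_or_pos n with rfl | hn
  · simp
  · have : (n : ℝ) ≠ 0 := by positivity
    field_simp

lemma abs_trace_le (M : Matrix (Fin p) (Fin p) ℝ) : |M.trace| ≤ p * frobNorm M := by
  calc |M.trace| ≤ ∑ k, |M k k| := Finset.abs_sum_le_sum_abs _ _
    _ ≤ ∑ _k : Fin p, frobNorm M := Finset.sum_le_sum fun k _ => abs_entry_le_frobNorm M k k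
    _ = p * frobNorm M := by simp

/-- Uniform convergence of the second moment matrices along the whole sequence forces
`max_{i ≤ n} |g(X_i, θ)|² = o_P(n)`, uniformly in `θ` near `θ₀`. -/
lemma whp_norm_sq_le
    (hV : TendsToZeroInProb P fun n ω => ⨆ θ ∈ N, ENNReal.ofReal
      (frobNorm (meanS g (sample X n ω) θ - V θ)))
    {U : Set (Vec p)} (hU : U ⊆ N) {τ : ℝ} (hτ : ∀ θ ∈ U, frobNorm (V θ) ≤ τ) (hτ0 : 0 ≤ τ)
    {ε : ℝ} (hε : 0 < ε) :
    WHP P fun n ω => ∀ i : Fin n, ∀ θ ∈ U, ‖g (sample X n ω i) θ‖ ^ 2 ≤ ε * n := by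
  set T : ℕ → Ω → Vec p → ℝ := fun n ω θ => ∑ i ∈ Finset.range n, ‖g (X i ω) θ‖ ^ 2 with hT
  -- The indices are cut into `M'` blocks. A single `‖g‖ ^ 2` is at most the increment of `T` over
  -- its block, about `n / M'` times a trace bounded by `p * τ`; only finitely many partial sums
  -- need control.
  obtain ⟨M, hM⟩ : ∃ M : ℕ, 4 * (p * τ) / ε ≤ M := exists_nat_ge _
  set M' := M + 1 with hM'
  have hM'pos : (0 : ℝ) < M' := by positivity
  have hMτ : p * τ / M' ≤ ε / 4 := by
    rw [div_le_iff₀ hM'pos]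
    rw [div_le_iff₀ hε] at hM
    have : (M' : ℝ) = M + 1 := by simp [hM']
    rw [this]; linarith
  set δ := ε / (8 * (p + 1 : ℝ)) with hδ
  have hδ0 : 0 < δ := by positivity
  have hpδ : p * δ ≤ ε / 8 := by
    rw [hδ, mul_div_assoc', div_le_div_iff₀ (by positivity) (by norm_num)]
    nlinarith
  let ok : ℕ → Ω → Prop := fun n ω => ∀ θ ∈ U, |T n ω θ - n * (V θ).trace| ≤ n * (ε / 8)
  have hok : WHP P ok := by
    refine (hV.whp hδ0).mono (Eventually.of_forall fun n ω h θ hθ => ?_)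
    have h1 : T n ω θ = n * (meanS g (sample X n ω) θ).trace := by
      rw [← sum_norm_sq_eq, hT]
      exact (Fin.sum_univ_eq_sum_range (fun i => ‖g (X i ω) θ‖ ^ 2) n).symm
    rw [h1, ← mul_sub, ← Matrix.trace_sub, abs_mul, Nat.abs_cast]
    gcongr
    refine (abs_trace_le _).trans (le_trans ?_ hpδ)
    gcongr
    exact h θ (hU hθ)
  have hlo : ∀ l : Fin M', WHP P fun n ω => ok (l * n / M') ω := by
    intro l
    -- For the first block the left endpoint is `0` and does not tend to infinity, but the empty sum
    -- is exact.
    rcases Nat.eq_zero_or_pos (l : ℕ) with h0 | hpos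
    · refine WHP.of_eventually (Eventually.of_forall fun n ω θ _ => ?_)
      rw [h0]
      simp [hT]
    · refine hok.comp (tendsto_atTop_mono (fun n => ?_)
        (Nat.tendsto_div_const_atTop (Nat.succ_ne_zero M)))
      exact Nat.div_le_div_right (Nat.le_mul_of_pos_left n hpos)
  have hhi : ∀ l : Fin M', WHP P fun n ω => ok ((l + 1) * n / M' + 1) ω := by
    intro l
    refine hok.comp (tendsto_atTop_mono (fun n => ?_)
      (Nat.tendsto_div_const_atTop (Nat.succ_ne_zero M)))
    exact (Nat.div_le_div_right (Nat.le_mul_of_pos_left n (Nat.succ_pos _))).trans (Nat.le_succ _)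
  have hall := WHP.finite_forall fun l => (hlo l).and (hhi l)
  have hlarge : ∀ᶠ n : ℕ in atTop, 2 * (p * τ) + ε / 8 ≤ ε / 4 * n := by
    have : Tendsto (fun n : ℕ => ε / 4 * (n : ℝ)) atTop atTop :=
      Tendsto.const_mul_atTop (by positivity) tendsto_natCast_atTop_atTop
    exact this.eventually_ge_atTop _
  refine hall.mono ?_
  filter_upwards [hlarge] with n hn ω hω i θ hθ
  have hnpos : 0 < n := i.pos
  have hlM : (i : ℕ) * M' / n < M' := by
    rw [Nat.div_lt_iff_lt_mul hnpos, mul_comm]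
    exact Nat.mul_lt_mul_of_pos_left i.2 (Nat.succ_pos M)
  set l : ℕ := (i : ℕ) * M' / n with hl
  obtain ⟨h1, h2⟩ := hω ⟨l, hlM⟩
  set n₁ := l * n / M' with hn₁
  -- The `+ 1` places `i` strictly below the right endpoint after rounding. The endpoint may reach
  -- `n + 1`, which is harmless because the data form an infinite sequence.
  set n₂ := (l + 1) * n / M' + 1 with hn₂
  have hli : l * n ≤ i * M' := Nat.div_mul_le_self _ _
  have hli' : i * M' < (l + 1) * n := by
    rw [hl, mul_comm (_ + 1)]; exact Nat.lt_mul_div_succ _ hnpos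
  have hi1 : n₁ ≤ i := Nat.div_le_of_le_mul (by rw [mul_comm M']; exact hli)
  have hi2 : (i : ℕ) < n₂ := by
    have : (i : ℕ) ≤ (l + 1) * n / M' := (Nat.le_div_iff_mul_le (Nat.succ_pos M)).2 hli'.le
    omega
  have hn1r : (n₁ : ℝ) ≤ n := by
    exact_mod_cast hi1.trans i.2.le
  have hn2le : (n₂ : ℝ) ≤ (l + 1) * n / M' + 1 := by
    have : (((l + 1) * n / M' : ℕ) : ℝ) ≤ (((l + 1) * n : ℕ) : ℝ) / M' := Nat.cast_div_le
    rw [hn₂]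
    push_cast at this ⊢
    linarith
  have hn1ge : (l : ℝ) * n / M' - 1 ≤ n₁ := by
    have : l * n < (n₁ + 1) * M' := by
      rw [mul_comm (n₁ + 1)]; exact Nat.lt_mul_div_succ _ (Nat.succ_pos M)
    have h' : (l : ℝ) * n < (n₁ + 1) * M' := by exact_mod_cast this
    rw [sub_le_iff_le_add, div_le_iff₀ hM'pos]
    exact h'.le
  have hn2r : (n₂ : ℝ) ≤ n + 1 := by
    refine hn2le.trans ?_
    have : ((l : ℝ) + 1) ≤ M' := by exact_mod_cast hlM
    have : ((l : ℝ) + 1) * n / M' ≤ n := by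
      rw [div_le_iff₀ hM'pos, mul_comm (n : ℝ)]; gcongr
    linarith
  have hdiff : (n₂ : ℝ) - n₁ ≤ n / M' + 2 := by
    have : ((l : ℝ) + 1) * n / M' = l * n / M' + n / M' := by ring
    linarith
  have hsub : ‖g (X i ω) θ‖ ^ 2 ≤ T n₂ ω θ - T n₁ ω θ := by
    have hle : n₁ ≤ n₂ := hi1.trans hi2.le
    have : T n₂ ω θ - T n₁ ω θ = ∑ k ∈ Finset.Ico n₁ n₂, ‖g (X k ω) θ‖ ^ 2 := by
      rw [Finset.sum_Ico_eq_sub _ hle]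
    rw [this]
    exact Finset.single_le_sum (f := fun k => ‖g (X k ω) θ‖ ^ 2) (fun k _ => sq_nonneg _)
      (Finset.mem_Ico.2 ⟨hi1, hi2⟩)
  have hb2 := (abs_le.1 (h2 θ hθ)).2
  have hb1 := (abs_le.1 (h1 θ hθ)).1
  have htr : (V θ).trace ≤ p * τ :=
    (le_abs_self _).trans ((abs_trace_le _).trans (by gcongr; exact hτ θ hθ))
  have hd0 : 0 ≤ (n₂ : ℝ) - n₁ := by
    have : (n₁ : ℝ) ≤ n₂ := by exact_mod_cast hi1.trans hi2.le
    linarith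
  have hmain : ((n₂ : ℝ) - n₁) * (V θ).trace ≤ (n / M' + 2) * (p * τ) := by
    calc ((n₂ : ℝ) - n₁) * (V θ).trace ≤ ((n₂ : ℝ) - n₁) * (p * τ) := by gcongr
      _ ≤ _ := by gcongr
  have hMn : n / M' * (p * τ) ≤ ε / 4 * n := by
    calc (n : ℝ) / M' * (p * τ) = (p * τ / M') * n := by ring
      _ ≤ ε / 4 * n := by gcongr
  change ‖g (X i ω) θ‖ ^ 2 ≤ ε * n
  nlinarith

/-- `max_{i ≤ n} sup |g(X_i, θ)| = o_P(a n)` over balls of radius `K / a n` around `θ₀`. -/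
lemma whp_norm_le {a : ℕ → ℝ} (ha_pos : ∀ n, 0 < a n) (ha : Tendsto a atTop atTop)
    (hN : IsOpen N) (hθ₀N : θ₀ ∈ N) (h_smooth : ∀ᵐ ω ∂P, ∀ i, ContDiffOn ℝ 1 (g (X i ω)) N)
    (hV : TendsToZeroInProb P fun n ω => ⨆ θ ∈ N, ENNReal.ofReal
      (frobNorm (meanS g (sample X n ω) θ - V θ)))
    (hVc : Tendsto (fun θ => frobNorm (V θ - V θ₀)) (𝓝 θ₀) (𝓝 0))
    (h_max : IsSmallOInProb P
      (fun n ω => ⨆ i : Fin n, ENNReal.ofReal ‖g (sample X n ω i) θ₀‖) a)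
    (h_max_unif : ((fun n : ℕ => √(n : ℝ)) =O[atTop] a) ∨
      IsBigOInProb P (fun n ω => ⨆ i : Fin n, ⨆ θ ∈ N,
        ENNReal.ofReal (frobNorm (jacobian (g (sample X n ω i)) θ))) a)
    {K : ℝ} (hK : 0 < K) {ε : ℝ} (hε : 0 < ε) :
    WHP P fun n ω => ∀ i : Fin n, ∀ θ ∈ Metric.closedBall θ₀ (K / a n),
      ‖g (sample X n ω i) θ‖ ≤ ε * a n := by
  have hKa : Tendsto (fun n => K / a n) atTop (𝓝 0) := ha.const_div_atTop K
  rcases h_max_unif with hO | hO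
  -- If `√n = O(a n)`, the bound `o(√n)` from the second moments suffices.
  · obtain ⟨c, hc, hbound⟩ := hO.exists_pos
    have hloc : ∀ᶠ θ in 𝓝 θ₀, θ ∈ N ∧ frobNorm (V θ - V θ₀) ≤ 1 :=
      (hN.eventually_mem hθ₀N).and (hVc.eventually_le_const one_pos)
    obtain ⟨ρ, hρ, hball⟩ := Metric.nhds_basis_closedBall.mem_iff.1 hloc
    have h := whp_norm_sq_le hV (U := Metric.closedBall θ₀ ρ) (fun θ hθ => (hball hθ).1)
      (τ := 1 + frobNorm (V θ₀)) (fun θ hθ => by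
        have h1 := frobNorm_add_le (V θ - V θ₀) (V θ₀)
        rw [sub_add_cancel] at h1
        linarith [(hball hθ).2]) (by linarith [frobNorm_nonneg (V θ₀)])
      (ε := (ε / c) ^ 2) (by positivity)
    refine h.mono ?_
    filter_upwards [hKa.eventually_le_const hρ, hbound.bound] with n hn hb ω hω i θ hθ
    have h1 := hω i θ (Metric.closedBall_subset_closedBall hn hθ)
    rw [Real.norm_of_nonneg (Real.sqrt_nonneg _), Real.norm_of_nonneg (ha_pos n).le] at hb
    have h2 : ‖g (sample X n ω i) θ‖ ≤ ε / c * √(n : ℝ) := by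
      refine le_of_sq_le_sq ?_ (by positivity)
      rwa [mul_pow, Real.sq_sqrt (Nat.cast_nonneg n)]
    calc ‖g (sample X n ω i) θ‖ ≤ ε / c * √(n : ℝ) := h2
      _ ≤ ε / c * (c * a n) := by gcongr
      _ = ε * a n := by field_simp
  -- Otherwise the mean value inequality applies: the gradient is at most `M * a n` and the radius
  -- is `K / a n`, so the increment is at most the constant `M * K`.
  · obtain ⟨ρ, hρ, hball⟩ := Metric.nhds_basis_closedBall.mem_iff.1 (hN.mem_nhds hθ₀N)
    have hbase := (h_max.whp (f := fun n ω (i : Fin n) => ‖g (sample X n ω i) θ₀‖)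
      (half_pos hε)).and (WHP.of_ae h_smooth)
    refine WHP.of_forall_le fun δ hδ => ?_
    obtain ⟨δ', hδ', hδδ⟩ : ∃ δ' : ℝ, 0 < δ' ∧ ENNReal.ofReal δ' ≤ δ / 2 := by
      rcases eq_or_ne δ ⊤ with rfl | hne
      · exact ⟨1, one_pos, by simp [ENNReal.top_div]⟩
      · exact ⟨(δ / 2).toReal, ENNReal.toReal_pos (ENNReal.half_pos hδ.ne').ne'
          (ENNReal.div_ne_top hne (by norm_num)), ENNReal.ofReal_toReal_le⟩
    obtain ⟨M, hM, hMn⟩ := hO δ' hδ'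
    have hlarge : ∀ᶠ n in atTop, M * K ≤ ε / 2 * a n :=
      (Tendsto.const_mul_atTop (half_pos hε) ha).eventually_ge_atTop _
    filter_upwards [hMn, hbase.eventually_le (ENNReal.half_pos hδ.ne'), hlarge,
      hKa.eventually_le_const hρ] with n hn hb hl hr
    refine (measure_mono fun ω hω => ?_).trans ((measure_union_le _ _).trans
      ((add_le_add (hn.trans hδδ) hb).trans_eq (ENNReal.add_halves δ)))
    by_contra hcon
    simp only [Set.mem_union, Set.mem_ofPred_eq, not_or, not_lt, not_not] at hcon
    obtain ⟨hj, hg0, hsm⟩ := hcon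
    refine hω fun i θ hθ => ?_
    have hθ' := Metric.closedBall_subset_closedBall hr hθ
    have hjac : ∀ y ∈ Metric.closedBall θ₀ ρ, ‖fderiv ℝ (g (sample X n ω i)) y‖ ≤ M * a n := by
      intro y hy
      refine (norm_fderiv_le _ _).trans ?_
      have h0 : 0 ≤ M * a n := mul_nonneg hM.le (ha_pos n).le
      rw [← ENNReal.ofReal_le_ofReal_iff h0]
      refine le_trans ?_ hj
      exact (le_iSup₂ (f := fun θ (_ : θ ∈ N) =>
        ENNReal.ofReal (frobNorm (jacobian (g (sample X n ω i)) θ))) y (hball hy)).trans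
        (le_iSup (fun i : Fin n => ⨆ θ ∈ N,
          ENNReal.ofReal (frobNorm (jacobian (g (sample X n ω i)) θ))) i)
    have hmv := (convex_closedBall θ₀ ρ).norm_image_sub_le_of_norm_fderiv_le
      (f := g (sample X n ω i)) (C := M * a n)
      (fun y hy => ((hsm i).differentiableOn one_ne_zero).differentiableAt
        (hN.mem_nhds (hball hy))) hjac (Metric.mem_closedBall_self hρ.le) hθ'
    rw [mem_closedBall_iff_norm] at hθ
    have h1 : M * a n * ‖θ - θ₀‖ ≤ M * K := by
      calc M * a n * ‖θ - θ₀‖ ≤ M * a n * (K / a n) := by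
            have := ha_pos n
            gcongr
        _ = M * K := by have := (ha_pos n).ne'; field_simp
    have h2 := norm_sub_norm_le (g (sample X n ω i) θ) (g (sample X n ω i) θ₀)
    have h3 := hg0 i
    linarith

end MaxBound

/-! ### Slowly growing radii -/

section Approx

variable {Ω : Type*} [MeasurableSpace Ω] {P : Measure Ω} [IsProbabilityMeasure P]
  {𝒳 : Type*} {X : ℕ → Ω → 𝒳} {p m : ℕ} {g : 𝒳 → Vec p → Vec p} {Θ N : Set (Vec p)} {θ₀ : Vec p}
  {G : Vec p → Vec p} {V : Vec p → Matrix (Fin p) (Fin p) ℝ} {a : ℕ → ℝ}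

/-- For slowly growing `K n`, the statistics of the true hypotheses are jointly approximated by
quadratic forms in `a n • G_n(θ₀)`. -/
lemma exists_radius {q : Fin m → ℕ} {h : (j : Fin m) → Vec p → Vec (q j)}
    (hθ₀ : θ₀ ∈ interior Θ) (hN : IsOpen N) (hθ₀N : θ₀ ∈ N)
    (ha_pos : ∀ n, 0 < a n) (ha : Tendsto a atTop atTop)
    (h_smooth : ∀ᵐ ω ∂P, ∀ i, ContDiffOn ℝ 1 (g (X i ω)) N) (hG_smooth : ContDiffOn ℝ 1 G N)
    (h_jac : TendsToZeroInProb P fun n ω => ⨆ θ ∈ N, ENNReal.ofReal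
      (frobNorm (jacobian (meanG g (sample X n ω)) θ - jacobian G θ)))
    (hG_nonsing : IsUnit (jacobian G θ₀).det) (hV_pos : (V θ₀).PosDef)
    (hV_unif : TendsToZeroInProb P fun n ω => ⨆ θ ∈ N, ENNReal.ofReal
      (frobNorm (meanS g (sample X n ω) θ - V θ)))
    (hVc : Tendsto (fun θ => frobNorm (V θ - V θ₀)) (𝓝 θ₀) (𝓝 0))
    (h_clt : TendstoInDistribution (fun n ω => a n • meanG g (sample X n ω) θ₀) atTop
      id (fun _ => P) (multivariateGaussian (0 : Vec p) (V θ₀)))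
    (h_max : IsSmallOInProb P
      (fun n ω => ⨆ i : Fin n, ENNReal.ofReal ‖g (sample X n ω i) θ₀‖) a)
    (h_max_unif : ((fun n : ℕ => √(n : ℝ)) =O[atTop] a) ∨
      IsBigOInProb P (fun n ω => ⨆ i : Fin n, ⨆ θ ∈ N,
        ENNReal.ofReal (frobNorm (jacobian (g (sample X n ω i)) θ))) a)
    (hh_smooth : ∀ j, ContDiffOn ℝ 1 (h j) N) (hh_rank : ∀ j, (jacobian (h j) θ₀).rank = q j) :
    ∃ K : ℕ → ℝ, (∀ n, 0 < K n) ∧ Tendsto K atTop atTop ∧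
      Tendsto (fun n => K n / a n) atTop (𝓝 0) ∧
      ∀ η : ℝ, 0 < η → WHP P fun n ω => ∀ j, θ₀ ∈ nullSet Θ (h j) →
        ((qf (quadMatrix (jacobian (h j) θ₀ * (jacobian G θ₀)⁻¹) (V θ₀))
          (a n • meanG g (sample X n ω) θ₀) - η : ℝ) : EReal) ≤
          elStat g (sample X n ω) (a n) (nullSet Θ (h j)) θ₀ (K n / a n) ∧
        elStat g (sample X n ω) (a n) (nullSet Θ (h j)) θ₀ (K n / a n) ≤
        ((qf (quadMatrix (jacobian (h j) θ₀ * (jacobian G θ₀)⁻¹) (V θ₀))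
          (a n • meanG g (sample X n ω) θ₀) + η : ℝ) : EReal) := by
  have happ : ∀ j, θ₀ ∈ nullSet Θ (h j) → _ := fun j hj =>
    elStat_approx (g := g) hθ₀ hN hθ₀N hG_smooth hG_nonsing hV_pos hVc (hh_smooth j) (hh_rank j) hj.2
  -- For fixed `K` the bound on `z` need not hold with probability tending to one, so it stays a
  -- premise until `K` grows.
  have hex : ∀ j, ∃ C : ℝ, 0 ≤ C ∧ ∀ K : ℝ, 0 < K → ∀ η : ℝ, 0 < η →
      WHP P fun n ω => θ₀ ∈ nullSet Θ (h j) → C * ‖a n • meanG g (sample X n ω) θ₀‖ ≤ K →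
        ((qf (quadMatrix (jacobian (h j) θ₀ * (jacobian G θ₀)⁻¹) (V θ₀))
          (a n • meanG g (sample X n ω) θ₀) - η : ℝ) : EReal) ≤
          elStat g (sample X n ω) (a n) (nullSet Θ (h j)) θ₀ (K / a n) ∧
        elStat g (sample X n ω) (a n) (nullSet Θ (h j)) θ₀ (K / a n) ≤
        ((qf (quadMatrix (jacobian (h j) θ₀ * (jacobian G θ₀)⁻¹) (V θ₀))
          (a n • meanG g (sample X n ω) θ₀) + η : ℝ) : EReal) := by
    intro j
    by_cases hj : θ₀ ∈ nullSet Θ (h j)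
    · obtain ⟨C, hC, hCK⟩ := happ j hj
      refine ⟨C, hC, fun K hK η hη => ?_⟩
      obtain ⟨ε, hε, hεs⟩ := hCK K hK η hη
      have hw := (((WHP.of_ae h_smooth).and (h_jac.whp hε)).and (hV_unif.whp hε)).and
        (whp_norm_le ha_pos ha hN hθ₀N h_smooth hV_unif hVc h_max h_max_unif hK hε)
      refine hw.mono ?_
      have hinv : Tendsto (fun n => 1 / a n) atTop (𝓝 0) := ha.const_div_atTop 1
      filter_upwards [hinv.eventually_le_const hε, eventually_gt_atTop 0] with n hn hn0 ω hω _ hz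
      obtain ⟨⟨⟨hs, hJ⟩, hS⟩, hb⟩ := hω
      exact hεs (sample X n ω) (a n) hn0 (ha_pos n) hn (fun i => hs i) hJ hS hb hz
    · exact ⟨0, le_rfl, fun K _ η _ => WHP.of_eventually
        (Eventually.of_forall fun n ω hj' => absurd hj' hj)⟩
  choose C hC hCK using hex
  -- Radius `k + 1` and error `1 / (k + 1)` are tied together. The deterministic clause is carried
  -- along so that the diagonal choice also yields `K n / a n → 0`.
  have hfix : ∀ k : ℕ, WHP P fun n ω => ((k + 1 : ℝ) / a n ≤ 1 / (k + 1 : ℝ)) ∧ ∀ j,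
      θ₀ ∈ nullSet Θ (h j) → C j * ‖a n • meanG g (sample X n ω) θ₀‖ ≤ (k + 1 : ℝ) →
        ((qf (quadMatrix (jacobian (h j) θ₀ * (jacobian G θ₀)⁻¹) (V θ₀))
          (a n • meanG g (sample X n ω) θ₀) - 1 / (k + 1 : ℝ) : ℝ) : EReal) ≤
          elStat g (sample X n ω) (a n) (nullSet Θ (h j)) θ₀ ((k + 1 : ℝ) / a n) ∧
        elStat g (sample X n ω) (a n) (nullSet Θ (h j)) θ₀ ((k + 1 : ℝ) / a n) ≤
        ((qf (quadMatrix (jacobian (h j) θ₀ * (jacobian G θ₀)⁻¹) (V θ₀))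
          (a n • meanG g (sample X n ω) θ₀) + 1 / (k + 1 : ℝ) : ℝ) : EReal) := by
    intro k
    refine WHP.and (WHP.of_eventually ?_) (WHP.finite_forall fun j =>
      hCK j (k + 1 : ℝ) (by positivity) (1 / (k + 1 : ℝ)) (by positivity))
    have hlim : Tendsto (fun n => (k + 1 : ℝ) / a n) atTop (𝓝 0) := ha.const_div_atTop _
    filter_upwards [hlim.eventually_le_const (by positivity : (0 : ℝ) < 1 / (k + 1 : ℝ))]
      with n hn ω using hn
  obtain ⟨φ, hφ, hW⟩ := WHP.exists_diagonal hfix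
  have hφr : Tendsto (fun n => (φ n : ℝ) + 1) atTop atTop :=
    tendsto_atTop_add_const_right _ _ (tendsto_natCast_atTop_atTop.comp hφ)
  have hφ1 : Tendsto (fun n => 1 / ((φ n : ℝ) + 1)) atTop (𝓝 0) := hφr.const_div_atTop 1
  refine ⟨fun n => φ n + 1, fun n => by positivity, hφr, ?_, fun η hη => ?_⟩
  · have hev : ∀ᶠ n in atTop, ((φ n : ℝ) + 1) / a n ≤ 1 / ((φ n : ℝ) + 1) :=
      WHP.eventually_of_const (P := P) (hW.mono (Eventually.of_forall fun n ω h => h.1))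
    refine tendsto_of_tendsto_of_tendsto_of_le_of_le' tendsto_const_nhds hφ1
      (Eventually.of_forall fun n => ?_) hev
    have := ha_pos n
    positivity
  · have htight : ∀ j, WHP P fun n ω =>
        C j * ‖a n • meanG g (sample X n ω) θ₀‖ ≤ (φ n : ℝ) + 1 := by
      intro j
      have hb : Tendsto (fun n => ((φ n : ℝ) + 1) / (C j + 1)) atTop atTop :=
        hφr.atTop_div_const (by linarith [hC j])
      refine (whp_norm_le_of_tendstoInDistribution h_clt hb).mono
        (Eventually.of_forall fun n ω hω => ?_)
      rw [le_div_iff₀ (by linarith [hC j])] at hω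
      nlinarith [norm_nonneg (a n • meanG g (sample X n ω) θ₀)]
    refine (hW.and (WHP.finite_forall htight)).mono ?_
    filter_upwards [hφ1.eventually_le_const hη] with n hn ω hω j hj
    obtain ⟨⟨-, h1⟩, h2⟩ := hω
    obtain ⟨hl, hu⟩ := h1 j hj (h2 j)
    exact ⟨le_trans (EReal.coe_le_coe_iff.2 (by linarith)) hl,
      hu.trans (EReal.coe_le_coe_iff.2 (by linarith))⟩

end Approx

/-! ### Sample quantiles of simulated statistics -/

section Sampling

/-- Chebyshev's inequality for the number of draws in an event. -/
lemma pi_card_mem_le {E : Type*} [MeasurableSpace E] {Q : Measure E} [IsProbabilityMeasure Q]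
    {s : Set E} (hs : MeasurableSet s) {B : ℕ} (hB : 0 < B) {r d : ℝ} (hd : 0 < d)
    (hr : r + d ≤ Q.real s) :
    (Measure.pi fun _ : Fin B => Q) {t | (Nat.card {b : Fin B // t b ∈ s} : ℝ) ≤ r * B} ≤
      ENNReal.ofReal (1 / (B * d ^ 2)) := by
  classical
  set Y : E → ℝ := s.indicator 1 with hY
  have hYm : Measurable Y := measurable_one.indicator hs
  have hYb : ∀ x, Y x ∈ Set.Icc (0 : ℝ) 1 := fun x => by
    by_cases hx : x ∈ s <;> simp [hY, hx]
  have hYL : MemLp Y 2 Q := MemLp.of_bound hYm.aestronglyMeasurable 1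
    (ae_of_all _ fun x => by rw [Real.norm_of_nonneg (hYb x).1]; exact (hYb x).2)
  set ν := Measure.pi fun _ : Fin B => Q with hν
  set S : (Fin B → E) → ℝ := ∑ b, fun t => Y (t b) with hS
  have hcomp : ∀ b : Fin B, MemLp (fun t : Fin B → E => Y (t b)) 2 ν := fun b =>
    hYL.comp_measurePreserving (measurePreserving_eval _ b)
  have hSL : MemLp S 2 ν := memLp_finsetSum' _ fun b _ => hcomp b
  have hcard : ∀ t : Fin B → E, S t = (Nat.card {b : Fin B // t b ∈ s} : ℝ) := fun t => by
    rw [hS, Finset.sum_apply, Nat.card_eq_fintype_card, Fintype.card_subtype, Finset.card_filter]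
    push_cast
    exact Finset.sum_congr rfl fun b _ => by simp [hY, Set.indicator_apply]
  have hmean : ∫ t, S t ∂ν = B * Q.real s := by
    have : ∀ t, S t = ∑ b, Y (t b) := fun t => by rw [hS, Finset.sum_apply]
    simp_rw [this]
    rw [integral_finsetSum _ fun b _ => (hcomp b).integrable (by norm_num)]
    have h1 : ∀ b : Fin B, ∫ t, Y (t b) ∂ν = Q.real s := fun b => by
      have := (measurePreserving_eval (fun _ : Fin B => Q) b).map_eq
      have h2 := integral_map (μ := ν) (φ := Function.eval b) (f := Y)
        (measurable_pi_apply b).aemeasurable (by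
          rw [this]; exact hYm.aestronglyMeasurable)
      rw [this, hY, integral_indicator_one hs] at h2
      exact h2.symm
    simp [h1]
  have hvar : variance S ν ≤ B := by
    rw [hS, variance_sum_pi fun _ => hYL]
    have h1 : variance Y Q ≤ 1 := (variance_le_sq_of_bounded (ae_of_all _ hYb)
      hYm.aemeasurable).trans (by norm_num)
    calc ∑ _b : Fin B, variance Y Q ≤ ∑ _b : Fin B, 1 := Finset.sum_le_sum fun b _ => h1
      _ = B := by simp
  have hBr : (0 : ℝ) < B := by exact_mod_cast hB
  calc ν {t | (Nat.card {b : Fin B // t b ∈ s} : ℝ) ≤ r * B}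
      ≤ ν {t | B * d ≤ |S t - ∫ t, S t ∂ν|} := by
        refine measure_mono fun t ht => ?_
        rw [Set.mem_ofPred_eq, ← hcard] at ht
        rw [Set.mem_ofPred_eq, hmean]
        refine le_trans ?_ (neg_le_abs _)
        nlinarith
    _ ≤ ENNReal.ofReal (variance S ν / (B * d) ^ 2) :=
        meas_ge_le_variance_div_sq hSL (by positivity)
    _ ≤ ENNReal.ofReal (1 / (B * d ^ 2)) := by
        apply ENNReal.ofReal_le_ofReal
        rw [div_le_div_iff₀ (by positivity) (by positivity)]
        calc variance S ν * (B * d ^ 2) ≤ B * (B * d ^ 2) := by gcongr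
          _ = 1 * (B * d) ^ 2 := by ring

variable {m : ℕ}

lemma card_subtype_mono {ι : Type*} [Finite ι] {p r : ι → Prop} (h : ∀ i, p i → r i) :
    Nat.card {i // p i} ≤ Nat.card {i // r i} :=
  Nat.card_le_card_of_injective (Subtype.map id h) (Subtype.map_injective h Function.injective_id)

lemma card_lt_of_vthLargest_lt {v : ℕ} (hv : 1 ≤ v) {t : Fin m → ℝ} {c : ℝ}
    (h : vthLargest v t < c) : Nat.card {j : Fin m // c < t j} < v := by
  -- Nonemptiness suffices: a lower bound of a nonempty set cannot exceed its `sInf`, even if the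
  -- latter is a default value.
  have hne : {c : ℝ | Nat.card {j : Fin m // c < t j} < v}.Nonempty := by
    obtain ⟨M, hM⟩ := (Set.finite_range t).bddAbove
    refine ⟨M, ?_⟩
    have : IsEmpty {j : Fin m // M < t j} :=
      ⟨fun j => absurd (hM (Set.mem_range_self j.1)) (not_le.2 j.2)⟩
    rw [Set.mem_ofPred_eq, Nat.card_of_isEmpty]
    omega
  obtain ⟨c', hc', hlt⟩ := exists_lt_of_csInf_lt hne h
  exact (card_subtype_mono fun j hj => hlt.trans hj).trans_lt hc'

/-- If the cutoff is below `c`, few of the draws have `v` or more components above `c`. -/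
lemma card_exceed_le_of_amcCutoff_lt {v : ℕ} (hv : 1 ≤ v) {α : ℝ} (hα : 0 < α) {B : ℕ}
    {t : Fin B → Fin m → ℝ} {c : ℝ} (h : amcCutoff v α t < c) :
    (Nat.card {b : Fin B // v ≤ Nat.card {j : Fin m // c < t b j}} : ℝ) ≤ α * B := by
  classical
  set Q : Fin B → ℝ := fun b => vthLargest v (t b) with hQ
  have hne : {c : ℝ | (1 - α) * B ≤ (Nat.card {b : Fin B // Q b ≤ c} : ℝ)}.Nonempty := by
    obtain ⟨M, hM⟩ := (Set.finite_range Q).bddAbove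
    refine ⟨M, ?_⟩
    have : Nat.card {b : Fin B // Q b ≤ M} = B := by
      rw [Nat.card_congr (Equiv.subtypeUnivEquiv fun b => hM (Set.mem_range_self b)),
        Nat.card_fin]
    rw [Set.mem_ofPred_eq, this]
    nlinarith [(Nat.cast_nonneg B : (0 : ℝ) ≤ B)]
  obtain ⟨c', hc', hlt⟩ := exists_lt_of_csInf_lt hne h
  -- Some level `c' < c` is already reached by a fraction `1 - α` of the draws, and these have fewer
  -- than `v` components above `c`.
  have h1 : Nat.card {b : Fin B // Q b ≤ c'} ≤
      Nat.card {b : Fin B // ¬ v ≤ Nat.card {j : Fin m // c < t b j}} :=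
    card_subtype_mono fun b hb => not_le.2 (card_lt_of_vthLargest_lt hv (lt_of_le_of_lt hb hlt))
  have h2 : Nat.card {b : Fin B // v ≤ Nat.card {j : Fin m // c < t b j}} +
      Nat.card {b : Fin B // ¬ v ≤ Nat.card {j : Fin m // c < t b j}} = B := by
    simp only [Nat.card_eq_fintype_card]
    rw [Fintype.card_subtype_compl, Fintype.card_fin]
    have := Fintype.card_subtype_le (fun b : Fin B => v ≤ Nat.card {j : Fin m // c < t b j})
    rw [Fintype.card_fin] at this
    simp only [Nat.card_eq_fintype_card] at this ⊢
    omega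
  have h3 : (1 - α) * B ≤ (Nat.card {b : Fin B // Q b ≤ c'} : ℝ) := hc'
  have h1' : (Nat.card {b : Fin B // Q b ≤ c'} : ℝ) ≤
      Nat.card {b : Fin B // ¬ v ≤ Nat.card {j : Fin m // c < t b j}} := by exact_mod_cast h1
  have h2' : (Nat.card {b : Fin B // v ≤ Nat.card {j : Fin m // c < t b j}} : ℝ) +
      Nat.card {b : Fin B // ¬ v ≤ Nat.card {j : Fin m // c < t b j}} = B := by exact_mod_cast h2
  linarith

end Sampling

/-! ### Exceedance events -/

section Exceed

variable {m : ℕ}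

/-- At least `v` of the components in `I` exceed `c`. -/
def exceedSet (I : Set (Fin m)) (v : ℕ) (c : ℝ) : Set (Fin m → ℝ) :=
  {t | v ≤ Nat.card {j : Fin m // j ∈ I ∧ c < t j}}

variable {I : Set (Fin m)} {v : ℕ}

lemma exceedSet_anti {c c' : ℝ} (h : c ≤ c') : exceedSet I v c' ⊆ exceedSet I v c := fun _ ht =>
  le_trans ht (card_subtype_mono fun _ hj => ⟨hj.1, h.trans_lt hj.2⟩)

lemma mem_exceedSet_of_dist_lt {c η : ℝ} {s t : Fin m → ℝ} (hs : s ∈ exceedSet I v (c + η))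
    (hst : dist t s < η) : t ∈ exceedSet I v c := by
  refine le_trans hs (card_subtype_mono fun j hj => ⟨hj.1, ?_⟩)
  have h := (dist_le_pi_dist t s j).trans_lt hst
  rw [Real.dist_eq] at h
  have := (abs_lt.1 h).1
  linarith [hj.2]

/-- A sup-norm move of less than `η` changes each component by less than `η`, so thickening is paid
for by lowering the threshold. -/
lemma thickening_exceedSet_subset (c η : ℝ) :
    Metric.thickening η (exceedSet I v (c + η)) ⊆ exceedSet I v c := by
  intro t ht
  obtain ⟨s, hs, hst⟩ := Metric.mem_thickening_iff.1 ht
  exact mem_exceedSet_of_dist_lt hs hst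

lemma measurableSet_exceedSet (c : ℝ) : MeasurableSet (exceedSet I v c) := by
  classical
  have h : exceedSet I v c =
      {t | v ≤ ∑ j : Fin m, if j ∈ I ∧ c < t j then 1 else 0} := by
    ext t
    rw [exceedSet, Set.mem_ofPred_eq, Set.mem_ofPred_eq, Nat.card_eq_fintype_card,
      Fintype.card_subtype, Finset.card_filter]
  rw [h]
  refine measurableSet_le measurable_const (Finset.measurable_sum _ fun j _ => ?_)
  refine Measurable.ite ?_ measurable_const measurable_const
  by_cases hj : j ∈ I
  · simp only [hj, true_and]
    exact measurableSet_lt measurable_const (measurable_pi_apply j)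
  · simp [hj]

/-- Raising the threshold by `η` loses only points with some component in `(c, c + η]`. -/
lemma exceedSet_subset_union {c η : ℝ} :
    exceedSet I v c ⊆ exceedSet I v (c + η) ∪ {t | ∃ j, |t j - c| ≤ η} := by
  intro t ht
  by_contra hcon
  simp only [Set.mem_union, Set.mem_ofPred_eq, not_or, not_exists, not_le] at hcon
  refine hcon.1 (le_trans ht (card_subtype_mono fun j hj => ⟨hj.1, ?_⟩))
  have h := hcon.2 j
  rw [abs_of_pos (by linarith [hj.2])] at h
  linarith

/-- The limiting exceedance probability takes every value in `(0, 1)`. -/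
lemma exists_exceedSet_eq {μ : Measure (Fin m → ℝ)} [IsProbabilityMeasure μ]
    (hμ : ∀ j c, μ {t | t j = c} = 0) (hv : 1 ≤ v) (hI : v ≤ Nat.card I) {β : ℝ} (h0 : 0 < β)
    (h1 : β < 1) : ∃ c, μ.real (exceedSet I v c) = β := by
  have hcont : Continuous fun c => μ.real (exceedSet I v c) := by
    refine Metric.continuous_iff.2 fun c ε hε => ?_
    obtain ⟨η, hη, hosc⟩ := exists_cdf_osc_small hμ (ENNReal.ofReal_pos.2 (half_pos hε))
    have hstep : ∀ c₁ c₂, c₁ ≤ c₂ → c₂ ≤ c₁ + η →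
        μ.real (exceedSet I v c₁) ≤ μ.real (exceedSet I v c₂) + ε / 2 := by
      intro c₁ c₂ _ h2
      have hsub : exceedSet I v c₁ ⊆ exceedSet I v c₂ ∪ {t | ∃ j, |t j - c₁| ≤ η} :=
        exceedSet_subset_union.trans (Set.union_subset_union_left _ (exceedSet_anti h2))
      refine (measureReal_mono hsub).trans ((measureReal_union_le _ _).trans ?_)
      gcongr
      exact ENNReal.toReal_le_of_le_ofReal (half_pos hε).le (hosc fun _ => c₁)
    refine ⟨η, hη, fun c' hc' => ?_⟩
    rw [Real.dist_eq] at hc' ⊢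
    have hlt := abs_lt.1 hc'
    rcases le_total c c' with h | h
    · have ha := measureReal_mono (μ := μ) (exceedSet_anti (I := I) (v := v) h)
      have hb := hstep c c' h (by linarith)
      rw [abs_lt]; constructor <;> linarith
    · have ha := measureReal_mono (μ := μ) (exceedSet_anti (I := I) (v := v) h)
      have hb := hstep c' c h (by linarith)
      rw [abs_lt]; constructor <;> linarith
  -- Intermediate values between the limits `0` and `1`; the latter needs at least `v` indices in
  -- `I`.
  refine mem_range_of_exists_le_of_exists_ge hcont ?_ ?_
  · have hlim : Tendsto (fun k : ℕ => μ (exceedSet I v k)) atTop (𝓝 0) := by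
      have he : ⋂ k : ℕ, exceedSet I v (k : ℝ) = ∅ := by
        refine Set.eq_empty_of_forall_notMem fun t ht => ?_
        obtain ⟨M, hM⟩ := (Set.finite_range t).bddAbove
        obtain ⟨k, hk⟩ := exists_nat_ge M
        have hk' : v ≤ Nat.card {j : Fin m // j ∈ I ∧ (k : ℝ) < t j} := Set.mem_iInter.1 ht k
        have : IsEmpty {j : Fin m // j ∈ I ∧ (k : ℝ) < t j} :=
          ⟨fun j => absurd ((hM (Set.mem_range_self j.1)).trans hk) (not_le.2 j.2.2)⟩
        rw [Nat.card_of_isEmpty] at hk'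
        omega
      have := tendsto_measure_iInter_atTop (μ := μ) (s := fun k : ℕ => exceedSet I v (k : ℝ))
        (fun k => (measurableSet_exceedSet _).nullMeasurableSet)
        (fun a b hab => exceedSet_anti (by exact_mod_cast hab)) ⟨0, measure_ne_top _ _⟩
      rwa [he, measure_empty] at this
    obtain ⟨k, hk⟩ := (hlim.eventually_le_const (ENNReal.ofReal_pos.2 h0)).exists
    exact ⟨k, ENNReal.toReal_le_of_le_ofReal h0.le hk⟩
  · have hlim : Tendsto (fun k : ℕ => μ (exceedSet I v (-k : ℝ))) atTop (𝓝 1) := by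
      have he : ⋃ k : ℕ, exceedSet I v (-k : ℝ) = Set.univ := by
        refine Set.eq_univ_of_forall fun t => ?_
        obtain ⟨M, hM⟩ := (Set.finite_range t).bddBelow
        obtain ⟨k, hk⟩ := exists_nat_gt (-M)
        refine Set.mem_iUnion.2 ⟨k, hI.trans ?_⟩
        refine card_subtype_mono fun j hj => ⟨hj, ?_⟩
        have := hM (Set.mem_range_self j)
        linarith
      have := tendsto_measure_iUnion_atTop (μ := μ) (s := fun k : ℕ => exceedSet I v (-k : ℝ))
        (fun a b hab => exceedSet_anti (by
          have : (a : ℝ) ≤ b := by exact_mod_cast hab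
          linarith))
      rwa [he, measure_univ] at this
    have hβ : ENNReal.ofReal β < 1 := by
      rw [← ENNReal.ofReal_one]; exact (ENNReal.ofReal_lt_ofReal_iff one_pos).2 h1
    obtain ⟨k, hk⟩ := (hlim.eventually_const_le hβ).exists
    exact ⟨-k, (ENNReal.ofReal_le_iff_le_toReal (measure_ne_top _ _)).1 hk⟩

end Exceed

/-! ### Shifting orthants -/

section Shift

variable {m : ℕ} {μ : Measure (Fin m → ℝ)}

lemma measure_Iic_le_add {x : Fin m → ℝ} {η η' : ℝ} (hη : η' ≤ η) {ε : ℝ≥0∞}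
    (h : μ {t | ∃ j, |t j - x j| ≤ η} ≤ ε) :
    μ (Set.Iic fun j => x j + η') ≤ μ (Set.Iic x) + ε := by
  refine (measure_mono fun t ht => ?_).trans ((measure_union_le _ _).trans (add_le_add_right h _))
  by_contra hcon
  simp only [Set.mem_union, Set.mem_ofPred_eq, not_or, not_exists, not_le] at hcon
  refine hcon.1 fun j => ?_
  by_contra hj
  rw [not_le] at hj
  have h1 := hcon.2 j
  rw [abs_of_pos (by linarith)] at h1
  have h2 : t j ≤ x j + η' := ht j
  linarith

lemma measure_Iic_le_sub_add {x : Fin m → ℝ} {η η' : ℝ} (hη : η' ≤ η) {ε : ℝ≥0∞}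
    (h : μ {t | ∃ j, |t j - x j| ≤ η} ≤ ε) :
    μ (Set.Iic x) ≤ μ (Set.Iic fun j => x j - η') + ε := by
  refine (measure_mono fun t ht => ?_).trans ((measure_union_le _ _).trans (add_le_add_right h _))
  by_contra hcon
  simp only [Set.mem_union, Set.mem_ofPred_eq, not_or, not_exists, not_le] at hcon
  refine hcon.1 fun j => ?_
  by_contra hj
  change ¬ t j ≤ x j - η' at hj
  have h1 := hcon.2 j
  have h2 : t j ≤ x j := ht j
  rw [abs_of_nonpos (by linarith)] at h1
  linarith

end Shift

/-! ### Uniform consistency and error control -/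

section Consistency

variable {Ω : Type*} [MeasurableSpace Ω] {P : Measure Ω} [IsProbabilityMeasure P] {m : ℕ}
  {μ : Measure (Fin m → ℝ)} [IsProbabilityMeasure μ] {Q : ℕ → Ω → Fin m → ℝ}
  {T : ℕ → Ω → Fin m → EReal} {law : ℕ → Ω → Measure (Fin m → ℝ)}
  [∀ n ω, IsProbabilityMeasure (law n ω)]

lemma abs_toReal_sub_le {a b : ℝ≥0∞} (ha : a ≠ ⊤) (hb : b ≠ ⊤) {d : ℝ} (hd : 0 ≤ d)
    (h1 : a ≤ b + ENNReal.ofReal d) (h2 : b ≤ a + ENNReal.ofReal d) :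
    |a.toReal - b.toReal| ≤ d := by
  have e1 := ENNReal.toReal_mono (by finiteness) h1
  have e2 := ENNReal.toReal_mono (by finiteness) h2
  rw [ENNReal.toReal_add hb (by finiteness), ENNReal.toReal_ofReal hd] at e1
  rw [ENNReal.toReal_add ha (by finiteness), ENNReal.toReal_ofReal hd] at e2
  rw [abs_le]; constructor <;> linarith

/-- The simulated distribution function is uniformly consistent. -/
lemma tendsToZeroInProb_cdf_sub (hμ : ∀ j c, μ {t | t j = c} = 0)
    (hQ : ∀ η : ℝ, 0 < η → ∀ᶠ n in atTop, ∀ B, MeasurableSet B →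
      P (Q n ⁻¹' B) ≤ μ (Metric.thickening η B) + ENNReal.ofReal η ∧
      μ B ≤ P (Q n ⁻¹' Metric.thickening η B) + ENNReal.ofReal η)
    (hlaw : ∀ η : ℝ, 0 < η → WHP P fun n ω => ∀ B, MeasurableSet B →
      law n ω B ≤ μ (Metric.thickening η B) + ENNReal.ofReal η ∧
      μ B ≤ law n ω (Metric.thickening η B) + ENNReal.ofReal η)
    (hT : ∀ η : ℝ, 0 < η → WHP P fun n ω => ∀ j,
      ((Q n ω j - η : ℝ) : EReal) ≤ T n ω j ∧ T n ω j ≤ ((Q n ω j + η : ℝ) : EReal)) :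
    TendsToZeroInProb P fun n ω => ⨆ x : {x : Fin m → ℝ // 0 ≤ x}, ENNReal.ofReal
      |(law n ω).real (Set.Iic x.1) - P.real {ω' | ∀ j, T n ω' j ≤ ((x.1 j : ℝ) : EReal)}| := by
  intro ε hε
  -- Comparing the simulated law with `μ` costs `2 * e`, and comparing the law of `T` with `μ` costs
  -- `3 * e`; the total `5 * e` is strictly below `ε`.
  set e := ε / 8 with he
  have he0 : 0 < e := by positivity
  obtain ⟨η₀, hη₀, hosc⟩ := exists_cdf_osc_small hμ (ENNReal.ofReal_pos.2 he0)
  set η := min e (η₀ / 2) with hη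
  have hη0 : 0 < η := lt_min he0 (half_pos hη₀)
  have hηe : ENNReal.ofReal η ≤ ENNReal.ofReal e := ENNReal.ofReal_le_ofReal (min_le_left _ _)
  have hηη : η ≤ η₀ / 2 := min_le_right _ _
  refine (hlaw η hη0).mono (F := fun n ω => ¬ ENNReal.ofReal ε ≤ _) ?_ |> fun h => by
    simpa only [WHP, not_not] using h
  filter_upwards [hQ η hη0, (hT η hη0).eventually_le (ENNReal.ofReal_pos.2 he0)] with n hn hb ω hω
  rw [not_le]
  refine lt_of_le_of_lt (b := ENNReal.ofReal (5 * e)) ?_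
    ((ENNReal.ofReal_lt_ofReal_iff hε).2 (by rw [he]; linarith))
  refine iSup_le fun x => ENNReal.ofReal_le_ofReal ?_
  obtain ⟨x, -⟩ := x
  change |(law n ω).real (Set.Iic x) - P.real {ω' | ∀ j, T n ω' j ≤ ((x j : ℝ) : EReal)}| ≤ 5 * e
  set E := ENNReal.ofReal e with hE
  have hEk : ENNReal.ofReal (5 * e) = E + E + E + E + E := by
    rw [hE, ← ENNReal.ofReal_add, ← ENNReal.ofReal_add, ← ENNReal.ofReal_add, ← ENNReal.ofReal_add]
    · congr 1; ring
    all_goals positivity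
  have hl1 : law n ω (Set.Iic x) ≤ μ (Set.Iic x) + E + E := by
    refine (hω _ measurableSet_Iic).1.trans (add_le_add ?_ hηe)
    exact (measure_mono (thickening_Iic_subset x η)).trans
      (measure_Iic_le_add (by linarith) (hosc x))
  have hl2 : μ (Set.Iic x) ≤ law n ω (Set.Iic x) + E + E := by
    refine (measure_Iic_le_sub_add (η' := η) (by linarith) (hosc x)).trans ?_
    gcongr
    refine (hω _ measurableSet_Iic).2.trans (add_le_add (measure_mono ?_) hηe)
    refine (thickening_Iic_subset _ η).trans (Set.Iic_subset_Iic.2 fun j => ?_)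
    simp
  have hp1 : P {ω' | ∀ j, T n ω' j ≤ ((x j : ℝ) : EReal)} ≤ μ (Set.Iic x) + E + E + E := by
    have hsub : {ω' | ∀ j, T n ω' j ≤ ((x j : ℝ) : EReal)} ⊆
        (Q n ⁻¹' Set.Iic fun j => x j + η) ∪ {ω' | ¬ ∀ j,
          ((Q n ω' j - η : ℝ) : EReal) ≤ T n ω' j ∧ T n ω' j ≤ ((Q n ω' j + η : ℝ) : EReal)} := by
      intro ω' hω'
      by_contra hcon
      simp only [Set.mem_union, Set.mem_ofPred_eq, not_or, not_not] at hcon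
      refine hcon.1 fun j => ?_
      have := EReal.coe_le_coe_iff.1 ((hcon.2 j).1.trans (hω' j))
      change Q n ω' j ≤ x j + η
      linarith
    refine (measure_mono hsub).trans ((measure_union_le _ _).trans (add_le_add ?_ hb))
    refine (hn _ measurableSet_Iic).1.trans (add_le_add ?_ hηe)
    refine (measure_mono (thickening_Iic_subset _ η)).trans ?_
    have : (fun j => x j + η + η) = fun j => x j + (η + η) := by funext j; ring
    rw [this]
    exact measure_Iic_le_add (by linarith) (hosc x)
  have hp2 : μ (Set.Iic x) ≤ P {ω' | ∀ j, T n ω' j ≤ ((x j : ℝ) : EReal)} + E + E + E := by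
    refine (measure_Iic_le_sub_add (η' := η + η) (by linarith) (hosc x)).trans ?_
    gcongr
    refine (hn _ measurableSet_Iic).2.trans (add_le_add ?_ hηe)
    refine le_trans (measure_mono ?_) ((measure_union_le _ {ω' | ¬ ∀ j,
      ((Q n ω' j - η : ℝ) : EReal) ≤ T n ω' j ∧ T n ω' j ≤ ((Q n ω' j + η : ℝ) : EReal)}).trans
      (add_le_add_right hb _))
    intro ω' hω'
    by_contra hcon
    simp only [Set.mem_union, Set.mem_ofPred_eq, not_or, not_not] at hcon
    refine hcon.1 fun j => (hcon.2 j).2.trans (EReal.coe_le_coe_iff.2 ?_)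
    have h1 := thickening_Iic_subset _ _ hω' j
    simp only at h1
    linarith
  refine abs_toReal_sub_le (measure_ne_top _ _) (measure_ne_top _ _) (by positivity) ?_ ?_
  · rw [hEk]
    calc law n ω (Set.Iic x) ≤ μ (Set.Iic x) + E + E := hl1
      _ ≤ P {ω' | ∀ j, T n ω' j ≤ ((x j : ℝ) : EReal)} + E + E + E + E + E := by gcongr
      _ = _ := by ring
  · rw [hEk]
    calc P {ω' | ∀ j, T n ω' j ≤ ((x j : ℝ) : EReal)} ≤ μ (Set.Iic x) + E + E + E := hp1
      _ ≤ law n ω (Set.Iic x) + E + E + E + E + E := by gcongr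
      _ = _ := by ring

/-- The Monte Carlo cutoffs control the generalized family-wise error rate. -/
lemma limsup_exceed_le (hμ : ∀ j c, μ {t | t j = c} = 0)
    (hQ : ∀ η : ℝ, 0 < η → ∀ᶠ n in atTop, ∀ B, MeasurableSet B →
      P (Q n ⁻¹' B) ≤ μ (Metric.thickening η B) + ENNReal.ofReal η ∧
      μ B ≤ P (Q n ⁻¹' Metric.thickening η B) + ENNReal.ofReal η)
    (hlaw : ∀ η : ℝ, 0 < η → WHP P fun n ω => ∀ B, MeasurableSet B →
      law n ω B ≤ μ (Metric.thickening η B) + ENNReal.ofReal η ∧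
      μ B ≤ law n ω (Metric.thickening η B) + ENNReal.ofReal η)
    {I : Set (Fin m)}
    (hT : ∀ η : ℝ, 0 < η → WHP P fun n ω => ∀ j ∈ I, T n ω j ≤ ((Q n ω j + η : ℝ) : EReal))
    {v : ℕ} (hv : 1 ≤ v) {α : ℝ} (hα : 0 < α) (hα1 : α < 1) {B : ℕ → ℕ}
    (hB : Tendsto B atTop atTop) :
    limsup (fun n => ∫⁻ ω, (Measure.pi fun _ : Fin (B n) => law n ω)
      {t | v ≤ Nat.card {j : Fin m // j ∈ I ∧
        ((amcCutoff v α t : ℝ) : EReal) < T n ω j}} ∂P) atTop ≤ ENNReal.ofReal α := by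
  -- With fewer than `v` true hypotheses the error event is empty.
  rcases lt_or_ge (Nat.card I) v with hI | hI
  · have h0 : ∀ n ω, {t : Fin (B n) → Fin m → ℝ | v ≤ Nat.card {j : Fin m // j ∈ I ∧
        ((amcCutoff v α t : ℝ) : EReal) < T n ω j}} = ∅ := fun n ω =>
      Set.eq_empty_of_forall_notMem fun t ht =>
        absurd (le_trans ht (card_subtype_mono fun j hj => hj.1)) (not_le.2 hI)
    simp [h0]
  suffices hδ : ∀ δ : ℝ, 0 < δ → δ < 1 - α →
      limsup (fun n => ∫⁻ ω, (Measure.pi fun _ : Fin (B n) => law n ω)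
        {t | v ≤ Nat.card {j : Fin m // j ∈ I ∧
          ((amcCutoff v α t : ℝ) : EReal) < T n ω j}} ∂P) atTop ≤ ENNReal.ofReal (α + 5 * δ) by
    have hlim : Tendsto (fun δ : ℝ => ENNReal.ofReal (α + 5 * δ)) (𝓝[>] 0)
        (𝓝 (ENNReal.ofReal α)) := by
      have hc : Continuous fun δ : ℝ => ENNReal.ofReal (α + 5 * δ) :=
        ENNReal.continuous_ofReal.comp (by fun_prop)
      exact (hc.tendsto' 0 _ (by simp)).mono_left nhdsWithin_le_nhds
    refine ge_of_tendsto hlim ?_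
    filter_upwards [self_mem_nhdsWithin,
      nhdsWithin_le_nhds ((gt_mem_nhds (by linarith : (0 : ℝ) < 1 - α)))] with δ h1 h2
    exact hδ δ h1 h2
  intro δ hδ0 hδ1
  -- The margin `δ` above `α` separates the cutoff from `c`: with high probability the simulated
  -- fraction beyond `c` exceeds `α`.
  obtain ⟨c, hc⟩ := exists_exceedSet_eq (I := I) hμ hv hI (by linarith : 0 < α + δ) (by linarith)
  obtain ⟨η₀, hη₀, hosc⟩ := exists_cdf_osc_small hμ (ENNReal.ofReal_pos.2 (by positivity : 0 < δ / 4))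
  set η := min (δ / 4) (η₀ / 2) with hη
  have hη0 : 0 < η := lt_min (by positivity) (half_pos hη₀)
  have hηδ : η ≤ δ / 4 := min_le_left _ _
  have hηη : η ≤ η₀ / 2 := min_le_right _ _
  have hstep : ∀ c' η', η' ≤ η₀ →
      μ.real (exceedSet I v c') ≤ μ.real (exceedSet I v (c' + η')) + δ / 4 := by
    intro c' η' h'
    have hsub : exceedSet I v c' ⊆ exceedSet I v (c' + η') ∪ {t | ∃ j, |t j - c'| ≤ η₀} :=
      exceedSet_subset_union.trans (Set.union_subset_union_left _ (exceedSet_anti (by linarith)))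
    refine (measureReal_mono hsub).trans ((measureReal_union_le _ _).trans ?_)
    gcongr
    exact ENNReal.toReal_le_of_le_ofReal (by positivity) (hosc fun _ => c')
  have hcheb : Tendsto (fun n => ENNReal.ofReal (1 / (B n * (δ / 2) ^ 2))) atTop (𝓝 0) := by
    have h1 : Tendsto (fun n => (B n : ℝ) * (δ / 2) ^ 2) atTop atTop :=
      (tendsto_natCast_atTop_atTop.comp hB).atTop_mul_const (by positivity)
    have h2 := ENNReal.tendsto_ofReal (h1.const_div_atTop 1)
    simpa using h2
  refine limsup_le_of_le (by isBoundedDefault) ?_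
  filter_upwards [hQ η hη0, (hT η hη0).eventually_le (ENNReal.ofReal_pos.2 hδ0),
    (hlaw η hη0).eventually_le (ENNReal.ofReal_pos.2 hδ0),
    hcheb.eventually_le_const (ENNReal.ofReal_pos.2 hδ0), hB.eventually_gt_atTop 0]
    with n hn hbT hbl hch hBn
  set badL : Set Ω := {ω | ¬ ∀ B, MeasurableSet B →
      law n ω B ≤ μ (Metric.thickening η B) + ENNReal.ofReal η ∧
      μ B ≤ law n ω (Metric.thickening η B) + ENNReal.ofReal η} with hbadL
  set badT : Set Ω := {ω | ¬ ∀ j ∈ I, T n ω j ≤ ((Q n ω j + η : ℝ) : EReal)} with hbadT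
  -- Off `A` both approximations hold and fewer than `v` true components of `Q n` exceed `c - η`, so
  -- an error requires a cutoff below `c`.
  set A : Set Ω := badL ∪ (badT ∪ Q n ⁻¹' exceedSet I v (c - η)) with hA
  have hPQ : P (Q n ⁻¹' exceedSet I v (c - η)) ≤ ENNReal.ofReal (α + 2 * δ) := by
    refine (hn _ (measurableSet_exceedSet _)).1.trans ?_
    have h1 : μ (Metric.thickening η (exceedSet I v (c - η))) ≤ ENNReal.ofReal (α + δ + δ / 4) := by
      have e : c - η = c - (η + η) + η := by ring
      rw [e]
      refine (measure_mono (thickening_exceedSet_subset _ _)).trans ?_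
      rw [ENNReal.le_ofReal_iff_toReal_le (measure_ne_top _ _) (by positivity)]
      have h2 := hstep (c - (η + η)) (η + η) (by linarith)
      rw [sub_add_cancel, hc] at h2
      exact h2
    refine (add_le_add_left h1 _).trans ?_
    rw [← ENNReal.ofReal_add (by positivity) hη0.le]
    exact ENNReal.ofReal_le_ofReal (by linarith)
  have hPA : P A ≤ ENNReal.ofReal (α + 4 * δ) := by
    refine (measure_union_le _ _).trans ((add_le_add hbl ((measure_union_le _ _).trans
      (add_le_add hbT hPQ))).trans ?_)
    rw [← ENNReal.ofReal_add hδ0.le (by positivity), ← ENNReal.ofReal_add hδ0.le (by positivity)]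
    exact ENNReal.ofReal_le_ofReal (by linarith)
  -- `A` need not be measurable, so its measurable hull, of the same measure, is used for
  -- integration.
  have hint : ∀ ω, (Measure.pi fun _ : Fin (B n) => law n ω)
      {t | v ≤ Nat.card {j : Fin m // j ∈ I ∧ ((amcCutoff v α t : ℝ) : EReal) < T n ω j}} ≤
      (toMeasurable P A).indicator 1 ω + ENNReal.ofReal δ := by
    intro ω
    by_cases hω : ω ∈ A
    · rw [Set.indicator_of_mem (subset_toMeasurable P A hω)]
      exact prob_le_one.trans le_self_add
    refine le_trans ?_ le_add_self
    rw [hA, Set.mem_union, Set.mem_union, not_or, not_or, hbadL, hbadT, Set.mem_ofPred_eq,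
      Set.mem_ofPred_eq, not_not, not_not] at hω
    obtain ⟨hL, hTω, hQω⟩ := hω
    have hlaw_c : α + δ / 2 ≤ (law n ω).real (exceedSet I v c) := by
      have h1 := (hL (exceedSet I v (c + η)) (measurableSet_exceedSet _)).2
      have h2 : μ (exceedSet I v (c + η)) ≤ law n ω (exceedSet I v c) + ENNReal.ofReal η :=
        h1.trans (by gcongr; exact thickening_exceedSet_subset c η)
      have h3 := ENNReal.toReal_mono (by finiteness) h2
      rw [ENNReal.toReal_add (measure_ne_top _ _) (by finiteness), ENNReal.toReal_ofReal hη0.le]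
        at h3
      have h4 := hstep c η (by linarith)
      rw [hc] at h4
      change μ.real (exceedSet I v (c + η)) ≤ (law n ω).real (exceedSet I v c) + η at h3
      linarith
    refine le_trans (measure_mono fun t ht => ?_) ((pi_card_mem_le
      (measurableSet_exceedSet (I := I) (v := v) c) hBn (half_pos hδ0) hlaw_c).trans hch)
    have hcut : amcCutoff v α t < c := by
      by_contra hge
      rw [not_lt] at hge
      refine hQω (le_trans ht (card_subtype_mono fun j hj => ⟨hj.1, ?_⟩))
      have h1 := hj.2.trans_le (hTω j hj.1)
      rw [EReal.coe_lt_coe_iff] at h1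
      linarith
    refine le_trans ?_ (card_exceed_le_of_amcCutoff_lt hv hα hcut)
    -- Counting exceedances over all components, not only those in `I`, can only increase the count.
    have h1 : Nat.card {b : Fin (B n) // t b ∈ exceedSet I v c} ≤
        Nat.card {b : Fin (B n) // v ≤ Nat.card {j : Fin m // c < t b j}} :=
      card_subtype_mono fun b hb => le_trans hb (card_subtype_mono fun j hj => hj.2)
    exact_mod_cast h1
  calc ∫⁻ ω, (Measure.pi fun _ : Fin (B n) => law n ω)
        {t | v ≤ Nat.card {j : Fin m // j ∈ I ∧ ((amcCutoff v α t : ℝ) : EReal) < T n ω j}} ∂P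
      ≤ ∫⁻ ω, ((toMeasurable P A).indicator 1 ω + ENNReal.ofReal δ) ∂P := lintegral_mono hint
    _ = P A + ENNReal.ofReal δ := by
        rw [lintegral_add_right _ measurable_const,
          lintegral_indicator_one (measurableSet_toMeasurable P A), measure_toMeasurable]
        simp
    _ ≤ ENNReal.ofReal (α + 4 * δ) + ENNReal.ofReal δ := by gcongr
    _ = ENNReal.ofReal (α + 5 * δ) := by
        rw [← ENNReal.ofReal_add (by positivity) hδ0.le]; congr 1; ring

end Consistency

/-! ### The limit law of the statistics and of the simulated statistics -/

section Limit

variable {𝒳 : Type*} {p m : ℕ} {q : Fin m → ℕ} {g : 𝒳 → Vec p → Vec p}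

lemma meanS_posSemidef {n : ℕ} (x : Fin n → 𝒳) (θ : Vec p) : (meanS g x θ).PosSemidef := by
  refine Matrix.PosSemidef.of_dotProduct_mulVec_nonneg ?_ fun y => ?_
  · ext k l
    simp [meanS, mul_comm]
  · have h : star y ⬝ᵥ (meanS g x θ *ᵥ y) = qf (meanS g x θ) (WithLp.toLp 2 y) := by simp [qf]
    rw [h, qf_eq_inner, mv_meanS, inner_smul_right, inner_sum]
    simp_rw [inner_smul_right]
    exact mul_nonneg (by positivity) (Finset.sum_nonneg fun i _ => mul_self_nonneg _)

variable {Ω : Type*} [MeasurableSpace Ω] {P : Measure Ω} {X : ℕ → Ω → 𝒳}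
  {N : Set (Vec p)} {θ₀ : Vec p} {V : Vec p → Matrix (Fin p) (Fin p) ℝ}
  {L : (j : Fin m) → Matrix (Fin (q j)) (Fin p) ℝ}

/-- Once `θ̂` is in `N`, uniform convergence removes the dependence of `S_n` on the estimator, and
continuity of `V` at `θ₀` does the rest. -/
lemma whp_frobNorm_meanS_sub_le (hN : IsOpen N) (hθ₀N : θ₀ ∈ N)
    (hV_unif : TendsToZeroInProb P fun n ω => ⨆ θ ∈ N, ENNReal.ofReal
      (frobNorm (meanS g (sample X n ω) θ - V θ)))
    (hVc : Tendsto (fun θ => frobNorm (V θ - V θ₀)) (𝓝 θ₀) (𝓝 0))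
    {θhat : ℕ → Ω → Vec p} (hcons : TendstoInMeasure P θhat atTop (fun _ => θ₀))
    {δ : ℝ} (hδ : 0 < δ) :
    WHP P fun n ω => frobNorm (meanS g (sample X n ω) (θhat n ω) - V θ₀) ≤ δ := by
  have hev : ∀ᶠ θ in 𝓝 θ₀, θ ∈ N ∧ frobNorm (V θ - V θ₀) < δ / 2 :=
    (hN.eventually_mem hθ₀N).and (hVc.eventually_lt_const (half_pos hδ))
  obtain ⟨ρ, hρ, hball⟩ := Metric.eventually_nhds_iff.1 hev
  have hdist : WHP P fun n ω => dist (θhat n ω) θ₀ < ρ := by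
    simpa only [WHP, not_lt] using tendstoInMeasure_iff_dist.1 hcons ρ hρ
  refine (hdist.and (hV_unif.whp (half_pos hδ))).mono (.of_forall fun n ω hω => ?_)
  obtain ⟨h1, h2⟩ := hball hω.1
  have h3 := hω.2 _ h1
  exact (frobNorm_sub_le _ (V (θhat n ω)) _).trans (by linarith)

lemma whp_amcLaw_close (hN : IsOpen N) (hθ₀N : θ₀ ∈ N) (hV_pos : (V θ₀).PosDef)
    (hV_unif : TendsToZeroInProb P fun n ω => ⨆ θ ∈ N, ENNReal.ofReal
      (frobNorm (meanS g (sample X n ω) θ - V θ)))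
    (hVc : Tendsto (fun θ => frobNorm (V θ - V θ₀)) (𝓝 θ₀) (𝓝 0))
    {θhat : ℕ → Ω → Vec p} (hcons : TendstoInMeasure P θhat atTop (fun _ => θ₀))
    (hL : ∀ j, (L j).rank = q j) {η : ℝ} (hη : 0 < η) :
    WHP P fun n ω => ∀ B, MeasurableSet B →
      amcLaw L (meanS g (sample X n ω) (θhat n ω)) B ≤
        amcLaw L (V θ₀) (Metric.thickening η B) + ENNReal.ofReal η ∧
      amcLaw L (V θ₀) B ≤
        amcLaw L (meanS g (sample X n ω) (θhat n ω)) (Metric.thickening η B) +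
          ENNReal.ofReal η := by
  obtain ⟨δ, hδ, hclose⟩ := exists_amcLaw_close hV_pos hL hη
  exact (whp_frobNorm_meanS_sub_le hN hθ₀N hV_unif hVc hcons hδ).mono
    (.of_forall fun n ω hω => hclose _ (meanS_posSemidef _ _) hω)

/-- Continuous mapping, applied to all quadratic forms jointly; this retains their dependence. -/
lemma eventually_law_qf_close [IsProbabilityMeasure P] {S : Matrix (Fin p) (Fin p) ℝ}
    {Z : ℕ → Ω → Vec p}
    (h : TendstoInDistribution Z atTop id (fun _ => P) (multivariateGaussian (0 : Vec p) S))
    {η : ℝ} (hη : 0 < η) :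
    ∀ᶠ n in atTop, ∀ B, MeasurableSet B →
      P ((fun ω j => qf (quadMatrix (L j) S) (Z n ω)) ⁻¹' B) ≤
        amcLaw L S (Metric.thickening η B) + ENNReal.ofReal η ∧
      amcLaw L S B ≤
        P ((fun ω j => qf (quadMatrix (L j) S) (Z n ω)) ⁻¹' Metric.thickening η B) +
          ENNReal.ofReal η := by
  have hF : Continuous fun (z : Vec p) (j : Fin m) => qf (quadMatrix (L j) S) z :=
    continuous_pi fun j => continuous_qf _
  have hd := h.continuous_comp hF
  filter_upwards [eventually_measure_le_thickening hd.tendsto hη] with n hn B hB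
  have hm := hd.forall_aemeasurable n
  have h1 := hn B hB
  simp only [ProbabilityMeasure.coe_mk] at h1
  rw [Measure.map_apply_of_aemeasurable hm hB,
    Measure.map_apply_of_aemeasurable hm Metric.isOpen_thickening.measurableSet] at h1
  exact h1

end Limit

end EmpLik

end

/-! ### The main theorem -/

theorem theorem2
    -- the probability space and the data `X_1, X_2, …` (neither independent nor identically
    -- distributed in general)
    {Ω : Type*} [MeasurableSpace Ω] (P : Measure Ω) [IsProbabilityMeasure P]
    {𝒳 : Type*} [MeasurableSpace 𝒳] (X : ℕ → Ω → 𝒳) (hX : ∀ i, Measurable (X i))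
    -- the parameter set, the true parameter, the estimating function, and its mean `G`
    {p : ℕ} (Θ : Set (Vec p)) (θ₀ : Vec p) (hθ₀ : θ₀ ∈ interior Θ)
    (g : 𝒳 → Vec p → Vec p) (hg : ∀ θ, Measurable fun x => g x θ)
    (N : Set (Vec p)) (hN : IsOpen N) (hθ₀N : θ₀ ∈ N)
    (G : Vec p → Vec p)
    (hG_int : ∀ θ ∈ N, ∀ i, Integrable (fun ω => g (X i ω) θ) P)
    (hG_mean : ∀ θ ∈ N, Tendsto
      (fun n : ℕ => (n : ℝ)⁻¹ • ∑ i ∈ Finset.range n, ∫ ω, g (X i ω) θ ∂P) atTop (𝓝 (G θ)))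
    (hG_zero : G θ₀ = 0)
    -- the normalizing sequence
    (a : ℕ → ℝ) (ha_pos : ∀ n, 0 < a n) (ha : Tendsto a atTop atTop)
    -- convex hull condition
    (h_hull : Tendsto (fun n => P {ω | (0 : Vec p) ∈
      interior (convexHull ℝ (Set.range fun i : Fin n => g (sample X n ω i) θ₀))}) atTop (𝓝 1))
    -- smoothness and uniform consistency of the Jacobian
    (h_smooth : ∀ᵐ ω ∂P, ∀ i, ContDiffOn ℝ 1 (g (X i ω)) N)
    (hG_smooth : ContDiffOn ℝ 1 G N)
    (h_jac : TendsToZeroInProb P fun n ω => ⨆ θ ∈ N, ENNReal.ofReal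
      (frobNorm (jacobian (meanG g (sample X n ω)) θ - jacobian G θ)))
    (hG_nonsing : IsUnit (jacobian G θ₀).det)
    -- consistent covariance estimation
    (V : Vec p → Matrix (Fin p) (Fin p) ℝ) (hV_pos : (V θ₀).PosDef)
    (hV_unif : TendsToZeroInProb P fun n ω => ⨆ θ ∈ N, ENNReal.ofReal
      (frobNorm (meanS g (sample X n ω) θ - V θ)))
    (hV_cont : ∀ b : ℕ → ℝ, (∀ n, 0 < b n) → Antitone b → Tendsto b atTop (𝓝 0) →
      Tendsto (fun n => ⨆ θ ∈ Metric.closedBall θ₀ (b n),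
        ENNReal.ofReal (frobNorm (V θ - V θ₀))) atTop (𝓝 0))
    -- asymptotic normality
    (h_clt : TendstoInDistribution (fun n ω => a n • meanG g (sample X n ω) θ₀) atTop
      id (fun _ => P) (multivariateGaussian (0 : Vec p) (V θ₀)))
    -- maximum bounds
    (h_max : IsSmallOInProb P
      (fun n ω => ⨆ i : Fin n, ENNReal.ofReal ‖g (sample X n ω i) θ₀‖) a)
    (h_max_jac : IsBigOInProb P
      (fun n ω => ⨆ i : Fin n,
        ENNReal.ofReal (frobNorm (jacobian (g (sample X n ω i)) θ₀))) a)
    -- if `a` is not at least of the order `√n`, the last bound holds uniformly on `N`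
    (h_max_unif : ((fun n : ℕ => √(n : ℝ)) =O[atTop] a) ∨
      IsBigOInProb P (fun n ω => ⨆ i : Fin n, ⨆ θ ∈ N,
        ENNReal.ofReal (frobNorm (jacobian (g (sample X n ω i)) θ))) a)
    -- the hypotheses `H_j = {θ ∈ Θ : h_j(θ) = 0}`
    {m : ℕ} (q : Fin m → ℕ) (hq : ∀ j, 1 ≤ q j) (h : (j : Fin m) → Vec p → Vec (q j))
    (hh_smooth : ∀ j, ContDiffOn ℝ 1 (h j) N)
    (hh_rank : ∀ j, (jacobian (h j) θ₀).rank = q j) :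
    -- for some sequence of balls of radius `K_n / a_n` around `θ₀`, and with
    -- `T n ω j` denoting the empirical likelihood statistic of `H_j`
    ∃ K : ℕ → ℝ, (∀ n, 0 < K n) ∧ Tendsto K atTop atTop ∧
      Tendsto (fun n => K n / a n) atTop (𝓝 0) ∧
      ∀ T : ℕ → Ω → Fin m → EReal,
      (∀ n ω j, T n ω j =
        elStat g (sample X n ω) (a n) (nullSet Θ (h j)) θ₀ (K n / a n)) →
      -- for every consistent estimator, and with `law n ω` denoting the conditional law of the
      -- simulated statistics
      ∀ θhat : (n : ℕ) → (Fin n → 𝒳) → Vec p, (∀ n, Measurable (θhat n)) →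
      TendstoInMeasure P (fun n ω => θhat n (sample X n ω)) atTop (fun _ => θ₀) →
      ∀ law : ℕ → Ω → Measure (Fin m → ℝ),
      (∀ n ω, law n ω = amcLaw (fun j => jacobian (h j) θ₀ * (jacobian G θ₀)⁻¹)
        (meanS g (sample X n ω) (θhat n (sample X n ω)))) →
      -- consistency under the complete null hypothesis
      ((∀ j, θ₀ ∈ nullSet Θ (h j)) →
        TendsToZeroInProb P fun n ω => ⨆ x : {x : Fin m → ℝ // 0 ≤ x}, ENNReal.ofReal
          |(law n ω).real (Set.Iic x.1) - P.real {ω' | ∀ j, T n ω' j ≤ ((x.1 j : ℝ) : EReal)}|) ∧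
      -- asymptotic control of the generalized family-wise error rate, whichever hypotheses are
      -- true, with cutoffs from `B n → ∞` independent draws from the conditional law
      (∀ v : ℕ, 1 ≤ v → v ≤ m → ∀ α : ℝ, 0 < α → α < 1 →
        ∀ B : ℕ → ℕ, Tendsto B atTop atTop →
        limsup (fun n => ∫⁻ ω, (Measure.pi fun _ : Fin (B n) => law n ω)
          {t | v ≤ Nat.card {j : Fin m // θ₀ ∈ nullSet Θ (h j) ∧
            ((amcCutoff v α t : ℝ) : EReal) < T n ω j}} ∂P) atTop ≤ ENNReal.ofReal α) := by
  have hVc := tendsto_of_forall_antitone hV_cont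
  obtain ⟨K, hK0, hK, hKa, happrox⟩ := exists_radius (h := h) hθ₀ hN hθ₀N ha_pos ha h_smooth
    hG_smooth h_jac hG_nonsing hV_pos hV_unif hVc h_clt h_max h_max_unif hh_smooth hh_rank
  refine ⟨K, hK0, hK, hKa, fun T hT θhat _ hcons law hlaw => ?_⟩
  set L := fun j => jacobian (h j) θ₀ * (jacobian G θ₀)⁻¹ with hLdef
  have hL : ∀ j, (L j).rank = q j := fun j => by
    rw [hLdef, Matrix.rank_mul_eq_left_of_isUnit_det _ _
      (Matrix.isUnit_nonsing_inv_det _ hG_nonsing), hh_rank]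
  have hprob : ∀ n ω, IsProbabilityMeasure (law n ω) := fun n ω => by
    rw [hlaw]; infer_instance
  have hμ := amcLaw_eval_eq_zero (L := L) hV_pos hL hq
  have hQ := fun (η : ℝ) (hη : 0 < η) => eventually_law_qf_close (L := L) h_clt hη
  have hlawc : ∀ η : ℝ, 0 < η → WHP P fun n ω => ∀ B, MeasurableSet B →
      law n ω B ≤ amcLaw L (V θ₀) (Metric.thickening η B) + ENNReal.ofReal η ∧
      amcLaw L (V θ₀) B ≤ law n ω (Metric.thickening η B) + ENNReal.ofReal η := fun η hη => by
    simp only [hlaw]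
    exact whp_amcLaw_close hN hθ₀N hV_pos hV_unif hVc hcons hL hη
  refine ⟨fun hall => tendsToZeroInProb_cdf_sub hμ hQ hlawc fun η hη => ?_,
    fun v hv _ α hα hα1 B hB => limsup_exceed_le (I := {j | θ₀ ∈ nullSet Θ (h j)})
      hμ hQ hlawc (fun η hη => ?_) hv hα hα1 hB⟩
  · refine (happrox η hη).mono (.of_forall fun n ω hω j => ?_)
    rw [hT]
    exact hω j (hall j)
  -- Error control needs only the upper half of the approximation, and only for true hypotheses.
  · refine (happrox η hη).mono (.of_forall fun n ω hω j hj => ?_)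
    rw [hT]
    exact (hω j hj).2
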